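/- **Theorem 4.1.** Let $\mathbb H$ be the real quaternions and $\eta\in\{\mathbf i,\mathbf j,\mathbf k\}$. For a quaternion matrix $A$ let $A^{*}$ be the conjugate transpose, $A^{\eta^*}=-\eta A^{*}\eta$, $A^\dagger$ the Moore–Penrose inverse, $L_A=I-A^\dagger A$, $R_A=I-AA^\dagger$, and $r(A)$ the rank; $A$ is $\eta$-Hermitian if $A=A^{\eta^*}$. Let $A_1\in\mathbb H^{m_1\times n_1}$, $C_1\in\mathbb H^{m_1\times p}$, $A_i,C_i\in\mathbb H^{m_i\times n_i}$ $(i=2,3,4)$, $E_i\in\mathbb H^{p\times n_i}$ $(i=1,\dots,4)$ and $C_c\in\mathbb H^{p\times p}$ be given, and consider the system, in the unknowns $U\in\mathbb H^{n_1\times p}$, $X\in\mathbb H^{n_2\times n_2}$, $Y\in\mathbb H^{n_3\times n_3}$, $Z\in\mathbb H^{n_4\times n_4}$, $$\begin{aligned}&A_1U=C_1,\quad A_2X=C_2,\ X=X^{\eta^*},\quad A_3Y=C_3,\ Y=Y^{\eta^*},\quad A_4Z=C_4,\ Z=Z^{\eta^*},\\ &E_1U+(E_1U)^{\eta^*}+E_2XE_2^{\eta^*}+E_3YE_3^{\eta^*}+E_4ZE_4^{\eta^*}=C_c.\end{aligned}\tag{S}$$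 Set $A_{ii}=E_iL_{A_i}$ $(i=1,\dots,4)$, $A_{1j}=R_{A_{11}}A_{jj}$ $(j=2,3,4)$, $M_1=R_{A_{12}}A_{13}$, $S_1=A_{13}L_{M_1}$, $$T_1=C_c-E_1A_1^\dagger C_1-C_1^{\eta^*}(A_1^{\eta^*})^\dagger E_1^{\eta^*}-\sum_{i=2}^4E_i\bigl(A_i^\dagger C_i+L_{A_i}C_i^{\eta^*}(A_i^{\eta^*})^\dagger\bigr)E_i^{\eta^*},\qquad T_2=R_{A_{11}}T_1(R_{A_{11}})^{\eta^*},$$ $G=R_{M_1}R_{A_{12}}$, $G_1=GA_{14}$, $G_2=R_{A_{12}}A_{14}$, $G_3=R_{A_{13}}A_{14}$, $G_4=A_{14}$, $L_1=GT_2$, $L_2=R_{A_{12}}T_2(R_{A_{13}})^{\eta^*}$, $L_3=R_{A_{13}}T_2(R_{A_{12}})^{\eta^*}$, $L_4=T_2G^{\eta^*}$, $C_{11}=(L_{G_2},\,L_{G_4})$, $C_{22}=L_{G_1}$, $C_{33}=L_{G_3}$, $E_{11}=R_{C_{11}}C_{22}$, $E_{22}=R_{C_{11}}C_{33}$, $M=R_{E_{11}}E_{22}$,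 $N=(R_{E_{22}}E_{11})^{\eta^*}$, $S=E_{22}L_M$, $F_1=G_1^\dagger L_1(G_4^{\eta^*})^\dagger+L_{G_1}G_2^\dagger L_2(G_3^{\eta^*})^\dagger$, $F_2=G_3^\dagger L_3(G_2^{\eta^*})^\dagger+L_{G_3}G_4^\dagger L_4(G_1^{\eta^*})^\dagger$, $F=F_2-F_1$, $E=R_{C_{11}}F(R_{C_{11}})^{\eta^*}$, and $P_i=C_iE_i^{\eta^*}$ $(i=2,3,4)$. The following three statements are equivalent. (1) The system (S) has a solution. (2) $C_c=C_c^{\eta^*}$, $A_iC_i^{\eta^*}=C_iA_i^{\eta^*}$ $(i=2,3,4)$, and $$R_{E_{22}}E(R_{E_{22}})^{\eta^*}=0,\qquad R_{A_i}C_i=0,\quad R_{G_i}L_i=0\quad(i=1,\dots,4).$$ (3) $C_c=C_c^{\eta^*}$, $A_iC_i^{\eta^*}=C_iA_i^{\eta^*}$ $(i=2,3,4)$, $r(C_i,\ A_i)=r(A_i)$ $(i=1,\dots,4)$, and the following five rank equalities hold (the second display stands for two of them): $$r\begin{pmatrix}C_c&E_1&E_2&E_3&E_4&C_1^{\eta^*}\\E_1^{\eta^*}&0&0&0&0&A_1^{\eta^*}\\C_1&A_1&0&0&0&0\\P_2&0&A_2&0&0&0\\P_3&0&0&A_3&0&0\\P_4&0&0&0&A_4&0\end{pmatrix}=r\begin{pmatrix}E_1&E_2&E_3&E_4\\A_1&0&0&0\\0&A_2&0&0\\0&0&A_3&0\\0&0&0&A_4\end{pmatrix}+r\begin{pmatrix}E_1\\A_1\end{pmatrix},$$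 $$r\begin{pmatrix}C_c&E_4&E_a&E_1&P_b^{\eta^*}&C_1^{\eta^*}\\E_b^{\eta^*}&0&0&0&A_b^{\eta^*}&0\\E_1^{\eta^*}&0&0&0&0&A_1^{\eta^*}\\P_4&A_4&0&0&0&0\\P_a&0&A_a&0&0&0\\C_1&0&0&A_1&0&0\end{pmatrix}=r\begin{pmatrix}E_4&E_a&E_1\\A_4&0&0\\0&A_a&0\\0&0&A_1\end{pmatrix}+r\begin{pmatrix}E_b&E_1\\A_b&0\\0&A_1\end{pmatrix}\quad\text{for }(a,b)=(2,3)\text{ and }(a,b)=(3,2),$$ $$r\begin{pmatrix}C_c&E_4&E_1&P_3^{\eta^*}&P_2^{\eta^*}&C_1^{\eta^*}\\E_3^{\eta^*}&0&0&A_3^{\eta^*}&0&0\\E_2^{\eta^*}&0&0&0&A_2^{\eta^*}&0\\E_1^{\eta^*}&0&0&0&0&A_1^{\eta^*}\\P_4&A_4&0&0&0&0\\C_1&0&A_1&0&0&0\end{pmatrix}=r\begin{pmatrix}E_3&E_2&E_1\\A_3&0&0\\0&A_2&0\\0&0&A_1\end{pmatrix}+r\begin{pmatrix}E_4&E_1\\A_4&0\\0&A_1\end{pmatrix},$$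 $$r\left(\begin{array}{cccccccccccc}C_c&E_2&E_1&0&0&0&E_4&P_3^{\eta^*}&C_1^{\eta^*}&0&0&P_4^{\eta^*}\\E_3^{\eta^*}&0&0&0&0&0&0&A_3^{\eta^*}&0&0&0&0\\E_1^{\eta^*}&0&0&0&0&0&0&0&A_1^{\eta^*}&0&0&0\\0&0&0&C_c&E_3&E_1&E_4&0&0&P_2^{\eta^*}&C_1^{\eta^*}&0\\0&0&0&E_2^{\eta^*}&0&0&0&0&0&A_2^{\eta^*}&0&0\\0&0&0&E_1^{\eta^*}&0&0&0&0&0&0&A_1^{\eta^*}&0\\E_4^{\eta^*}&0&0&-E_4^{\eta^*}&0&0&0&0&0&0&0&A_4^{\eta^*}\\P_2&A_2&0&0&0&0&0&0&0&0&0&0\\C_1&0&A_1&0&0&0&0&0&0&0&0&0\\0&0&0&P_3&A_3&0&0&0&0&0&0&0\\0&0&0&C_1&0&A_1&0&0&0&0&0&0\\0&0&0&P_4&0&0&A_4&0&0&0&0&0\end{array}\right)=2\,r\begin{pmatrix}E_2&E_1&0&0&E_4\\0&0&E_3&E_1&E_4\\A_2&0&0&0&0\\0&A_1&0&0&0\\0&0&A_3&0&0\\0&0&0&A_1&0\\0&0&0&0&A_4\end{pmatrix}.$$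 Suppose that (S) has a solution. Then $(U,X,Y,Z)$ is a solution if and only if it has the form $$U=\tfrac12\bigl(\tilde U+\tilde V^{\eta^*}\bigr),\quad X=\tfrac12\bigl(\tilde X+\tilde X^{\eta^*}\bigr),\quad Y=\tfrac12\bigl(\tilde Y+\tilde Y^{\eta^*}\bigr),\quad Z=\tfrac12\bigl(\tilde Z+\tilde Z^{\eta^*}\bigr)$$ for some choice of the matrices $W_{11},W_{13}\in\mathbb H^{p\times n_1}$, $W_{12}\in\mathbb H^{n_1\times p}$, $U_5,U_6\in\mathbb H^{n_2\times n_2}$, $U_4,U_7,U_8\in\mathbb H^{n_3\times n_3}$, $U_{11},U_{21}\in\mathbb H^{n_4\times 2n_4}$, $U_{12}\in\mathbb H^{2n_4\times n_4}$, $U_{31},U_{32},U_{33},U_{41},U_{42}\in\mathbb H^{n_4\times n_4}$, where $$\begin{aligned} \tilde U&=A_1^\dagger C_1+L_{A_1}\bigl(A_{11}^\dagger T_0-A_{11}^\dagger W_{11}A_{11}^{\eta^*}+L_{A_{11}}W_{12}\bigr),\\ \tilde V&=C_1^{\eta^*}(A_1^{\eta^*})^\dagger+\bigl(R_{A_{11}}T_0(A_{11}^{\eta^*})^\dagger+A_{11}A_{11}^\dagger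 W_{11}+W_{13}R_{A_{11}^{\eta^*}}\bigr)R_{A_1^{\eta^*}},\\ \tilde X&=A_2^\dagger C_2+L_{A_2}C_2^{\eta^*}(A_2^{\eta^*})^\dagger+L_{A_2}U_1(L_{A_2})^{\eta^*},\\ \tilde Y&=A_3^\dagger C_3+L_{A_3}C_3^{\eta^*}(A_3^{\eta^*})^\dagger+L_{A_3}U_2(L_{A_3})^{\eta^*},\\ \tilde Z&=A_4^\dagger C_4+L_{A_4}C_4^{\eta^*}(A_4^{\eta^*})^\dagger+L_{A_4}U_3(L_{A_4})^{\eta^*},\\ T_0&=T_1-A_{22}U_1A_{22}^{\eta^*}-A_{33}U_2A_{33}^{\eta^*}-A_{44}U_3A_{44}^{\eta^*},\\ U_1&=A_{12}^\dagger T(A_{12}^\dagger)^{\eta^*}-A_{12}^\dagger A_{13}M_1^\dagger T(A_{12}^\dagger)^{\eta^*}-A_{12}^\dagger S_1A_{13}^\dagger T(M_1^{\eta^*})^\dagger A_{13}^{\eta^*}(A_{12}^\dagger)^{\eta^*}\\ &\quad-A_{12}^\dagger S_1U_4R_{M_1^{\eta^*}}A_{13}^{\eta^*}(A_{12}^\dagger)^{\eta^*}+L_{A_{12}}U_5+U_6R_{A_{12}^{\eta^*}},\\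 U_2&=M_1^\dagger T(A_{13}^\dagger)^{\eta^*}+S_1^\dagger S_1A_{13}^\dagger T(M_1^\dagger)^{\eta^*}+L_{M_1}L_{S_1}U_7+U_8R_{A_{13}^{\eta^*}}+L_{M_1}U_4R_{M_1^{\eta^*}},\\ T&=T_2-A_{14}U_3A_{14}^{\eta^*},\\ U_3&=F_1+L_{G_2}V_1+V_2R_{G_4^{\eta^*}}+L_{G_1}V_3R_{G_3^{\eta^*}}\quad\text{or, equivalently,}\quad U_3=F_2-L_{G_4}W_1-W_2R_{G_2^{\eta^*}}-L_{G_3}W_3R_{G_1^{\eta^*}},\\ V_1&=(I,\ 0)\,Q,\qquad W_1=(0,\ I)\,Q,\qquad Q=C_{11}^\dagger K-\bigl(C_{11}^\dagger U_{11}C_{11}^{\eta^*}+L_{C_{11}}U_{12}\bigr),\\ W_2&=Q'\begin{pmatrix}I\\0\end{pmatrix},\qquad V_2=Q'\begin{pmatrix}0\\I\end{pmatrix},\qquad Q'=R_{C_{11}}K(C_{11}^{\eta^*})^\dagger+C_{11}C_{11}^\dagger U_{11}+U_{21}(L_{C_{11}})^{\eta^*},\\ K&=F-C_{22}V_3C_{33}^{\eta^*}-C_{33}W_3C_{22}^{\eta^*},\\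 V_3&=E_{11}^\dagger F(E_{22}^{\eta^*})^\dagger-E_{11}^\dagger E_{22}M^\dagger F(E_{22}^{\eta^*})^\dagger-E_{11}^\dagger SE_{22}^\dagger FN^\dagger E_{11}^{\eta^*}(E_{22}^{\eta^*})^\dagger\\ &\quad-E_{11}^\dagger SU_{31}R_NE_{11}^{\eta^*}(E_{22}^{\eta^*})^\dagger+L_{E_{11}}U_{32}+U_{33}(L_{E_{22}})^{\eta^*},\\ W_3&=M^\dagger F(E_{11}^{\eta^*})^\dagger+S^\dagger SE_{22}^\dagger FN^\dagger+L_ML_SU_{41}+L_MU_{31}R_N-U_{42}(L_{E_{11}})^{\eta^*}. \end{aligned}$$ The two expressions for $U_3$ agree for every choice of the arbitrary matrices, and for every choice $(\tilde U,\tilde V,\tilde X,\tilde Y,\tilde Z)$ solves the associated unconstrained system $A_1\tilde U=C_1$, $\tilde VA_1^{\eta^*}=C_1^{\eta^*}$, $A_2\tilde X=C_2$, $\tilde XA_2^{\eta^*}=C_2^{\eta^*}$, $A_3\tilde Y=C_3$, $\tilde YA_3^{\eta^*}=C_3^{\eta^*}$, $A_4\tilde Z=C_4$, $\tilde ZA_4^{\eta^*}=C_4^{\eta^*}$,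 $E_1\tilde U+\tilde VE_1^{\eta^*}+E_2\tilde XE_2^{\eta^*}+E_3\tilde YE_3^{\eta^*}+E_4\tilde ZE_4^{\eta^*}=C_c$. -/

import Mathlib

open scoped Quaternion Matrix

namespace EtaSylvester

noncomputable section

/-! ### Quaternion matrices: rank, `η`-conjugate transpose, Moore-Penrose inverse -/

/-- The rank of a quaternion matrix: the dimension of its left row space (which is also the
dimension of its right column space). -/
def rank {m n : Type*} (A : Matrix m n ℍ[ℝ]) : ℕ :=
  Module.finrank ℍ[ℝ] (Submodule.span ℍ[ℝ] (Set.range A.row))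

/-- `A^{η*} = -η A* η`, where `A*` is the conjugate transpose. -/
def etaStar {m n : Type*} (η : ℍ[ℝ]) (A : Matrix m n ℍ[ℝ]) : Matrix n m ℍ[ℝ] :=
  Aᴴ.map fun q => -(η * q * η)

/-- The four Penrose equations. -/
structure IsMoorePenrose {m n : Type*} [Fintype m] [Fintype n]
    (A : Matrix m n ℍ[ℝ]) (Y : Matrix n m ℍ[ℝ]) : Prop where
  mul_mul_left : A * Y * A = A
  mul_mul_right : Y * A * Y = Y
  left_hermitian : (A * Y)ᴴ = A * Y
  right_hermitian : (Y * A)ᴴ = Y * A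

theorem IsMoorePenrose.unique {m n : Type*} [Fintype m] [Fintype n]
    {A : Matrix m n ℍ[ℝ]} {Y Z : Matrix n m ℍ[ℝ]}
    (hY : IsMoorePenrose A Y) (hZ : IsMoorePenrose A Z) : Y = Z := by
  have h1 : A * Y = A * Z := by
    calc A * Y = (A * Y)ᴴ := hY.left_hermitian.symm
      _ = ((A * Z) * (A * Y))ᴴ := by rw [← Matrix.mul_assoc, hZ.mul_mul_left]
      _ = A * Y * (A * Z) := by
        rw [Matrix.conjTranspose_mul, hY.left_hermitian, hZ.left_hermitian]
      _ = A * Z := by rw [← Matrix.mul_assoc, hY.mul_mul_left]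
  have h2 : Y * A = Z * A := by
    calc Y * A = (Y * A)ᴴ := hY.right_hermitian.symm
      _ = ((Y * A) * (Z * A))ᴴ := by
        rw [Matrix.mul_assoc, ← Matrix.mul_assoc A, hZ.mul_mul_left]
      _ = Z * A * (Y * A) := by
        rw [Matrix.conjTranspose_mul, hY.right_hermitian, hZ.right_hermitian]
      _ = Z * A := by rw [Matrix.mul_assoc, ← Matrix.mul_assoc A, hY.mul_mul_left]
  calc Y = Y * A * Y := hY.mul_mul_right.symm
    _ = Z * A * Y := by rw [h2]
    _ = Z * (A * Z) := by rw [Matrix.mul_assoc, h1]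
    _ = Z := by rw [← Matrix.mul_assoc, hZ.mul_mul_right]

theorem eq_zero_of_conjTranspose_mul_self {m n : Type*} [Fintype m]
    (B : Matrix m n ℍ[ℝ]) (h : Bᴴ * B = 0) : B = 0 := by
  ext1 i j
  have h1 : (∑ k, Quaternion.normSq (B k j) : ℝ) = 0 := by
    have h2 := congrFun (congrFun h j) j
    rw [Matrix.mul_apply] at h2
    simp only [Matrix.conjTranspose_apply, Quaternion.star_mul_self, Matrix.zero_apply] at h2
    have h3 := map_sum (algebraMap ℝ ℍ[ℝ]) (fun k => Quaternion.normSq (B k j)) Finset.univ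
    exact Quaternion.coe_injective (h3.trans h2)
  have h4 := (Finset.sum_eq_zero_iff_of_nonneg
    (fun k _ => Quaternion.normSq_nonneg (a := B k j))).1 h1 i (Finset.mem_univ i)
  exact Quaternion.normSq_eq_zero.1 h4

theorem exists_mul_mul_self {m n : Type*} [Fintype m] [Fintype n] (A : Matrix m n ℍ[ℝ]) :
    ∃ G : Matrix n m ℍ[ℝ], A * G * A = A := by
  classical
  obtain ⟨g₀, hg₀⟩ := A.vecMulLinear.rangeRestrict.exists_rightInverse_of_surjective
    A.vecMulLinear.range_rangeRestrict
  obtain ⟨g, hg⟩ := LinearMap.exists_extend g₀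
  refine ⟨LinearMap.toMatrixRight' g, ?_⟩
  have key : ∀ x : m → ℍ[ℝ], A.vecMulLinear (g (A.vecMulLinear x)) = A.vecMulLinear x := by
    intro x
    have h1 : g (A.vecMulLinear x) = g₀ (A.vecMulLinear.rangeRestrict x) := by
      rw [← hg]; rfl
    have h2 := LinearMap.congr_fun hg₀ (A.vecMulLinear.rangeRestrict x)
    rw [h1]
    exact congrArg Subtype.val h2
  have hG : ∀ y, Matrix.vecMul y (LinearMap.toMatrixRight' g) = g y := by
    intro y
    have := LinearMap.congr_fun (LinearMap.toMatrixRight'.symm_apply_apply g) y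
    exact this
  have hrow : ∀ i, (A * LinearMap.toMatrixRight' g * A).row i = A.row i := by
    intro i
    have := key (Pi.single i 1)
    simp only [Matrix.vecMulLinear_apply, ← hG, Matrix.vecMul_vecMul,
      Matrix.single_one_vecMul] at this
    rw [← Matrix.single_one_vecMul i (A * _ * A), ← Matrix.vecMul_vecMul, ← Matrix.vecMul_vecMul,
      Matrix.single_one_vecMul, Matrix.vecMul_vecMul]
    exact this
  ext1 i j
  exact congrFun (hrow i) j

theorem exists_mul_mul_self_hermitian {m n : Type*} [Fintype m] [Fintype n]
    (A : Matrix m n ℍ[ℝ]) : ∃ X : Matrix n m ℍ[ℝ], A * X * A = A ∧ (A * X)ᴴ = A * X := by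
  obtain ⟨G, hG⟩ := exists_mul_mul_self (Aᴴ * A)
  have h1 : A * (G * Aᴴ) * A = A := by
    have h0 : Aᴴ * (A * (G * Aᴴ) * A - A) = 0 := by
      rw [Matrix.mul_sub, sub_eq_zero]
      simpa only [Matrix.mul_assoc] using hG
    refine sub_eq_zero.1 (eq_zero_of_conjTranspose_mul_self _ ?_)
    have h1 : (A * (G * Aᴴ) * A - A)ᴴ = (G * Aᴴ * A)ᴴ * Aᴴ - Aᴴ := by
      rw [← Matrix.conjTranspose_mul, ← Matrix.conjTranspose_sub]
      simp only [Matrix.mul_assoc]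
    rw [h1, Matrix.sub_mul, Matrix.mul_assoc, h0, Matrix.mul_zero, sub_zero]
  refine ⟨G * Aᴴ, h1, ?_⟩
  have h2 : Aᴴ * A * (Gᴴ * Aᴴ) = Aᴴ := by
    have := congrArg Matrix.conjTranspose h1
    simpa only [Matrix.conjTranspose_mul, Matrix.conjTranspose_conjTranspose,
      Matrix.mul_assoc] using this
  have h3 : A * (G * Aᴴ) = A * (Gᴴ * Aᴴ) := by
    calc A * (G * Aᴴ) = A * (G * Aᴴ) * A * (Gᴴ * Aᴴ) := by
          conv_lhs => rw [← h2]
          simp only [Matrix.mul_assoc]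
      _ = A * (Gᴴ * Aᴴ) := by rw [h1]
  rw [h3]
  conv_rhs => rw [← h3]
  simp only [Matrix.conjTranspose_mul, Matrix.conjTranspose_conjTranspose, Matrix.mul_assoc]

theorem exists_isMoorePenrose {m n : Type*} [Fintype m] [Fintype n] (A : Matrix m n ℍ[ℝ]) :
    ∃ Y, IsMoorePenrose A Y := by
  obtain ⟨X, hX, hX'⟩ := exists_mul_mul_self_hermitian A
  obtain ⟨W, hW, hW'⟩ := exists_mul_mul_self_hermitian Aᴴ
  have e1 : A * Wᴴ * A = A := by
    have := congrArg Matrix.conjTranspose hW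
    simpa only [Matrix.conjTranspose_mul, Matrix.conjTranspose_conjTranspose,
      Matrix.mul_assoc] using this
  have e2 : (Wᴴ * A)ᴴ = Wᴴ * A := by
    have := congrArg Matrix.conjTranspose hW'
    simpa only [Matrix.conjTranspose_mul, Matrix.conjTranspose_conjTranspose] using this
  have e3 : A * (Wᴴ * A * X) = A * X := by
    rw [← Matrix.mul_assoc, ← Matrix.mul_assoc, e1]
  have e4 : Wᴴ * A * X * A = Wᴴ * A := by
    rw [Matrix.mul_assoc, Matrix.mul_assoc, ← Matrix.mul_assoc A, hX]
  refine ⟨Wᴴ * A * X, ?_, ?_, ?_, ?_⟩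
  · rw [e3, hX]
  · rw [e4, ← Matrix.mul_assoc, Matrix.mul_assoc Wᴴ A, Matrix.mul_assoc Wᴴ,
      ← Matrix.mul_assoc A, e1, Matrix.mul_assoc]
  · rw [e3, hX']
  · rw [e4, e2]

/-- The Moore-Penrose inverse `A†`, the unique solution of the four Penrose equations. -/
def pinv {m n : Type*} [Fintype m] [Fintype n] (A : Matrix m n ℍ[ℝ]) : Matrix n m ℍ[ℝ] :=
  (exists_isMoorePenrose A).choose

theorem isMoorePenrose_pinv {m n : Type*} [Fintype m] [Fintype n] (A : Matrix m n ℍ[ℝ]) :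
    IsMoorePenrose A (pinv A) :=
  (exists_isMoorePenrose A).choose_spec

/-- The projector `L_A = I - A† A`. -/
def projL {m n : Type*} [Fintype m] [Fintype n] [DecidableEq n] (A : Matrix m n ℍ[ℝ]) :
    Matrix n n ℍ[ℝ] :=
  1 - pinv A * A

/-- The projector `R_A = I - A A†`. -/
def projR {m n : Type*} [Fintype m] [Fintype n] [DecidableEq m] (A : Matrix m n ℍ[ℝ]) :
    Matrix m m ℍ[ℝ] :=
  1 - A * pinv A

local infixr:64 " ┃ " => Matrix.fromCols
local infixr:62 " ⊟ " => Matrix.fromRows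
local postfix:max "†" => pinv

/-! ### The system of equations -/

/-- The given matrices of the system. -/
structure System (p m₁ m₂ m₃ m₄ n₁ n₂ n₃ n₄ : ℕ) where
  A₁ : Matrix (Fin m₁) (Fin n₁) ℍ[ℝ]
  A₂ : Matrix (Fin m₂) (Fin n₂) ℍ[ℝ]
  A₃ : Matrix (Fin m₃) (Fin n₃) ℍ[ℝ]
  A₄ : Matrix (Fin m₄) (Fin n₄) ℍ[ℝ]
  C₁ : Matrix (Fin m₁) (Fin p) ℍ[ℝ]
  C₂ : Matrix (Fin m₂) (Fin n₂) ℍ[ℝ]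
  C₃ : Matrix (Fin m₃) (Fin n₃) ℍ[ℝ]
  C₄ : Matrix (Fin m₄) (Fin n₄) ℍ[ℝ]
  E₁ : Matrix (Fin p) (Fin n₁) ℍ[ℝ]
  E₂ : Matrix (Fin p) (Fin n₂) ℍ[ℝ]
  E₃ : Matrix (Fin p) (Fin n₃) ℍ[ℝ]
  E₄ : Matrix (Fin p) (Fin n₄) ℍ[ℝ]
  Cc : Matrix (Fin p) (Fin p) ℍ[ℝ]

namespace System

variable {p m₁ m₂ m₃ m₄ n₁ n₂ n₃ n₄ : ℕ} (η : ℍ[ℝ]) (D : System p m₁ m₂ m₃ m₄ n₁ n₂ n₃ n₄)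

local postfix:max "ᵑ" => etaStar η

/-- `(U, X, Y, Z)` solves the system; in particular `X`, `Y`, `Z` are `η`-Hermitian. -/
structure IsSolution (U : Matrix (Fin n₁) (Fin p) ℍ[ℝ]) (X : Matrix (Fin n₂) (Fin n₂) ℍ[ℝ])
    (Y : Matrix (Fin n₃) (Fin n₃) ℍ[ℝ]) (Z : Matrix (Fin n₄) (Fin n₄) ℍ[ℝ]) : Prop where
  eq_U : D.A₁ * U = D.C₁
  eq_X : D.A₂ * X = D.C₂
  hermitian_X : X = Xᵑ
  eq_Y : D.A₃ * Y = D.C₃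
  hermitian_Y : Y = Yᵑ
  eq_Z : D.A₄ * Z = D.C₄
  hermitian_Z : Z = Zᵑ
  eq_main : D.E₁ * U + (D.E₁ * U)ᵑ + D.E₂ * X * D.E₂ᵑ + D.E₃ * Y * D.E₃ᵑ + D.E₄ * Z * D.E₄ᵑ
    = D.Cc

/-- `(U, V, X, Y, Z)` solves the associated unconstrained system, in which `V` stands for `U^{η*}`
and no matrix is required to be `η`-Hermitian. -/
structure IsUnconstrainedSolution
    (U : Matrix (Fin n₁) (Fin p) ℍ[ℝ]) (V : Matrix (Fin p) (Fin n₁) ℍ[ℝ])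
    (X : Matrix (Fin n₂) (Fin n₂) ℍ[ℝ]) (Y : Matrix (Fin n₃) (Fin n₃) ℍ[ℝ])
    (Z : Matrix (Fin n₄) (Fin n₄) ℍ[ℝ]) : Prop where
  eq_U : D.A₁ * U = D.C₁
  eq_V : V * D.A₁ᵑ = D.C₁ᵑ
  eq_X : D.A₂ * X = D.C₂
  eq_X' : X * D.A₂ᵑ = D.C₂ᵑ
  eq_Y : D.A₃ * Y = D.C₃
  eq_Y' : Y * D.A₃ᵑ = D.C₃ᵑ
  eq_Z : D.A₄ * Z = D.C₄
  eq_Z' : Z * D.A₄ᵑ = D.C₄ᵑ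
  eq_main : D.E₁ * U + V * D.E₁ᵑ + D.E₂ * X * D.E₂ᵑ + D.E₃ * Y * D.E₃ᵑ + D.E₄ * Z * D.E₄ᵑ
    = D.Cc

/-! ### The auxiliary matrices -/

def A₁₁ := D.E₁ * projL D.A₁
def A₂₂ := D.E₂ * projL D.A₂
def A₃₃ := D.E₃ * projL D.A₃
def A₄₄ := D.E₄ * projL D.A₄
def A₁₂ := projR D.A₁₁ * D.A₂₂
def A₁₃ := projR D.A₁₁ * D.A₃₃
def A₁₄ := projR D.A₁₁ * D.A₄₄
def M₁ := projR D.A₁₂ * D.A₁₃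
def S₁ := D.A₁₃ * projL D.M₁
def T₁ := D.Cc - D.E₁ * D.A₁† * D.C₁ - D.C₁ᵑ * D.A₁ᵑ† * D.E₁ᵑ
  - (D.E₂ * (D.A₂† * D.C₂ + projL D.A₂ * D.C₂ᵑ * D.A₂ᵑ†) * D.E₂ᵑ
    + D.E₃ * (D.A₃† * D.C₃ + projL D.A₃ * D.C₃ᵑ * D.A₃ᵑ†) * D.E₃ᵑ
    + D.E₄ * (D.A₄† * D.C₄ + projL D.A₄ * D.C₄ᵑ * D.A₄ᵑ†) * D.E₄ᵑ)
def T₂ := projR D.A₁₁ * D.T₁ η * (projR D.A₁₁)ᵑ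
def G := projR D.M₁ * projR D.A₁₂
def G₁ := D.G * D.A₁₄
def G₂ := projR D.A₁₂ * D.A₁₄
def G₃ := projR D.A₁₃ * D.A₁₄
def G₄ := D.A₁₄
def L₁ := D.G * D.T₂ η
def L₂ := projR D.A₁₂ * D.T₂ η * (projR D.A₁₃)ᵑ
def L₃ := projR D.A₁₃ * D.T₂ η * (projR D.A₁₂)ᵑ
def L₄ := D.T₂ η * D.Gᵑ
def C₁₁ := projL D.G₂ ┃ projL D.G₄
def C₂₂ := projL D.G₁
def C₃₃ := projL D.G₃
def E₁₁ := projR D.C₁₁ * D.C₂₂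
def E₂₂ := projR D.C₁₁ * D.C₃₃
def M := projR D.E₁₁ * D.E₂₂
def N := (projR D.E₂₂ * D.E₁₁)ᵑ
def S := D.E₂₂ * projL D.M
def F₁ := D.G₁† * D.L₁ η * D.G₄ᵑ† + projL D.G₁ * D.G₂† * D.L₂ η * D.G₃ᵑ†
def F₂ := D.G₃† * D.L₃ η * D.G₂ᵑ† + projL D.G₃ * D.G₄† * D.L₄ η * D.G₁ᵑ†
def F := D.F₂ η - D.F₁ η
def E := projR D.C₁₁ * D.F η * (projR D.C₁₁)ᵑ
def P₂ := D.C₂ * D.E₂ᵑ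
def P₃ := D.C₃ * D.E₃ᵑ
def P₄ := D.C₄ * D.E₄ᵑ

/-! ### The solvability criteria -/

/-- The symmetry conditions that occur in both criteria. -/
structure Symmetric : Prop where
  Cc : D.Cc = D.Ccᵑ
  A₂C₂ : D.A₂ * D.C₂ᵑ = D.C₂ * D.A₂ᵑ
  A₃C₃ : D.A₃ * D.C₃ᵑ = D.C₃ * D.A₃ᵑ
  A₄C₄ : D.A₄ * D.C₄ᵑ = D.C₄ * D.A₄ᵑ

/-- The projector conditions. -/
structure ProjectorConditions : Prop where
  E : projR D.E₂₂ * D.E η * (projR D.E₂₂)ᵑ = 0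
  C₁ : projR D.A₁ * D.C₁ = 0
  C₂ : projR D.A₂ * D.C₂ = 0
  C₃ : projR D.A₃ * D.C₃ = 0
  C₄ : projR D.A₄ * D.C₄ = 0
  L₁ : projR D.G₁ * D.L₁ η = 0
  L₂ : projR D.G₂ * D.L₂ η = 0
  L₃ : projR D.G₃ * D.L₃ η = 0
  L₄ : projR D.G₄ * D.L₄ η = 0

/-- The block rank equalities; `┃` joins blocks in a row, `⊟` stacks block rows. -/
structure RankConditions : Prop where
  C₁ : rank (D.C₁ ┃ D.A₁) = rank D.A₁
  C₂ : rank (D.C₂ ┃ D.A₂) = rank D.A₂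
  C₃ : rank (D.C₃ ┃ D.A₃) = rank D.A₃
  C₄ : rank (D.C₄ ┃ D.A₄) = rank D.A₄
  rank₁ :
    rank ( D.Cc  ┃ D.E₁ ┃ D.E₂ ┃ D.E₃ ┃ D.E₄ ┃ D.C₁ᵑ
         ⊟ D.E₁ᵑ ┃ 0    ┃ 0    ┃ 0    ┃ 0    ┃ D.A₁ᵑ
         ⊟ D.C₁  ┃ D.A₁ ┃ 0    ┃ 0    ┃ 0    ┃ 0
         ⊟ D.P₂ η ┃ 0   ┃ D.A₂ ┃ 0    ┃ 0    ┃ 0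
         ⊟ D.P₃ η ┃ 0   ┃ 0    ┃ D.A₃ ┃ 0    ┃ 0
         ⊟ D.P₄ η ┃ 0   ┃ 0    ┃ 0    ┃ D.A₄ ┃ 0)
    = rank ( D.E₁ ┃ D.E₂ ┃ D.E₃ ┃ D.E₄
           ⊟ D.A₁ ┃ 0    ┃ 0    ┃ 0
           ⊟ 0    ┃ D.A₂ ┃ 0    ┃ 0
           ⊟ 0    ┃ 0    ┃ D.A₃ ┃ 0
           ⊟ 0    ┃ 0    ┃ 0    ┃ D.A₄)
      + rank (D.E₁ ⊟ D.A₁)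
  rank₂ :
    rank ( D.Cc   ┃ D.E₄ ┃ D.E₂ ┃ D.E₁ ┃ (D.P₃ η)ᵑ ┃ D.C₁ᵑ
         ⊟ D.E₃ᵑ  ┃ 0    ┃ 0    ┃ 0    ┃ D.A₃ᵑ     ┃ 0
         ⊟ D.E₁ᵑ  ┃ 0    ┃ 0    ┃ 0    ┃ 0         ┃ D.A₁ᵑ
         ⊟ D.P₄ η ┃ D.A₄ ┃ 0    ┃ 0    ┃ 0         ┃ 0
         ⊟ D.P₂ η ┃ 0    ┃ D.A₂ ┃ 0    ┃ 0         ┃ 0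
         ⊟ D.C₁   ┃ 0    ┃ 0    ┃ D.A₁ ┃ 0         ┃ 0)
    = rank ( D.E₄ ┃ D.E₂ ┃ D.E₁
           ⊟ D.A₄ ┃ 0    ┃ 0
           ⊟ 0    ┃ D.A₂ ┃ 0
           ⊟ 0    ┃ 0    ┃ D.A₁)
      + rank ( D.E₃ ┃ D.E₁
             ⊟ D.A₃ ┃ 0
             ⊟ 0    ┃ D.A₁)
  rank₃ :
    rank ( D.Cc   ┃ D.E₄ ┃ D.E₃ ┃ D.E₁ ┃ (D.P₂ η)ᵑ ┃ D.C₁ᵑ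
         ⊟ D.E₂ᵑ  ┃ 0    ┃ 0    ┃ 0    ┃ D.A₂ᵑ     ┃ 0
         ⊟ D.E₁ᵑ  ┃ 0    ┃ 0    ┃ 0    ┃ 0         ┃ D.A₁ᵑ
         ⊟ D.P₄ η ┃ D.A₄ ┃ 0    ┃ 0    ┃ 0         ┃ 0
         ⊟ D.P₃ η ┃ 0    ┃ D.A₃ ┃ 0    ┃ 0         ┃ 0
         ⊟ D.C₁   ┃ 0    ┃ 0    ┃ D.A₁ ┃ 0         ┃ 0)
    = rank ( D.E₄ ┃ D.E₃ ┃ D.E₁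
           ⊟ D.A₄ ┃ 0    ┃ 0
           ⊟ 0    ┃ D.A₃ ┃ 0
           ⊟ 0    ┃ 0    ┃ D.A₁)
      + rank ( D.E₂ ┃ D.E₁
             ⊟ D.A₂ ┃ 0
             ⊟ 0    ┃ D.A₁)
  rank₄ :
    rank ( D.Cc   ┃ D.E₄ ┃ D.E₁ ┃ (D.P₃ η)ᵑ ┃ (D.P₂ η)ᵑ ┃ D.C₁ᵑ
         ⊟ D.E₃ᵑ  ┃ 0    ┃ 0    ┃ D.A₃ᵑ     ┃ 0         ┃ 0
         ⊟ D.E₂ᵑ  ┃ 0    ┃ 0    ┃ 0         ┃ D.A₂ᵑ     ┃ 0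
         ⊟ D.E₁ᵑ  ┃ 0    ┃ 0    ┃ 0         ┃ 0         ┃ D.A₁ᵑ
         ⊟ D.P₄ η ┃ D.A₄ ┃ 0    ┃ 0         ┃ 0         ┃ 0
         ⊟ D.C₁   ┃ 0    ┃ D.A₁ ┃ 0         ┃ 0         ┃ 0)
    = rank ( D.E₃ ┃ D.E₂ ┃ D.E₁
           ⊟ D.A₃ ┃ 0    ┃ 0
           ⊟ 0    ┃ D.A₂ ┃ 0
           ⊟ 0    ┃ 0    ┃ D.A₁)
      + rank ( D.E₄ ┃ D.E₁
             ⊟ D.A₄ ┃ 0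
             ⊟ 0    ┃ D.A₁)
  rank₅ :
    rank
      ( D.Cc   ┃ D.E₂ ┃ D.E₁ ┃ 0      ┃ 0    ┃ 0    ┃ D.E₄ ┃ (D.P₃ η)ᵑ ┃ D.C₁ᵑ ┃ 0 ┃ 0 ┃ (D.P₄ η)ᵑ
      ⊟ D.E₃ᵑ  ┃ 0    ┃ 0    ┃ 0      ┃ 0    ┃ 0    ┃ 0    ┃ D.A₃ᵑ     ┃ 0     ┃ 0 ┃ 0 ┃ 0
      ⊟ D.E₁ᵑ  ┃ 0    ┃ 0    ┃ 0      ┃ 0    ┃ 0    ┃ 0    ┃ 0         ┃ D.A₁ᵑ ┃ 0 ┃ 0 ┃ 0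
      ⊟ 0      ┃ 0    ┃ 0    ┃ D.Cc   ┃ D.E₃ ┃ D.E₁ ┃ D.E₄ ┃ 0 ┃ 0 ┃ (D.P₂ η)ᵑ ┃ D.C₁ᵑ ┃ 0
      ⊟ 0      ┃ 0    ┃ 0    ┃ D.E₂ᵑ  ┃ 0    ┃ 0    ┃ 0    ┃ 0 ┃ 0 ┃ D.A₂ᵑ     ┃ 0     ┃ 0
      ⊟ 0      ┃ 0    ┃ 0    ┃ D.E₁ᵑ  ┃ 0    ┃ 0    ┃ 0    ┃ 0 ┃ 0 ┃ 0         ┃ D.A₁ᵑ ┃ 0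
      ⊟ D.E₄ᵑ  ┃ 0    ┃ 0    ┃ -D.E₄ᵑ ┃ 0    ┃ 0    ┃ 0    ┃ 0 ┃ 0 ┃ 0         ┃ 0     ┃ D.A₄ᵑ
      ⊟ D.P₂ η ┃ D.A₂ ┃ 0    ┃ 0      ┃ 0    ┃ 0    ┃ 0    ┃ 0 ┃ 0 ┃ 0         ┃ 0     ┃ 0
      ⊟ D.C₁   ┃ 0    ┃ D.A₁ ┃ 0      ┃ 0    ┃ 0    ┃ 0    ┃ 0 ┃ 0 ┃ 0         ┃ 0     ┃ 0
      ⊟ 0      ┃ 0    ┃ 0    ┃ D.P₃ η ┃ D.A₃ ┃ 0    ┃ 0    ┃ 0 ┃ 0 ┃ 0         ┃ 0     ┃ 0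
      ⊟ 0      ┃ 0    ┃ 0    ┃ D.C₁   ┃ 0    ┃ D.A₁ ┃ 0    ┃ 0 ┃ 0 ┃ 0         ┃ 0     ┃ 0
      ⊟ 0      ┃ 0    ┃ 0    ┃ D.P₄ η ┃ 0    ┃ 0    ┃ D.A₄ ┃ 0 ┃ 0 ┃ 0         ┃ 0     ┃ 0)
    = 2 * rank ( D.E₂ ┃ D.E₁ ┃ 0    ┃ 0    ┃ D.E₄
               ⊟ 0    ┃ 0    ┃ D.E₃ ┃ D.E₁ ┃ D.E₄
               ⊟ D.A₂ ┃ 0    ┃ 0    ┃ 0    ┃ 0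
               ⊟ 0    ┃ D.A₁ ┃ 0    ┃ 0    ┃ 0
               ⊟ 0    ┃ 0    ┃ D.A₃ ┃ 0    ┃ 0
               ⊟ 0    ┃ 0    ┃ 0    ┃ D.A₁ ┃ 0
               ⊟ 0    ┃ 0    ┃ 0    ┃ 0    ┃ D.A₄)

/-! ### The general solution -/

/-- The arbitrary matrices in the general solution. -/
structure Parameters (p n₁ n₂ n₃ n₄ : ℕ) where
  W₁₁ : Matrix (Fin p) (Fin n₁) ℍ[ℝ]
  W₁₂ : Matrix (Fin n₁) (Fin p) ℍ[ℝ]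
  W₁₃ : Matrix (Fin p) (Fin n₁) ℍ[ℝ]
  U₄ : Matrix (Fin n₃) (Fin n₃) ℍ[ℝ]
  U₅ : Matrix (Fin n₂) (Fin n₂) ℍ[ℝ]
  U₆ : Matrix (Fin n₂) (Fin n₂) ℍ[ℝ]
  U₇ : Matrix (Fin n₃) (Fin n₃) ℍ[ℝ]
  U₈ : Matrix (Fin n₃) (Fin n₃) ℍ[ℝ]
  U₁₁ : Matrix (Fin n₄) (Fin n₄ ⊕ Fin n₄) ℍ[ℝ]
  U₁₂ : Matrix (Fin n₄ ⊕ Fin n₄) (Fin n₄) ℍ[ℝ]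
  U₂₁ : Matrix (Fin n₄) (Fin n₄ ⊕ Fin n₄) ℍ[ℝ]
  U₃₁ : Matrix (Fin n₄) (Fin n₄) ℍ[ℝ]
  U₃₂ : Matrix (Fin n₄) (Fin n₄) ℍ[ℝ]
  U₃₃ : Matrix (Fin n₄) (Fin n₄) ℍ[ℝ]
  U₄₁ : Matrix (Fin n₄) (Fin n₄) ℍ[ℝ]
  U₄₂ : Matrix (Fin n₄) (Fin n₄) ℍ[ℝ]

variable (P : Parameters p n₁ n₂ n₃ n₄)

def V₃ :=
  D.E₁₁† * D.F η * D.E₂₂ᵑ† - D.E₁₁† * D.E₂₂ * D.M† * D.F η * D.E₂₂ᵑ†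
    - D.E₁₁† * D.S * D.E₂₂† * D.F η * (D.N η)† * D.E₁₁ᵑ * D.E₂₂ᵑ†
    - D.E₁₁† * D.S * P.U₃₁ * projR (D.N η) * D.E₁₁ᵑ * D.E₂₂ᵑ†
    + projL D.E₁₁ * P.U₃₂ + P.U₃₃ * (projL D.E₂₂)ᵑ

def W₃ :=
  D.M† * D.F η * D.E₁₁ᵑ† + D.S† * D.S * D.E₂₂† * D.F η * (D.N η)†
    + projL D.M * projL D.S * P.U₄₁ + projL D.M * P.U₃₁ * projR (D.N η)
    - P.U₄₂ * (projL D.E₁₁)ᵑ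

def K := D.F η - D.C₂₂ * D.V₃ η P * D.C₃₃ᵑ - D.C₃₃ * D.W₃ η P * D.C₂₂ᵑ

/-- The column of blocks `V₁`, `W₁`. -/
def VW := D.C₁₁† * D.K η P - (D.C₁₁† * P.U₁₁ * D.C₁₁ᵑ + projL D.C₁₁ * P.U₁₂)

/-- The row of blocks `W₂`, `V₂`. -/
def WV :=
  projR D.C₁₁ * D.K η P * D.C₁₁ᵑ† + (D.C₁₁ * D.C₁₁† * P.U₁₁ + P.U₂₁ * (projL D.C₁₁)ᵑ)

def V₁ := (D.VW η P).toRows₁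
def W₁ := (D.VW η P).toRows₂
def V₂ := (D.WV η P).toCols₂
def W₂ := (D.WV η P).toCols₁

def U₃ :=
  D.F₁ η + projL D.G₂ * D.V₁ η P + D.V₂ η P * projR D.G₄ᵑ
    + projL D.G₁ * D.V₃ η P * projR D.G₃ᵑ

/-- The alternative expression for `U₃`. -/
def U₃' :=
  D.F₂ η - projL D.G₄ * D.W₁ η P - D.W₂ η P * projR D.G₂ᵑ
    - projL D.G₃ * D.W₃ η P * projR D.G₁ᵑ

def T := D.T₂ η - D.A₁₄ * D.U₃ η P * D.A₁₄ᵑ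

def U₁ :=
  D.A₁₂† * D.T η P * D.A₁₂†ᵑ - D.A₁₂† * D.A₁₃ * D.M₁† * D.T η P * D.A₁₂†ᵑ
    - D.A₁₂† * D.S₁ * D.A₁₃† * D.T η P * D.M₁ᵑ† * D.A₁₃ᵑ * D.A₁₂†ᵑ
    - D.A₁₂† * D.S₁ * P.U₄ * projR D.M₁ᵑ * D.A₁₃ᵑ * D.A₁₂†ᵑ
    + projL D.A₁₂ * P.U₅ + P.U₆ * projR D.A₁₂ᵑ

def U₂ :=
  D.M₁† * D.T η P * D.A₁₃†ᵑ + D.S₁† * D.S₁ * D.A₁₃† * D.T η P * D.M₁†ᵑ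
    + projL D.M₁ * projL D.S₁ * P.U₇ + P.U₈ * projR D.A₁₃ᵑ + projL D.M₁ * P.U₄ * projR D.M₁ᵑ

/-- What remains of `T₁` once the terms in `U₁`, `U₂`, `U₃` are subtracted. -/
def T₀ :=
  D.T₁ η - D.A₂₂ * D.U₁ η P * D.A₂₂ᵑ - D.A₃₃ * D.U₂ η P * D.A₃₃ᵑ - D.A₄₄ * D.U₃ η P * D.A₄₄ᵑ

def Utilde :=
  D.A₁† * D.C₁
    + projL D.A₁ * (D.A₁₁† * D.T₀ η P - D.A₁₁† * P.W₁₁ * D.A₁₁ᵑ + projL D.A₁₁ * P.W₁₂)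

def Vtilde :=
  D.C₁ᵑ * D.A₁ᵑ†
    + (projR D.A₁₁ * D.T₀ η P * D.A₁₁ᵑ† + D.A₁₁ * D.A₁₁† * P.W₁₁ + P.W₁₃ * projR D.A₁₁ᵑ)
      * projR D.A₁ᵑ

def Xtilde :=
  D.A₂† * D.C₂ + projL D.A₂ * D.C₂ᵑ * D.A₂ᵑ† + projL D.A₂ * D.U₁ η P * (projL D.A₂)ᵑ

def Ytilde :=
  D.A₃† * D.C₃ + projL D.A₃ * D.C₃ᵑ * D.A₃ᵑ† + projL D.A₃ * D.U₂ η P * (projL D.A₃)ᵑ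

def Ztilde :=
  D.A₄† * D.C₄ + projL D.A₄ * D.C₄ᵑ * D.A₄ᵑ† + projL D.A₄ * D.U₃ η P * (projL D.A₄)ᵑ

end System

end

end EtaSylvester

open scoped Quaternion Matrix

namespace EtaSylvester

set_option linter.unusedSectionVars false

local infixr:64 " ┃ " => Matrix.fromCols
local infixr:62 " ⊟ " => Matrix.fromRows
local postfix:max "†" => pinv

/-! ### Pseudoinverses and the projectors `projL`, `projR` -/

section Projectors

variable {m n o : Type*} [Fintype m] [Fintype n]

/-! The symmetry requirement can be removed first. `IsUnconstrainedSolution` replaces U^{η*} by an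
independent V and adds the mirrored constraints X A^{η*} = C^{η*}. A solution of (S) gives an
unconstrained one with V = U^{η*}; conversely, when C_c is η-Hermitian, averaging an unconstrained
solution with its η-star solves (S). What remains is a linear problem, solved by elimination.

Write each unknown as a particular solution of its constraints plus a projected free term. The main
equation becomes A₁₁u + vA₁₁^{η*} = T₁ − (terms in U₁, U₂, U₃). An equation Au + vB = T is solvable
exactly when R_A T L_B = 0, so u and v drop out and `IsReduced` remains. For fixed U₃ that is a
two-term equation AXB + CYD = E in U₁, U₂; its four projected solvability conditions
(`twoTerm_exists`) are the `FourEquations` for U₃. They form two nested pairs, each with an explicit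
general solution (`pair_sound`, `pair_complete`) around F₁ and F₂ respectively. Equating the two
descriptions of U₃ gives a Sylvester equation with coefficient C₁₁, and applying R_{C₁₁} on both
sides leaves E₁₁V₃E₂₂^{η*} + E₂₂W₃E₁₁^{η*} = E, again a two-term equation. Three of its four
conditions follow from G₁FG₂^{η*} = 0 = G₂FG₁^{η*}; the fourth is the stated condition on E.

The parametrizations are complete because inserting a solution, suitably projected, as the
parameters gives that solution back. They are sound because the free terms cancel or are
annihilated.

For the ranks, r(C A; B 0) = r(A) + r(B) holds exactly when yCx = 0 for all y, x with yA = 0 and Bx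
= 0. In a bordered matrix the constraint blocks turn C_c into T₁ (`rank_bordered_eq_add_iff`), so
each equality says that yT₁w^{η*} vanishes for y and w annihilating certain A_ii. These annihilators
are row spaces of products of projectors, which yields the conditions R_{G_i}L_i = 0. The fifth
equality couples two copies of the problem through E₄; the form to vanish is then −vFw^{η*} for v, w
in the common row space of G₂ and G₃, which is the condition on E. -/

theorem mul_pinv_mul (A : Matrix m n ℍ[ℝ]) : A * A† * A = A := (isMoorePenrose_pinv A).mul_mul_left

theorem pinv_mul_pinv (A : Matrix m n ℍ[ℝ]) : A† * A * A† = A† :=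
  (isMoorePenrose_pinv A).mul_mul_right

theorem conjTranspose_mul_pinv (A : Matrix m n ℍ[ℝ]) : (A * A†)ᴴ = A * A† :=
  (isMoorePenrose_pinv A).left_hermitian

theorem conjTranspose_pinv_mul (A : Matrix m n ℍ[ℝ]) : (A† * A)ᴴ = A† * A :=
  (isMoorePenrose_pinv A).right_hermitian

/-- By the Penrose equations A† = A†(A†)ᴴAᴴ, so A† annihilates whatever Aᴴ annihilates. -/
theorem pinv_mul_eq_zero {A : Matrix m n ℍ[ℝ]} {B : Matrix m o ℍ[ℝ]} (h : Aᴴ * B = 0) :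
    A† * B = 0 := by
  rw [← pinv_mul_pinv, Matrix.mul_assoc, Matrix.mul_assoc, ← Matrix.mul_assoc A,
    ← conjTranspose_mul_pinv, Matrix.conjTranspose_mul, Matrix.mul_assoc, h, Matrix.mul_zero,
    Matrix.mul_zero]

theorem mul_pinv_eq_zero {A : Matrix m n ℍ[ℝ]} {B : Matrix o n ℍ[ℝ]} (h : B * Aᴴ = 0) :
    B * A† = 0 := by
  rw [← pinv_mul_pinv, ← Matrix.mul_assoc,
    ← conjTranspose_pinv_mul, Matrix.conjTranspose_mul, ← Matrix.mul_assoc B, h, Matrix.zero_mul,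
    Matrix.zero_mul]

variable [DecidableEq m] [DecidableEq n]

theorem mul_projL (A : Matrix m n ℍ[ℝ]) : A * projL A = 0 := by
  rw [projL, Matrix.mul_sub, Matrix.mul_one, ← Matrix.mul_assoc, mul_pinv_mul, sub_self]

theorem projR_mul (A : Matrix m n ℍ[ℝ]) : projR A * A = 0 := by
  rw [projR, Matrix.sub_mul, Matrix.one_mul, mul_pinv_mul, sub_self]

theorem projL_mul_pinv (A : Matrix m n ℍ[ℝ]) : projL A * A† = 0 := by
  rw [projL, Matrix.sub_mul, Matrix.one_mul, pinv_mul_pinv, sub_self]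

theorem pinv_mul_projR (A : Matrix m n ℍ[ℝ]) : A† * projR A = 0 := by
  rw [projR, Matrix.mul_sub, Matrix.mul_one, ← Matrix.mul_assoc, pinv_mul_pinv, sub_self]

theorem conjTranspose_projL (A : Matrix m n ℍ[ℝ]) : (projL A)ᴴ = projL A := by
  rw [projL, Matrix.conjTranspose_sub, conjTranspose_pinv_mul, Matrix.conjTranspose_one]

theorem conjTranspose_projR (A : Matrix m n ℍ[ℝ]) : (projR A)ᴴ = projR A := by
  rw [projR, Matrix.conjTranspose_sub, conjTranspose_mul_pinv, Matrix.conjTranspose_one]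

theorem projL_mul_projL (A : Matrix m n ℍ[ℝ]) : projL A * projL A = projL A := by
  nth_rw 2 [projL]
  rw [Matrix.mul_sub, ← Matrix.mul_assoc, projL_mul_pinv, Matrix.zero_mul, Matrix.mul_one, sub_zero]

theorem projR_mul_projR (A : Matrix m n ℍ[ℝ]) : projR A * projR A = projR A := by
  nth_rw 1 [projR]
  rw [Matrix.sub_mul, Matrix.mul_assoc, pinv_mul_projR, Matrix.mul_zero, Matrix.one_mul, sub_zero]

theorem mul_projL_eq_zero_iff {A : Matrix m n ℍ[ℝ]} {y : Matrix o n ℍ[ℝ]} :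
    y * projL A = 0 ↔ y = y * (A† * A) := by
  rw [projL, Matrix.mul_sub, Matrix.mul_one, sub_eq_zero]

theorem projR_mul_eq_zero_iff {A : Matrix m n ℍ[ℝ]} {x : Matrix m o ℍ[ℝ]} :
    projR A * x = 0 ↔ x = A * A† * x := by
  rw [projR, Matrix.sub_mul, Matrix.one_mul, sub_eq_zero]

theorem mul_projR_of_mul_eq_zero {A : Matrix m n ℍ[ℝ]} {y : Matrix o m ℍ[ℝ]} (h : y * A = 0) :
    y * projR A = y := by
  rw [projR, Matrix.mul_sub, Matrix.mul_one, ← Matrix.mul_assoc, h, Matrix.zero_mul, sub_zero]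

theorem projL_mul_of_mul_eq_zero {A : Matrix m n ℍ[ℝ]} {x : Matrix n o ℍ[ℝ]} (h : A * x = 0) :
    projL A * x = x := by
  rw [projL, Matrix.sub_mul, Matrix.one_mul, Matrix.mul_assoc, h, Matrix.mul_zero, sub_zero]

theorem mul_projL_eq_zero_iff_exists {A : Matrix m n ℍ[ℝ]} {y : Matrix o n ℍ[ℝ]} :
    y * projL A = 0 ↔ ∃ z : Matrix o m ℍ[ℝ], y = z * A := by
  rw [mul_projL_eq_zero_iff]
  refine ⟨fun h => ⟨y * A†, by rw [Matrix.mul_assoc]; exact h⟩, ?_⟩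
  rintro ⟨z, rfl⟩
  rw [Matrix.mul_assoc, ← Matrix.mul_assoc A, mul_pinv_mul]

theorem projR_mul_eq_zero_iff_exists {A : Matrix m n ℍ[ℝ]} {x : Matrix m o ℍ[ℝ]} :
    projR A * x = 0 ↔ ∃ z : Matrix n o ℍ[ℝ], x = A * z := by
  rw [projR_mul_eq_zero_iff]
  refine ⟨fun h => ⟨A† * x, by rw [← Matrix.mul_assoc]; exact h⟩, ?_⟩
  rintro ⟨z, rfl⟩
  rw [← Matrix.mul_assoc, mul_pinv_mul]

/-- Aᴴ annihilates P − 1, hence so does A†. This is the tool for absorbing a projector that stands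
next to a pseudoinverse. -/
theorem pinv_mul_of_mul_eq {A : Matrix m n ℍ[ℝ]} {P : Matrix m m ℍ[ℝ]} (hP : Pᴴ = P)
    (h : P * A = A) : A† * P = A† := by
  have : A† * (P - 1) = 0 := by
    apply pinv_mul_eq_zero
    rw [Matrix.mul_sub, Matrix.mul_one, ← hP, ← Matrix.conjTranspose_mul, h, sub_self]
  rwa [Matrix.mul_sub, Matrix.mul_one, sub_eq_zero] at this

theorem mul_pinv_of_mul_eq {A : Matrix m n ℍ[ℝ]} {P : Matrix n n ℍ[ℝ]} (hP : Pᴴ = P)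
    (h : A * P = A) : P * A† = A† := by
  have : (P - 1) * A† = 0 := by
    apply mul_pinv_eq_zero
    rw [Matrix.sub_mul, Matrix.one_mul, ← hP, ← Matrix.conjTranspose_mul, h, sub_self]
  rwa [Matrix.sub_mul, Matrix.one_mul, sub_eq_zero] at this

end Projectors

/-- `η` is a pure unit quaternion. -/
structure IsPureUnit (η : ℍ[ℝ]) : Prop where
  star_eq : star η = -η
  mul_self : η * η = -1

/-! ### The anti-involution A ↦ A^{η*} -/

section EtaStar

variable {l m n o : Type*} {η : ℍ[ℝ]}

local postfix:max "ᵑ" => etaStar η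

theorem etaStar_apply (A : Matrix m n ℍ[ℝ]) (i : n) (j : m) :
    Aᵑ i j = -(η * star (A j i) * η) := rfl

theorem etaStar_add (A B : Matrix m n ℍ[ℝ]) : (A + B)ᵑ = Aᵑ + Bᵑ := by
  ext1 i j; simp only [etaStar_apply, Matrix.add_apply, star_add, mul_add, add_mul, neg_add]

theorem etaStar_zero : (0 : Matrix m n ℍ[ℝ])ᵑ = 0 := by
  ext1 i j; simp only [etaStar_apply, Matrix.zero_apply, star_zero, mul_zero, zero_mul, neg_zero]

theorem etaStar_neg (A : Matrix m n ℍ[ℝ]) : (-A)ᵑ = -Aᵑ := by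
  ext1 i j; simp only [etaStar_apply, Matrix.neg_apply, star_neg, mul_neg, neg_mul]

theorem etaStar_sub (A B : Matrix m n ℍ[ℝ]) : (A - B)ᵑ = Aᵑ - Bᵑ := by
  rw [sub_eq_add_neg, etaStar_add, etaStar_neg, sub_eq_add_neg]

theorem etaStar_smul (r : ℝ) (A : Matrix m n ℍ[ℝ]) : (r • A)ᵑ = r • Aᵑ := by
  ext1 i j
  simp only [etaStar_apply, Matrix.smul_apply, Quaternion.star_smul, mul_smul_comm, smul_mul_assoc,
    smul_neg]

theorem etaStar_fromRows (A : Matrix m n ℍ[ℝ]) (B : Matrix l n ℍ[ℝ]) :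
    (Matrix.fromRows A B)ᵑ = Matrix.fromCols Aᵑ Bᵑ := by
  ext1 i j; rcases j with j | j <;> rfl

theorem etaStar_fromCols (A : Matrix m n ℍ[ℝ]) (B : Matrix m l ℍ[ℝ]) :
    (Matrix.fromCols A B)ᵑ = Matrix.fromRows Aᵑ Bᵑ := by
  ext1 i j; rcases i with i | i <;> rfl

/-- The two inner factors η meet as η² = −1, so (−ηaη)(−ηbη) = −ηabη. -/
theorem etaStar_mul (hη : IsPureUnit η) [Fintype n] (A : Matrix m n ℍ[ℝ]) (B : Matrix n o ℍ[ℝ]) :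
    (A * B)ᵑ = Bᵑ * Aᵑ := by
  ext1 i j
  simp only [etaStar_apply, Matrix.mul_apply, star_sum, star_mul, Finset.mul_sum, Finset.sum_mul,
    ← Finset.sum_neg_distrib]
  refine Finset.sum_congr rfl fun k _ => ?_
  have : (η * star (B k i) * η) * (η * star (A j k) * η)
      = η * star (B k i) * (η * η) * star (A j k) * η := by simp only [mul_assoc]
  rw [neg_mul_neg, this, hη.mul_self]
  simp only [mul_neg, mul_one, neg_mul, mul_assoc]

theorem etaStar_etaStar (hη : IsPureUnit η) (A : Matrix m n ℍ[ℝ]) : Aᵑᵑ = A := by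
  ext1 i j
  simp only [etaStar_apply, star_neg, star_mul, star_star, hη.star_eq]
  have : η * (-η * (A i j * -η)) * η = (η * η) * A i j * (η * η) := by
    simp only [mul_assoc, neg_mul, mul_neg, neg_neg]
  rw [mul_neg, neg_mul, neg_neg, this, hη.mul_self]
  simp

theorem etaStar_one (hη : IsPureUnit η) [DecidableEq n] : (1 : Matrix n n ℍ[ℝ])ᵑ = 1 := by
  ext1 i j
  rw [etaStar_apply]
  by_cases h : i = j
  · subst h; simp [hη.mul_self]
  · simp [h, Ne.symm h]

theorem etaStar_conjTranspose (hη : IsPureUnit η) (A : Matrix m n ℍ[ℝ]) : (Aᴴ)ᵑ = (Aᵑ)ᴴ := by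
  ext1 i j
  simp only [etaStar_apply, Matrix.conjTranspose_apply, star_neg, star_mul, hη.star_eq, mul_neg,
    neg_mul, neg_neg, mul_assoc]

/-- The η-star carries the Penrose equations of A to those of A^{η*}, exchanging the two Hermitian
conditions; uniqueness does the rest. -/
theorem etaStar_pinv (hη : IsPureUnit η) [Fintype m] [Fintype n] (A : Matrix m n ℍ[ℝ]) :
    A†ᵑ = Aᵑ† := by
  refine IsMoorePenrose.unique (A := Aᵑ) ⟨?_, ?_, ?_, ?_⟩ (isMoorePenrose_pinv _)
  · rw [← etaStar_mul hη, ← etaStar_mul hη, ← Matrix.mul_assoc, mul_pinv_mul]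
  · rw [← etaStar_mul hη, ← etaStar_mul hη, ← Matrix.mul_assoc, pinv_mul_pinv]
  · rw [← etaStar_mul hη, ← etaStar_conjTranspose hη, conjTranspose_pinv_mul]
  · rw [← etaStar_mul hη, ← etaStar_conjTranspose hη, conjTranspose_mul_pinv]

theorem etaStar_projL (hη : IsPureUnit η) [Fintype m] [Fintype n] [DecidableEq n]
    (A : Matrix m n ℍ[ℝ]) : (projL A)ᵑ = projR Aᵑ := by
  rw [projL, projR, etaStar_sub, etaStar_mul hη, etaStar_pinv hη, etaStar_one hη]

theorem etaStar_projR (hη : IsPureUnit η) [Fintype m] [Fintype n] [DecidableEq m]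
    (A : Matrix m n ℍ[ℝ]) : (projR A)ᵑ = projL Aᵑ := by
  rw [projL, projR, etaStar_sub, etaStar_mul hη, etaStar_pinv hη, etaStar_one hη]

theorem etaStar_eq_zero_iff (hη : IsPureUnit η) {A : Matrix m n ℍ[ℝ]} : Aᵑ = 0 ↔ A = 0 :=
  ⟨fun h => by rw [← etaStar_etaStar hη A, h, etaStar_zero], fun h => by rw [h, etaStar_zero]⟩

end EtaStar

/-! ### Explicit general solutions of linear matrix equations -/

section Equations

variable {a b c d e f g h : Type*} [Fintype a] [Fintype b] [Fintype c] [Fintype d] [Fintype e]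
  [Fintype f] [DecidableEq a] [DecidableEq b] [DecidableEq c] [DecidableEq d] [DecidableEq e]
  [DecidableEq f]

/-! #### The equation `A u + v B = T` -/

/-- A given solution is recovered from the general formula by taking v, u and R_A v as its free
parameters. -/
theorem sylvester_complete {A : Matrix a b ℍ[ℝ]} {B : Matrix c d ℍ[ℝ]} {T : Matrix a d ℍ[ℝ]}
    {u : Matrix b d ℍ[ℝ]} {v : Matrix a c ℍ[ℝ]} (h : A * u + v * B = T) :
    u = A† * T - A† * v * B + projL A * u ∧
      v = projR A * T * B† + A * A† * v + projR A * v * projR B := by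
  subst h
  constructor
  · simp only [projL, Matrix.mul_add, Matrix.sub_mul, Matrix.one_mul, Matrix.mul_assoc]
    abel
  · have h1 : projR A * (A * u + v * B) = projR A * v * B := by
      rw [Matrix.mul_add, ← Matrix.mul_assoc, projR_mul, Matrix.zero_mul, zero_add,
          Matrix.mul_assoc]
    rw [h1]
    simp only [projR, Matrix.mul_sub, Matrix.sub_mul, Matrix.one_mul, Matrix.mul_one,
      Matrix.mul_assoc]
    abel

/-- The hypothesis says that B†B fixes R_A T. So the two leading terms supply AA†T and R_A T, the
`W₁` terms cancel, and those in `W₂`, `W₃` are annihilated. -/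
theorem sylvester_sound {A : Matrix a b ℍ[ℝ]} {B : Matrix c d ℍ[ℝ]} {T : Matrix a d ℍ[ℝ]}
    (h : projR A * T * projL B = 0) (W₁ : Matrix a c ℍ[ℝ]) (W₂ : Matrix b d ℍ[ℝ])
    (W₃ : Matrix a c ℍ[ℝ]) :
    A * (A† * T - A† * W₁ * B + projL A * W₂)
      + (projR A * T * B† + A * A† * W₁ + W₃ * projR B) * B = T := by
  have h1 : projR A * T * (B† * B) = projR A * T := (mul_projL_eq_zero_iff.1 h).symm
  have h2 : A * (projL A * W₂) = 0 := by rw [← Matrix.mul_assoc, mul_projL, Matrix.zero_mul]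
  rw [Matrix.mul_add, h2, Matrix.add_mul, Matrix.add_mul, Matrix.mul_assoc W₃, projR_mul,
    Matrix.mul_assoc _ B†, h1]
  simp only [projR, Matrix.mul_sub, Matrix.sub_mul, Matrix.one_mul, Matrix.mul_zero,
    Matrix.mul_assoc]
  abel

/-! #### The equation `A X B + C Y D = E` -/

/-- The `X`-part of the general solution of `A X B + C Y D = E`. -/
noncomputable def twoTermX (A : Matrix a b ℍ[ℝ]) (B : Matrix c d ℍ[ℝ]) (C : Matrix a e ℍ[ℝ])
    (D : Matrix f d ℍ[ℝ]) (E : Matrix a d ℍ[ℝ]) (M : Matrix a e ℍ[ℝ]) (N : Matrix f d ℍ[ℝ])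
    (S : Matrix a e ℍ[ℝ]) (U₁ : Matrix e f ℍ[ℝ]) (U₂ U₃ : Matrix b c ℍ[ℝ]) : Matrix b c ℍ[ℝ] :=
  A† * E * B† - A† * C * M† * E * B† - A† * S * C† * E * N† * D * B†
    - A† * S * U₁ * projR N * D * B† + projL A * U₂ + U₃ * projR B

/-- The `Y`-part of the general solution of `A X B + C Y D = E`. -/
noncomputable def twoTermY (C : Matrix a e ℍ[ℝ])
    (D : Matrix f d ℍ[ℝ]) (E : Matrix a d ℍ[ℝ]) (M : Matrix a e ℍ[ℝ]) (N : Matrix f d ℍ[ℝ])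
    (S : Matrix a e ℍ[ℝ]) (U₁ U₂ U₃ : Matrix e f ℍ[ℝ]) : Matrix e f ℍ[ℝ] :=
  M† * E * D† + S† * S * C† * E * N† + projL M * projL S * U₂ + projL M * U₁ * projR N
    + U₃ * projR D

variable {A : Matrix a b ℍ[ℝ]} {B : Matrix c d ℍ[ℝ]} {C : Matrix a e ℍ[ℝ]}
    {D : Matrix f d ℍ[ℝ]} {E : Matrix a d ℍ[ℝ]} {M : Matrix a e ℍ[ℝ]} {N : Matrix f d ℍ[ℝ]}
    {S : Matrix a e ℍ[ℝ]} {X : Matrix b c ℍ[ℝ]} {Y : Matrix e f ℍ[ℝ]}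

theorem pinv_mul_projR_of_eq (hM : M = projR A * C) : M† * projR A = M† :=
  pinv_mul_of_mul_eq (conjTranspose_projR A)
    (by rw [hM, ← Matrix.mul_assoc, projR_mul_projR])

theorem projL_mul_pinv_of_eq (hN : N = D * projL B) : projL B * N† = N† :=
  mul_pinv_of_mul_eq (conjTranspose_projL B)
    (by rw [hN, Matrix.mul_assoc, projL_mul_projL])

/-- M† absorbs R_A, so it annihilates A and sees only the Y-term, with M†C = M†M. -/
theorem pinv_mul_two_term (hM : M = projR A * C) :
    M† * (A * X * B + C * Y * D) = M† * M * Y * D := by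
  have h1 : M† * A = 0 := by
    rw [← pinv_mul_projR_of_eq hM, Matrix.mul_assoc, projR_mul, Matrix.mul_zero]
  have h2 : M† * C = M† * M := by
    rw [hM, ← Matrix.mul_assoc, pinv_mul_projR_of_eq rfl]
  rw [Matrix.mul_add, ← Matrix.mul_assoc, ← Matrix.mul_assoc, h1, ← Matrix.mul_assoc,
    ← Matrix.mul_assoc, h2, Matrix.zero_mul, Matrix.zero_mul, zero_add]

theorem two_term_mul_pinv (hN : N = D * projL B) :
    (A * X * B + C * Y * D) * N† = C * Y * N * N† := by
  have h1 : B * N† = 0 := by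
    rw [← projL_mul_pinv_of_eq hN, ← Matrix.mul_assoc, mul_projL, Matrix.zero_mul]
  have h2 : D * N† = N * N† := by
    rw [hN, Matrix.mul_assoc, projL_mul_pinv_of_eq rfl]
  rw [Matrix.add_mul, Matrix.mul_assoc _ B, h1, Matrix.mul_assoc _ D, h2, Matrix.mul_zero,
    zero_add, Matrix.mul_assoc _ N]

/-- The row space of M lies in that of C, so M†M and C†C are nested orthogonal projectors and
commute. -/
theorem projL_commute (hM : M = projR A * C) : projL M * (C† * C) = (C† * C) * projL M := by
  have h1 : M† * M * (C† * C) = M† * M := by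
    rw [hM, Matrix.mul_assoc, Matrix.mul_assoc (projR A), ← Matrix.mul_assoc C, mul_pinv_mul]
  have h2 : C† * C * (M† * M) = M† * M := by
    have := congrArg Matrix.conjTranspose h1
    rwa [Matrix.conjTranspose_mul, conjTranspose_pinv_mul, conjTranspose_pinv_mul] at this
  rw [projL, Matrix.sub_mul, Matrix.mul_sub, h1, h2, Matrix.one_mul, Matrix.mul_one]

theorem mul_pinv_mul_of_eq (hM : M = projR A * C) (hS : S = C * projL M) : S * C† * C = S := by
  rw [hS, Matrix.mul_assoc, Matrix.mul_assoc, projL_commute hM, ← Matrix.mul_assoc,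
    ← Matrix.mul_assoc, mul_pinv_mul]

/-- M†E and EN† involve Y alone, and C† disappears because SC†C = S. After these substitutions the
formulas, with projections of X and Y as parameters, collapse by cancellation. -/
theorem twoTerm_complete (h : A * X * B + C * Y * D = E) (hM : M = projR A * C)
    (hN : N = D * projL B) (hS : S = C * projL M) :
    X = twoTermX A B C D E M N S Y X (A† * A * X) ∧
      Y = twoTermY C D E M N S Y (Y * N * N†) (M† * M * Y) := by
  have hME : M† * E = M† * M * Y * D := by rw [← h, pinv_mul_two_term hM]
  have hEN : E * N† = C * Y * N * N† := by rw [← h, two_term_mul_pinv hN]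
  have hSC := mul_pinv_mul_of_eq hM hS
  have hSEN : S * C† * E * N† = S * Y * N * N† := by
    rw [Matrix.mul_assoc _ E, hEN]
    simp only [← Matrix.mul_assoc]
    rw [hSC]
  constructor
  · have h1 : A† * C * M† * E * B† = A† * C * M† * M * Y * D * B† := by
      rw [Matrix.mul_assoc _ _ E, hME]; simp only [← Matrix.mul_assoc]
    have h2 : A† * S * C† * E * N† * D * B† = A† * S * Y * N * N† * D * B† := by
      have : A† * S * C† * E * N† = A† * (S * C† * E * N†) := by simp only [Matrix.mul_assoc]
      rw [this, hSEN]; simp only [← Matrix.mul_assoc]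
    rw [twoTermX, h1, h2, hS, ← h]
    simp only [projL, projR, Matrix.mul_sub, Matrix.sub_mul, Matrix.one_mul, Matrix.mul_one,
      Matrix.mul_assoc, Matrix.mul_add, Matrix.add_mul]
    abel
  · have h1 : S† * S * C† * E * N† = S† * S * Y * N * N† := by
      have : S† * S * C† * E * N† = S† * (S * C† * E * N†) := by simp only [Matrix.mul_assoc]
      rw [this, hSEN]; simp only [← Matrix.mul_assoc]
    -- S = C L_M annihilates M†, so M†M and S†S are orthogonal projectors with zero product; hence
    -- L_M L_S = L_M − S†S.
    have h3 : M† * M * (S† * S) = 0 := by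
      have : S† * S * (M† * M) = 0 := by
        calc S† * S * (M† * M) = S† * (C * (projL M * M†) * M) := by
              nth_rw 2 [hS]; simp only [Matrix.mul_assoc]
          _ = 0 := by rw [projL_mul_pinv]; simp only [Matrix.mul_zero, Matrix.zero_mul]
      have := congrArg Matrix.conjTranspose this
      rwa [Matrix.conjTranspose_mul, conjTranspose_pinv_mul, conjTranspose_pinv_mul,
        Matrix.conjTranspose_zero] at this
    have h4 : projL M * projL S = projL M - S† * S := by
      rw [projL, projL, Matrix.mul_sub, Matrix.sub_mul _ _ (S† * S), h3, Matrix.one_mul,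
        Matrix.mul_one, sub_zero]
    rw [twoTermY, h1, h4, hME]
    simp only [projL, projR, Matrix.mul_sub, Matrix.sub_mul, Matrix.one_mul, Matrix.mul_one,
      Matrix.mul_assoc]
    abel

/-- S lies in the column space of A because R_A S = M L_M = 0, and R_N D lies in the row space of B
because R_N N = 0. The pseudoinverses of A and B therefore disappear, and the `U₁` terms of X and Y
cancel. -/
theorem twoTerm_homogeneous (hM : M = projR A * C)
    (hN : N = D * projL B) (hS : S = C * projL M) (U₁ : Matrix e f ℍ[ℝ]) :
    A * (A† * S * U₁ * projR N * D * B†) * B = C * (projL M * U₁ * projR N) * D := by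
  have h1 : A * A† * S = S := by
    refine (projR_mul_eq_zero_iff.1 ?_).symm
    rw [hS, ← Matrix.mul_assoc, ← hM, mul_projL]
  have h2 : projR N * D * (B† * B) = projR N * D := by
    refine (mul_projL_eq_zero_iff.1 ?_).symm
    rw [Matrix.mul_assoc, ← hN, projR_mul]
  calc A * (A† * S * U₁ * projR N * D * B†) * B
      = (A * A† * S) * U₁ * (projR N * D * (B† * B)) := by simp only [Matrix.mul_assoc]
    _ = C * (projL M * U₁ * projR N) * D := by
      rw [h1, h2, hS]; simp only [Matrix.mul_assoc]

/-- The left side does not depend on the parameters, and for the parameters that reproduce the given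
solution it equals E. -/
theorem twoTerm_sound (h : A * X * B + C * Y * D = E) (hM : M = projR A * C)
    (hN : N = D * projL B) (hS : S = C * projL M) (U₁ U₄ U₅ : Matrix e f ℍ[ℝ])
    (U₂ U₃ : Matrix b c ℍ[ℝ]) :
    A * twoTermX A B C D E M N S U₁ U₂ U₃ * B + C * twoTermY C D E M N S U₁ U₄ U₅ * D = E := by
  have key : ∀ (U₁ U₄ U₅ : Matrix e f ℍ[ℝ]) (U₂ U₃ : Matrix b c ℍ[ℝ]),
      A * twoTermX A B C D E M N S U₁ U₂ U₃ * B + C * twoTermY C D E M N S U₁ U₄ U₅ * D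
      = A * (A† * E * B† - A† * C * M† * E * B† - A† * S * C† * E * N† * D * B†) * B
        + C * (M† * E * D† + S† * S * C† * E * N†) * D := by
    intro U₁ U₄ U₅ U₂ U₃
    have h1 : A * (projL A * U₂) * B = 0 := by
      rw [← Matrix.mul_assoc, mul_projL, Matrix.zero_mul, Matrix.zero_mul]
    have h2 : A * (U₃ * projR B) * B = 0 := by
      rw [← Matrix.mul_assoc, Matrix.mul_assoc, projR_mul, Matrix.mul_zero]
    have h3 : C * (projL M * projL S * U₄) * D = 0 := by
      rw [← Matrix.mul_assoc, ← Matrix.mul_assoc, ← hS, mul_projL, Matrix.zero_mul,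
        Matrix.zero_mul]
    have h4 : C * (U₅ * projR D) * D = 0 := by
      rw [← Matrix.mul_assoc, Matrix.mul_assoc, projR_mul, Matrix.mul_zero]
    simp only [twoTermX, twoTermY, Matrix.mul_add, Matrix.add_mul, Matrix.mul_sub, Matrix.sub_mul,
      h1, h2, h3, h4, twoTerm_homogeneous hM hN hS U₁]
    abel
  obtain ⟨hX, hY⟩ := twoTerm_complete h hM hN hS
  rw [key U₁ U₄ U₅ U₂ U₃, ← key Y (Y * N * N†) (M† * M * Y) X (A† * A * X), ← hX, ← hY, h]

/-- Y is built from two corrections. The first makes the remainder vanish under R_A; the second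
makes it vanish under L_B without spoiling this. What is left lies in the column space of A and the
row space of B, so an X absorbs it. -/
theorem twoTerm_exists (hM : M = projR A * C) (hN : N = D * projL B)
    (h1 : projR M * (projR A * E) = 0) (h2 : projR A * E * projL D = 0)
    (h3 : projR C * (E * projL B) = 0) (h4 : E * projL B * projL N = 0) :
    ∃ (X : Matrix b c ℍ[ℝ]) (Y : Matrix e f ℍ[ℝ]), A * X * B + C * Y * D = E := by
  have e1 : M * M† * (projR A * E) = projR A * E := (projR_mul_eq_zero_iff.1 h1).symm
  have e2 : projR A * E * (D† * D) = projR A * E := (mul_projL_eq_zero_iff.1 h2).symm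
  have e3 : projR C * E * projL B = 0 := by rw [Matrix.mul_assoc, h3]
  have e4 : E * projL B * (N† * N) = E * projL B := (mul_projL_eq_zero_iff.1 h4).symm
  have hMR := pinv_mul_projR_of_eq hM
  have hNL := projL_mul_pinv_of_eq hN
  set Y₁ := M† * E * D† with hY₁
  set E₁ := E - C * Y₁ * D with hE₁
  have f1 : projR A * E₁ = 0 := by
    have : projR A * (C * Y₁ * D) = M * M† * (projR A * E) * (D† * D) := by
      rw [hY₁]
      calc projR A * (C * (M† * E * D†) * D) = (projR A * C) * M† * E * (D† * D) := by
            simp only [Matrix.mul_assoc]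
        _ = _ := by
            rw [← hM]
            nth_rw 1 [← hMR]
            simp only [Matrix.mul_assoc]
    rw [hE₁, Matrix.mul_sub, this, e1, e2, sub_self]
  have f2 : C * C† * (E₁ * projL B) = E₁ * projL B := by
    refine (projR_mul_eq_zero_iff.1 ?_).symm
    have : projR C * (C * Y₁ * D) = 0 := by
      rw [Matrix.mul_assoc, ← Matrix.mul_assoc, projR_mul, Matrix.zero_mul]
    rw [← Matrix.mul_assoc, hE₁, Matrix.mul_sub, this, sub_zero, e3]
  have f3 : E₁ * projL B * (N† * N) = E₁ * projL B := by
    refine (mul_projL_eq_zero_iff.1 ?_).symm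
    rw [hE₁, Matrix.sub_mul, Matrix.mul_assoc _ D, ← hN, Matrix.sub_mul, h4,
      Matrix.mul_assoc _ N, mul_projL, Matrix.mul_zero, sub_zero]
  set Y₂ := C† * E₁ * N† with hY₂
  -- The second correction CY₂D thus has E₁ as left factor, so R_A annihilates it.
  have g0 : C * Y₂ = E₁ * N† := by
    have : E₁ * N† = E₁ * projL B * N† := by rw [Matrix.mul_assoc, hNL]
    rw [this]
    rw [← f2, hY₂]
    simp only [Matrix.mul_assoc, hNL]
  set E₂ := E₁ - C * Y₂ * D with hE₂
  have g1 : projR A * E₂ = 0 := by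
    rw [hE₂, Matrix.mul_sub, f1, g0, ← Matrix.mul_assoc, ← Matrix.mul_assoc, f1, Matrix.zero_mul,
      Matrix.zero_mul, sub_zero]
  have g2 : E₂ * projL B = 0 := by
    rw [hE₂, Matrix.sub_mul, g0, Matrix.mul_assoc _ D, ← hN, sub_eq_zero, ← f3,
      Matrix.mul_assoc E₁, ← Matrix.mul_assoc (projL B), hNL, ← Matrix.mul_assoc]
  refine ⟨A† * E₂ * B†, Y₁ + Y₂, ?_⟩
  have k1 : A * (A† * E₂ * B†) * B = E₂ := by
    have : A * (A† * E₂ * B†) * B = A * A† * E₂ * (B† * B) := by simp only [Matrix.mul_assoc]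
    rw [this, ← projR_mul_eq_zero_iff.1 g1, ← mul_projL_eq_zero_iff.1 g2]
  rw [k1, hE₂, hE₁, Matrix.mul_add, Matrix.add_mul]
  abel

/-! #### The pair of equations `G₁ W H₁ = L₁`, `G₂ W H₂ = L₂` with nested coefficients -/

/-- `hL` is the compatibility of the two equations on their overlap. The first term of W solves the
first equation and contributes G₂G₁†G₁G₂†L₂ to the second; the next term, invisible to G₁, supplies
the rest. -/
theorem pair_sound {G₂ : Matrix a b ℍ[ℝ]} {J : Matrix c a ℍ[ℝ]} {H₁ : Matrix d e ℍ[ℝ]}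
    {K : Matrix e f ℍ[ℝ]} {L₁ : Matrix c e ℍ[ℝ]} {L₂ : Matrix a f ℍ[ℝ]} {G₁ : Matrix c b ℍ[ℝ]}
    {H₂ : Matrix d f ℍ[ℝ]}
    (hG : G₁ = J * G₂) (hH : H₂ = H₁ * K) (h1 : projR G₁ * L₁ = 0) (h1' : L₁ * projL H₁ = 0)
    (h2 : projR G₂ * L₂ = 0) (h2' : L₂ * projL H₂ = 0) (hL : L₁ * K = J * L₂)
    (V₁ V₂ V₃ : Matrix b d ℍ[ℝ]) :
    let W := G₁† * L₁ * H₁† + projL G₁ * G₂† * L₂ * H₂† + projL G₂ * V₁ + V₂ * projR H₁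
      + projL G₁ * V₃ * projR H₂
    G₁ * W * H₁ = L₁ ∧ G₂ * W * H₂ = L₂ := by
  have z1 : G₁ * projL G₁ = 0 := mul_projL G₁
  have z2 : G₂ * projL G₂ = 0 := mul_projL G₂
  have z3 : G₁ * projL G₂ = 0 := by rw [hG, Matrix.mul_assoc, z2, Matrix.mul_zero]
  have z4 : projR H₁ * H₁ = 0 := projR_mul H₁
  have z5 : projR H₂ * H₂ = 0 := projR_mul H₂
  have z6 : projR H₁ * H₂ = 0 := by rw [hH, ← Matrix.mul_assoc, z4, Matrix.zero_mul]
  have c1 : G₁ * G₁† * L₁ = L₁ := (projR_mul_eq_zero_iff.1 h1).symm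
  have c1' : L₁ * (H₁† * H₁) = L₁ := (mul_projL_eq_zero_iff.1 h1').symm
  have c2 : G₂ * G₂† * L₂ = L₂ := (projR_mul_eq_zero_iff.1 h2).symm
  have c2' : L₂ * (H₂† * H₂) = L₂ := (mul_projL_eq_zero_iff.1 h2').symm
  constructor
  · have e1 : G₁ * (G₁† * L₁ * H₁†) * H₁ = L₁ := by
      calc _ = G₁ * G₁† * L₁ * (H₁† * H₁) := by simp only [Matrix.mul_assoc]
        _ = L₁ := by rw [c1, c1']
    have e2 : G₁ * (projL G₁ * G₂† * L₂ * H₂†) * H₁ = 0 := by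
      calc _ = G₁ * projL G₁ * (G₂† * L₂ * H₂† * H₁) := by simp only [Matrix.mul_assoc]
        _ = 0 := by rw [z1, Matrix.zero_mul]
    have e3 : G₁ * (projL G₂ * V₁) * H₁ = 0 := by
      rw [← Matrix.mul_assoc, z3, Matrix.zero_mul, Matrix.zero_mul]
    have e4 : G₁ * (V₂ * projR H₁) * H₁ = 0 := by
      rw [← Matrix.mul_assoc, Matrix.mul_assoc, z4, Matrix.mul_zero]
    have e5 : G₁ * (projL G₁ * V₃ * projR H₂) * H₁ = 0 := by
      rw [Matrix.mul_assoc, Matrix.mul_assoc, Matrix.mul_assoc, ← Matrix.mul_assoc, z1,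
        Matrix.zero_mul]
    simp only [Matrix.mul_add, Matrix.add_mul, e1, e2, e3, e4, e5, add_zero]
  · have e1 : G₂ * (G₁† * L₁ * H₁†) * H₂ = G₂ * (G₁† * G₁ * (G₂† * L₂)) := by
      calc _ = G₂ * G₁† * (L₁ * (H₁† * H₁)) * K := by simp only [hH, Matrix.mul_assoc]
        _ = G₂ * G₁† * (L₁ * K) := by rw [c1', Matrix.mul_assoc]
        _ = G₂ * G₁† * (J * (G₂ * G₂† * L₂)) := by rw [hL, c2]
        _ = _ := by simp only [hG, Matrix.mul_assoc]
    have e2 : G₂ * (projL G₁ * G₂† * L₂ * H₂†) * H₂ = L₂ - G₂ * (G₁† * G₁ * (G₂† * L₂)) := by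
      calc _ = G₂ * projL G₁ * G₂† * (L₂ * (H₂† * H₂)) := by simp only [Matrix.mul_assoc]
        _ = G₂ * G₂† * L₂ - G₂ * (G₁† * G₁ * (G₂† * L₂)) := by
          rw [c2', projL]
          simp only [Matrix.mul_sub, Matrix.sub_mul, Matrix.mul_one, Matrix.mul_assoc]
        _ = _ := by rw [c2]
    have e3 : G₂ * (projL G₂ * V₁) * H₂ = 0 := by
      rw [← Matrix.mul_assoc, z2, Matrix.zero_mul, Matrix.zero_mul]
    have e4 : G₂ * (V₂ * projR H₁) * H₂ = 0 := by
      rw [← Matrix.mul_assoc, Matrix.mul_assoc, z6, Matrix.mul_zero]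
    have e5 : G₂ * (projL G₁ * V₃ * projR H₂) * H₂ = 0 := by
      rw [← Matrix.mul_assoc, Matrix.mul_assoc, z5, Matrix.mul_zero]
    simp only [Matrix.mul_add, Matrix.add_mul, e1, e2, e3, e4, e5, add_zero]
    abel

theorem pair_complete {G₂ : Matrix a b ℍ[ℝ]} {J : Matrix c a ℍ[ℝ]} {H₁ : Matrix d e ℍ[ℝ]}
    {K : Matrix e f ℍ[ℝ]} {L₁ : Matrix c e ℍ[ℝ]} {L₂ : Matrix a f ℍ[ℝ]} {G₁ : Matrix c b ℍ[ℝ]}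
    {H₂ : Matrix d f ℍ[ℝ]} {W : Matrix b d ℍ[ℝ]}
    (hG : G₁ = J * G₂) (hH : H₂ = H₁ * K) (h1 : G₁ * W * H₁ = L₁) (h2 : G₂ * W * H₂ = L₂) :
    ∃ V₁ V₂ V₃ : Matrix b d ℍ[ℝ], W = G₁† * L₁ * H₁† + projL G₁ * G₂† * L₂ * H₂† + projL G₂ * V₁ +
        V₂ * projR H₁
      + projL G₁ * V₃ * projR H₂ := by
  have e1 : G₁† * G₁ * (G₂† * G₂) = G₁† * G₁ := by
    rw [hG, Matrix.mul_assoc, Matrix.mul_assoc J, ← Matrix.mul_assoc G₂, mul_pinv_mul]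
  have e2 : H₁ * H₁† * (H₂ * H₂†) = H₂ * H₂† := by
    rw [hH, ← Matrix.mul_assoc, ← Matrix.mul_assoc, mul_pinv_mul]
  -- The projectors are nested, G₁†G₁ below G₂†G₂ and H₂H₂† below H₁H₁†. The third witness fills the
  -- block of W seen by G₂ and H₁ but by neither G₁ nor H₂.
  refine ⟨W, G₂† * G₂ * W, G₂† * G₂ * W * (H₁ * H₁†), ?_⟩
  subst h1 h2
  have k1 : projL G₁ * (G₂† * G₂) = G₂† * G₂ - G₁† * G₁ := by
    rw [projL, Matrix.sub_mul, e1, Matrix.one_mul]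
  have k2 : H₁ * H₁† * projR H₂ = H₁ * H₁† - H₂ * H₂† := by
    rw [projR, Matrix.mul_sub, e2, Matrix.mul_one]
  have t1 : projL G₁ * G₂† * (G₂ * W * H₂) * H₂†
      = (G₂† * G₂ - G₁† * G₁) * W * (H₂ * H₂†) := by
    rw [← k1]; simp only [Matrix.mul_assoc]
  have t2 : projL G₁ * (G₂† * G₂ * W * (H₁ * H₁†)) * projR H₂
      = (G₂† * G₂ - G₁† * G₁) * W * (H₁ * H₁† - H₂ * H₂†) := by
    rw [← k1, ← k2]; simp only [Matrix.mul_assoc]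
  rw [t1, t2]
  simp only [projL, projR, Matrix.mul_sub, Matrix.sub_mul, Matrix.one_mul, Matrix.mul_one,
      Matrix.mul_assoc]
  abel

end Equations

/-! ### The paired constraints AX = C and XA^{η*} = C^{η*} -/

section HermitianPair

variable {m n : Type*} [Fintype m] [Fintype n] [DecidableEq m] [DecidableEq n] {η : ℍ[ℝ]}
  {A C : Matrix m n ℍ[ℝ]} {X : Matrix n n ℍ[ℝ]}

local postfix:max "ᵑ" => etaStar η

theorem hermitianPair_complete (hη : IsPureUnit η) (h : A * X = C) (h' : X * Aᵑ = Cᵑ) :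
    X = A† * C + projL A * Cᵑ * Aᵑ† + projL A * X * (projL A)ᵑ := by
  rw [etaStar_projL hη, ← h', ← h]
  simp only [projL, projR, Matrix.mul_sub, Matrix.sub_mul, Matrix.one_mul, Matrix.mul_one,
    Matrix.mul_assoc]
  abel

/-- AC^{η*} = CA^{η*} is the compatibility of the two one-sided equations: both sides are A X
A^{η*}. -/
theorem hermitianPair_sound (hη : IsPureUnit η) (h : projR A * C = 0) (h' : A * Cᵑ = C * Aᵑ)
    (U : Matrix n n ℍ[ℝ]) :
    A * (A† * C + projL A * Cᵑ * Aᵑ† + projL A * U * (projL A)ᵑ) = C ∧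
      (A† * C + projL A * Cᵑ * Aᵑ† + projL A * U * (projL A)ᵑ) * Aᵑ = Cᵑ := by
  have h1 : A * A† * C = C := (projR_mul_eq_zero_iff.1 h).symm
  have h2 : Cᵑ * (Aᵑ† * Aᵑ) = Cᵑ := by
    have := congrArg (etaStar η) h1
    rwa [etaStar_mul hη, etaStar_mul hη, etaStar_pinv hη] at this
  constructor
  · rw [Matrix.mul_add, Matrix.mul_add]
    simp only [← Matrix.mul_assoc]
    rw [mul_projL, h1]
    simp only [Matrix.zero_mul, add_zero]
  · rw [etaStar_projL hη, Matrix.add_mul, Matrix.add_mul, Matrix.mul_assoc _ (projR Aᵑ), projR_mul,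
      Matrix.mul_assoc _ Aᵑ†, Matrix.mul_assoc (projL A), h2, Matrix.mul_assoc A†, ← h', projL,
      Matrix.sub_mul, Matrix.one_mul, Matrix.mul_zero, Matrix.mul_assoc A†]
    abel

/-- Expanded, the expression is A†C + (A†C)^{η*} minus the overlap A†C A^{η*}(A^{η*})†, which `h'`
makes self-adjoint. -/
theorem hermitianPair_etaStar (hη : IsPureUnit η) (h' : A * Cᵑ = C * Aᵑ) :
    (A† * C + projL A * Cᵑ * Aᵑ†)ᵑ = A† * C + projL A * Cᵑ * Aᵑ† := by
  have h1 : A† * A * Cᵑ * Aᵑ† = A† * C * (Aᵑ * Aᵑ†) := by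
    rw [Matrix.mul_assoc A†, h']; simp only [Matrix.mul_assoc]
  simp only [etaStar_add, etaStar_mul hη, etaStar_pinv hη, etaStar_projL hη, etaStar_etaStar hη]
  simp only [projL, projR, Matrix.sub_mul, Matrix.mul_sub, Matrix.one_mul, Matrix.mul_one, h1]
  simp only [Matrix.mul_assoc]
  abel

end HermitianPair

/-! ### Elimination down to the third unknown -/

namespace System

variable {p m₁ m₂ m₃ m₄ n₁ n₂ n₃ n₄ : ℕ} {η : ℍ[ℝ]} {D : System p m₁ m₂ m₃ m₄ n₁ n₂ n₃ n₄}

local postfix:max "ᵑ" => etaStar η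

/-- The equation that remains after the constraints `A_i X_i = C_i` have been solved. -/
theorem main_eq_iff (hη : IsPureUnit η) {u : Matrix (Fin n₁) (Fin p) ℍ[ℝ]}
    {v : Matrix (Fin p) (Fin n₁) ℍ[ℝ]}
    {U₁ : Matrix (Fin n₂) (Fin n₂) ℍ[ℝ]} {U₂ : Matrix (Fin n₃) (Fin n₃) ℍ[ℝ]}
    {U₃ : Matrix (Fin n₄) (Fin n₄) ℍ[ℝ]} :
    D.E₁ * (D.A₁† * D.C₁ + projL D.A₁ * u) + (D.C₁ᵑ * D.A₁ᵑ† + v * projR D.A₁ᵑ) * D.E₁ᵑ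
      + D.E₂ * (D.A₂† * D.C₂ + projL D.A₂ * D.C₂ᵑ * D.A₂ᵑ† + projL D.A₂ * U₁ * (projL D.A₂)ᵑ)
        * D.E₂ᵑ
      + D.E₃ * (D.A₃† * D.C₃ + projL D.A₃ * D.C₃ᵑ * D.A₃ᵑ† + projL D.A₃ * U₂ * (projL D.A₃)ᵑ)
        * D.E₃ᵑ
      + D.E₄ * (D.A₄† * D.C₄ + projL D.A₄ * D.C₄ᵑ * D.A₄ᵑ† + projL D.A₄ * U₃ * (projL D.A₄)ᵑ)
        * D.E₄ᵑ = D.Cc ↔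
    D.A₁₁ * u + v * D.A₁₁ᵑ
      = D.T₁ η - D.A₂₂ * U₁ * D.A₂₂ᵑ - D.A₃₃ * U₂ * D.A₃₃ᵑ - D.A₄₄ * U₃ * D.A₄₄ᵑ := by
  rw [← sub_eq_zero, ← sub_eq_zero (b := _ - _)]
  simp only [A₁₁, A₂₂, A₃₃, A₄₄, T₁, etaStar_mul hη, etaStar_projL hη, Matrix.mul_add,
    Matrix.add_mul, Matrix.mul_assoc]
  refine Eq.congr ?_ rfl
  abel

variable (η D) in
/-- The equation in three unknowns that remains after `u` and `v` have been eliminated. -/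
def IsReduced (U₁ : Matrix (Fin n₂) (Fin n₂) ℍ[ℝ]) (U₂ : Matrix (Fin n₃) (Fin n₃) ℍ[ℝ])
    (U₃ : Matrix (Fin n₄) (Fin n₄) ℍ[ℝ]) : Prop :=
  D.A₁₂ * U₁ * D.A₁₂ᵑ + D.A₁₃ * U₂ * D.A₁₃ᵑ = D.T₂ η - D.A₁₄ * U₃ * D.A₁₄ᵑ

/-- This is the solvability condition R_A T L_B = 0 of the Sylvester equation for u and v. -/
theorem isReduced_iff (hη : IsPureUnit η)
    {U₁ : Matrix (Fin n₂) (Fin n₂) ℍ[ℝ]} {U₂ : Matrix (Fin n₃) (Fin n₃) ℍ[ℝ]}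
    {U₃ : Matrix (Fin n₄) (Fin n₄) ℍ[ℝ]} :
    D.IsReduced η U₁ U₂ U₃ ↔
      projR D.A₁₁ * (D.T₁ η - D.A₂₂ * U₁ * D.A₂₂ᵑ - D.A₃₃ * U₂ * D.A₃₃ᵑ - D.A₄₄ * U₃ * D.A₄₄ᵑ)
        * projL D.A₁₁ᵑ = 0 := by
  rw [IsReduced, ← sub_eq_zero, ← neg_eq_zero]
  simp only [A₁₂, A₁₃, A₁₄, T₂, etaStar_mul hη, etaStar_projR hη, Matrix.mul_sub,
    Matrix.sub_mul, Matrix.mul_assoc]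
  refine Eq.congr ?_ rfl
  abel

variable (η D) in
/-- The four equations that characterize the third unknown of the reduced equation. -/
structure FourEquations (W : Matrix (Fin n₄) (Fin n₄) ℍ[ℝ]) : Prop where
  eq₁ : D.G₁ * W * D.G₄ᵑ = D.L₁ η
  eq₂ : D.G₂ * W * D.G₃ᵑ = D.L₂ η
  eq₃ : D.G₃ * W * D.G₂ᵑ = D.L₃ η
  eq₄ : D.G₄ * W * D.G₁ᵑ = D.L₄ η

theorem G_mul_A₁₂ : D.G * D.A₁₂ = 0 := by
  rw [G, Matrix.mul_assoc, projR_mul, Matrix.mul_zero]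

theorem G_mul_A₁₃ : D.G * D.A₁₃ = 0 := by
  rw [G, Matrix.mul_assoc, ← M₁, projR_mul]

theorem G_mul_projR_A₁₃ : D.G * projR D.A₁₃ = D.G := mul_projR_of_mul_eq_zero G_mul_A₁₃

theorem G₁_eq : D.G₁ = projR D.M₁ * D.G₂ := by rw [G₁, G, G₂, Matrix.mul_assoc]

theorem G₃_eq : D.G₃ = projR D.A₁₃ * D.G₄ := rfl

theorem star_G₁_eq (hη : IsPureUnit η) : D.G₁ᵑ = D.G₂ᵑ * (projR D.M₁)ᵑ := by
  rw [G₁_eq, etaStar_mul hη]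

theorem star_G₃_eq (hη : IsPureUnit η) : D.G₃ᵑ = D.G₄ᵑ * (projR D.A₁₃)ᵑ := by
  rw [G₃_eq, etaStar_mul hη]

/-- The overlap condition `hL` of `pair_sound` for the first pair; `L₃_mul_eq` plays the same role
for the second. -/
theorem L₁_mul_eq : D.L₁ η * (projR D.A₁₃)ᵑ = projR D.M₁ * D.L₂ η := by
  simp only [L₁, L₂, G, Matrix.mul_assoc]

theorem L₃_mul_eq (hη : IsPureUnit η) : D.L₃ η * (projR D.M₁)ᵑ = projR D.A₁₃ * D.L₄ η := by
  simp only [L₃, L₄, G, etaStar_mul hη, Matrix.mul_assoc]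

theorem fourEquations_iff (hη : IsPureUnit η) {W : Matrix (Fin n₄) (Fin n₄) ℍ[ℝ]} :
    D.FourEquations η W ↔ D.G * (D.T₂ η - D.A₁₄ * W * D.A₁₄ᵑ) = 0 ∧
      projR D.A₁₂ * (D.T₂ η - D.A₁₄ * W * D.A₁₄ᵑ) * (projR D.A₁₃)ᵑ = 0 ∧
      projR D.A₁₃ * (D.T₂ η - D.A₁₄ * W * D.A₁₄ᵑ) * (projR D.A₁₂)ᵑ = 0 ∧
      (D.T₂ η - D.A₁₄ * W * D.A₁₄ᵑ) * D.Gᵑ = 0 := by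
  have h : D.FourEquations η W ↔ D.G₁ * W * D.G₄ᵑ = D.L₁ η ∧ D.G₂ * W * D.G₃ᵑ = D.L₂ η ∧
    D.G₃ * W * D.G₂ᵑ = D.L₃ η ∧ D.G₄ * W * D.G₁ᵑ = D.L₄ η :=
    ⟨fun h => ⟨h.1, h.2, h.3, h.4⟩, fun h => ⟨h.1, h.2.1, h.2.2.1, h.2.2.2⟩⟩
  rw [h]
  simp only [G₁, G₂, G₃, G₄, L₁, L₂, L₃, L₄, Matrix.mul_sub, Matrix.sub_mul, sub_eq_zero,
    etaStar_mul hη, Matrix.mul_assoc]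
  simp only [eq_comm]

/-- G annihilates both A₁₂ and A₁₃, while each mixed pair of projectors kills one term from the left
and the other from the right. -/
theorem IsReduced.fourEquations (hη : IsPureUnit η)
    {U₁ : Matrix (Fin n₂) (Fin n₂) ℍ[ℝ]} {U₂ : Matrix (Fin n₃) (Fin n₃) ℍ[ℝ]}
    {U₃ : Matrix (Fin n₄) (Fin n₄) ℍ[ℝ]} (h : D.IsReduced η U₁ U₂ U₃) :
    D.FourEquations η U₃ := by
  have r2 : D.A₁₂ᵑ * (projR D.A₁₂)ᵑ = 0 := by rw [← etaStar_mul hη, projR_mul, etaStar_zero]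
  have r3 : D.A₁₃ᵑ * (projR D.A₁₃)ᵑ = 0 := by rw [← etaStar_mul hη, projR_mul, etaStar_zero]
  have g2 : D.A₁₂ᵑ * D.Gᵑ = 0 := by rw [← etaStar_mul hη, G_mul_A₁₂, etaStar_zero]
  have g3 : D.A₁₃ᵑ * D.Gᵑ = 0 := by rw [← etaStar_mul hη, G_mul_A₁₃, etaStar_zero]
  rw [fourEquations_iff hη, ← h]
  refine ⟨?_, ?_, ?_, ?_⟩
  · simp only [Matrix.mul_add, ← Matrix.mul_assoc, G_mul_A₁₂, G_mul_A₁₃, Matrix.zero_mul, add_zero]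
  · simp only [Matrix.mul_add, Matrix.add_mul, Matrix.mul_assoc, r3, Matrix.mul_zero, add_zero]
    rw [← Matrix.mul_assoc, projR_mul, Matrix.zero_mul]
  · simp only [Matrix.mul_add, Matrix.add_mul, Matrix.mul_assoc, r2, Matrix.mul_zero, zero_add]
    rw [← Matrix.mul_assoc, projR_mul, Matrix.zero_mul]
  · simp only [Matrix.add_mul, Matrix.mul_assoc, g2, g3, Matrix.mul_zero, add_zero]

/-- The four equations are exactly the hypotheses of `twoTerm_exists` for the right side T₂ −
A₁₄WA₁₄^{η*}. -/
theorem FourEquations.exists_isReduced (hη : IsPureUnit η) {W : Matrix (Fin n₄) (Fin n₄) ℍ[ℝ]}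
    (h : D.FourEquations η W) : ∃ U₁ U₂, D.IsReduced η U₁ U₂ W := by
  obtain ⟨h1, h2, h3, h4⟩ := (fourEquations_iff hη).1 h
  have hN : D.M₁ᵑ = D.A₁₃ᵑ * projL D.A₁₂ᵑ := by rw [M₁, etaStar_mul hη, etaStar_projR hη]
  rw [G, Matrix.mul_assoc] at h1
  rw [etaStar_projR hη] at h2
  rw [etaStar_projR hη, Matrix.mul_assoc] at h3
  rw [G, etaStar_mul hη, etaStar_projR hη, etaStar_projR hη, ← Matrix.mul_assoc] at h4
  obtain ⟨U₁, U₂, h⟩ := twoTerm_exists (M := D.M₁) (by rw [M₁]) hN h1 h2 h3 h4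
  exact ⟨U₁, U₂, h⟩

/-! #### The third unknown -/

variable (P : Parameters p n₁ n₂ n₃ n₄)

theorem C₁₁_mul_fromRows (V₁ W₁ : Matrix (Fin n₄) (Fin n₄) ℍ[ℝ]) :
    D.C₁₁ * Matrix.fromRows V₁ W₁ = projL D.G₂ * V₁ + projL D.G₄ * W₁ :=
  Matrix.fromCols_mul_fromRows _ _ _ _

theorem fromCols_mul_star_C₁₁ (hη : IsPureUnit η) (W₂ V₂ : Matrix (Fin n₄) (Fin n₄) ℍ[ℝ]) :
    Matrix.fromCols W₂ V₂ * D.C₁₁ᵑ = W₂ * projR D.G₂ᵑ + V₂ * projR D.G₄ᵑ := by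
  rw [C₁₁, etaStar_fromCols, etaStar_projL hη, etaStar_projL hη, Matrix.fromCols_mul_fromRows]

theorem U₃_sub_U₃' (hη : IsPureUnit η) :
    D.U₃ η P - D.U₃' η P = D.C₁₁ * D.VW η P + D.WV η P * D.C₁₁ᵑ - D.K η P := by
  have e1 : D.VW η P = Matrix.fromRows (D.V₁ η P) (D.W₁ η P) := (Matrix.fromRows_toRows _).symm
  have e2 : D.WV η P = Matrix.fromCols (D.W₂ η P) (D.V₂ η P) := (Matrix.fromCols_toCols _).symm
  rw [e1, e2, C₁₁_mul_fromRows, fromCols_mul_star_C₁₁ hη, U₃, U₃', K, F, C₂₂, C₃₃, etaStar_projL hη,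
    etaStar_projL hη]
  abel

/-- The columns of C₁₁ span ker G₂ + ker G₄, which is ker G₂ since G₂ is a left multiple of G₄. Its
orthogonal complement is the range of G₂†G₂. -/
theorem projR_C₁₁ : projR D.C₁₁ = D.G₂† * D.G₂ := by
  have h1 : D.G₂ * projL D.G₄ = 0 := by
    rw [G₂, ← G₄, Matrix.mul_assoc, mul_projL, Matrix.mul_zero]
  have h2 : D.G₂† * D.G₂ * D.C₁₁ = 0 := by
    rw [Matrix.mul_assoc, C₁₁, Matrix.mul_fromCols, mul_projL, h1, Matrix.fromCols_zero,
      Matrix.mul_zero]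
  have h3 : projR D.C₁₁ * projL D.G₂ = 0 := by
    have := projR_mul D.C₁₁
    conv at this => lhs; rw [C₁₁, Matrix.mul_fromCols, ← C₁₁]
    have := congrArg Matrix.toCols₁ this
    rwa [Matrix.toCols₁_fromCols] at this
  have h4 : projR D.C₁₁ * (D.G₂† * D.G₂) = projR D.C₁₁ := (mul_projL_eq_zero_iff.1 h3).symm
  have h5 := congrArg Matrix.conjTranspose (mul_projR_of_mul_eq_zero h2)
  rw [Matrix.conjTranspose_mul, conjTranspose_pinv_mul, conjTranspose_projR, h4] at h5
  exact h5

theorem star_projR_C₁₁ (hη : IsPureUnit η) : (projR D.C₁₁)ᵑ = D.G₂ᵑ * D.G₂ᵑ† := by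
  rw [projR_C₁₁, etaStar_mul hη, etaStar_pinv hη]

theorem projR_C₁₁_mul_E₁₁ : projR D.C₁₁ * D.E₁₁ = D.E₁₁ := by
  rw [E₁₁, ← Matrix.mul_assoc, projR_mul_projR]

theorem projR_C₁₁_mul_E₂₂ : projR D.C₁₁ * D.E₂₂ = D.E₂₂ := by
  rw [E₂₂, ← Matrix.mul_assoc, projR_mul_projR]

theorem M_eq_of_mul (Q : Matrix (Fin n₄) (Fin n₄) ℍ[ℝ]) (h1 : Q * D.E₁₁ = D.E₁₁)
    (h2 : Q * D.E₂₂ = D.E₂₂) : Q * D.M = D.M := by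
  rw [M, projR, Matrix.sub_mul, Matrix.mul_sub, Matrix.one_mul, h2, Matrix.mul_assoc,
    ← Matrix.mul_assoc Q, h1]

theorem N_eq (hη : IsPureUnit η) : D.N η = D.E₁₁ᵑ * projL D.E₂₂ᵑ := by
  rw [N, etaStar_mul hη, etaStar_projR hη]

theorem N_mul_star_projR_C₁₁ (hη : IsPureUnit η) : D.N η * (projR D.C₁₁)ᵑ = D.N η := by
  have h : projR D.E₂₂ * D.E₁₁ = D.E₁₁ - D.E₂₂ * (D.E₂₂† * D.E₁₁) := by
    rw [projR, Matrix.sub_mul, Matrix.one_mul, Matrix.mul_assoc]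
  rw [N, ← etaStar_mul hη, h, Matrix.mul_sub, projR_C₁₁_mul_E₁₁, ← Matrix.mul_assoc,
    projR_C₁₁_mul_E₂₂]

theorem conjTranspose_star_projR (hη : IsPureUnit η) {m n : Type*} [Fintype m] [Fintype n]
    [DecidableEq m] [DecidableEq n] (A : Matrix m n ℍ[ℝ]) : ((projR A)ᵑ)ᴴ = (projR A)ᵑ := by
  rw [etaStar_projR hη, conjTranspose_projL]

theorem E₁₁_pinv_mul : D.E₁₁† * projR D.C₁₁ = D.E₁₁† :=
  pinv_mul_of_mul_eq (conjTranspose_projR _) projR_C₁₁_mul_E₁₁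

theorem E₂₂_pinv_mul : D.E₂₂† * projR D.C₁₁ = D.E₂₂† :=
  pinv_mul_of_mul_eq (conjTranspose_projR _) projR_C₁₁_mul_E₂₂

theorem M_pinv_mul : D.M† * projR D.C₁₁ = D.M† :=
  pinv_mul_of_mul_eq (conjTranspose_projR _)
    (M_eq_of_mul _ projR_C₁₁_mul_E₁₁ projR_C₁₁_mul_E₂₂)

theorem mul_star_E₁₁_pinv (hη : IsPureUnit η) : (projR D.C₁₁)ᵑ * D.E₁₁ᵑ† = D.E₁₁ᵑ† :=
  mul_pinv_of_mul_eq (conjTranspose_star_projR hη _) (by rw [← etaStar_mul hη, projR_C₁₁_mul_E₁₁])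

theorem mul_star_E₂₂_pinv (hη : IsPureUnit η) : (projR D.C₁₁)ᵑ * D.E₂₂ᵑ† = D.E₂₂ᵑ† :=
  mul_pinv_of_mul_eq (conjTranspose_star_projR hη _) (by rw [← etaStar_mul hη, projR_C₁₁_mul_E₂₂])

theorem mul_N_pinv (hη : IsPureUnit η) : (projR D.C₁₁)ᵑ * (D.N η)† = (D.N η)† :=
  mul_pinv_of_mul_eq (conjTranspose_star_projR hη _) (N_mul_star_projR_C₁₁ hη)

/-- The formulas for `V₃` and `W₃` are written with F, the two-term solution with E. The two differ
by projectors that the neighbouring pseudoinverses absorb. -/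
theorem mul_E_mul {a b c : Type*} [Fintype b] [Fintype c] (X : Matrix a b ℍ[ℝ])
    {Y : Matrix b (Fin n₄) ℍ[ℝ]} {Z : Matrix (Fin n₄) c ℍ[ℝ]} (hY : Y * projR D.C₁₁ = Y)
    (hZ : (projR D.C₁₁)ᵑ * Z = Z) : X * Y * D.E η * Z = X * Y * D.F η * Z := by
  calc X * Y * D.E η * Z = X * (Y * projR D.C₁₁) * D.F η * ((projR D.C₁₁)ᵑ * Z) := by
        simp only [E, Matrix.mul_assoc]
    _ = _ := by rw [hY, hZ]

theorem V₃_eq (hη : IsPureUnit η) : D.V₃ η P = twoTermX D.E₁₁ D.E₂₂ᵑ D.E₂₂ D.E₁₁ᵑ (D.E η) D.M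
    (D.N η) D.S P.U₃₁ P.U₃₂ P.U₃₃ := by
  have h1 := mul_E_mul (D := D) (η := η) (1 : Matrix (Fin n₄) (Fin n₄) ℍ[ℝ]) E₁₁_pinv_mul
      (mul_star_E₂₂_pinv hη)
  rw [Matrix.one_mul] at h1
  rw [V₃, twoTermX, h1, mul_E_mul _ M_pinv_mul (mul_star_E₂₂_pinv hη),
    mul_E_mul _ E₂₂_pinv_mul (mul_N_pinv hη), etaStar_projL hη]

theorem W₃_eq (hη : IsPureUnit η) : D.W₃ η P = twoTermY D.E₂₂ D.E₁₁ᵑ (D.E η) D.M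
    (D.N η) D.S P.U₃₁ P.U₄₁ (-P.U₄₂) := by
  have h1 := mul_E_mul (D := D) (η := η) (1 : Matrix (Fin n₄) (Fin n₄) ℍ[ℝ]) M_pinv_mul
      (mul_star_E₁₁_pinv hη)
  rw [Matrix.one_mul] at h1
  rw [W₃, twoTermY, h1, mul_E_mul _ E₂₂_pinv_mul (mul_N_pinv hη), etaStar_projL hη,
    Matrix.neg_mul, sub_eq_add_neg]

theorem projR_mul_K_mul (hη : IsPureUnit η) : projR D.C₁₁ * D.K η P * projL D.C₁₁ᵑ
    = D.E η - (D.E₁₁ * D.V₃ η P * D.E₂₂ᵑ + D.E₂₂ * D.W₃ η P * D.E₁₁ᵑ) := by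
  simp only [K, E, E₁₁, E₂₂, etaStar_mul hη, Matrix.mul_sub, Matrix.sub_mul, ← etaStar_projR hη,
    Matrix.mul_assoc]
  abel

/-- The equation obtained by equating the two parametrizations of the third unknown. -/
theorem U₃_eq_U₃' (hη : IsPureUnit η) {X Y : Matrix (Fin n₄) (Fin n₄) ℍ[ℝ]}
    (h : D.E₁₁ * X * D.E₂₂ᵑ + D.E₂₂ * Y * D.E₁₁ᵑ = D.E η) : D.U₃ η P = D.U₃' η P := by
  rw [← sub_eq_zero, U₃_sub_U₃' P hη, sub_eq_zero]
  -- The Sylvester criterion holds for every choice of parameters, because `V₃` and `W₃` always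
  -- solve the two-term equation once it is solvable.
  have hK : projR D.C₁₁ * D.K η P * projL D.C₁₁ᵑ = 0 := by
    rw [projR_mul_K_mul P hη, V₃_eq P hη, W₃_eq P hη,
      twoTerm_sound (M := D.M) (S := D.S) h rfl (N_eq hη) rfl, sub_self]
  -- The sign is there because `VW` subtracts its `U₁₂` term.
  have := sylvester_sound hK P.U₁₁ (-P.U₁₂) P.U₂₁
  rw [← etaStar_projL hη] at this
  rw [← this]
  simp only [VW, WV, Matrix.mul_neg]
  congr 2
  · abel_nf
  · rw [add_assoc]

/-- The expression `U₃` satisfies the first pair of equations and `U₃'` the second; their equality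
gives all four. -/
theorem fourEquations_U₃ (hη : IsPureUnit η) (hU : D.U₃ η P = D.U₃' η P)
    (h1 : projR D.G₁ * D.L₁ η = 0) (h1' : D.L₁ η * projL D.G₄ᵑ = 0)
    (h2 : projR D.G₂ * D.L₂ η = 0) (h2' : D.L₂ η * projL D.G₃ᵑ = 0)
    (h3 : projR D.G₃ * D.L₃ η = 0) (h3' : D.L₃ η * projL D.G₂ᵑ = 0)
    (h4 : projR D.G₄ * D.L₄ η = 0) (h4' : D.L₄ η * projL D.G₁ᵑ = 0) :
    D.FourEquations η (D.U₃ η P) := by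
  have k1 := pair_sound G₁_eq (star_G₃_eq hη) h1 h1' h2 h2' L₁_mul_eq (D.V₁ η P) (D.V₂ η P) (D.V₃ η
      P)
  have k2 := pair_sound G₃_eq (star_G₁_eq hη) h3 h3' h4 h4' (L₃_mul_eq hη) (-D.W₁ η P) (-D.W₂ η P)
    (-D.W₃ η P)
  simp only [Matrix.mul_neg, Matrix.neg_mul, ← sub_eq_add_neg] at k2
  change D.G₁ * D.U₃ η P * _ = _ ∧ D.G₂ * D.U₃ η P * _ = _ at k1
  change D.G₃ * D.U₃' η P * _ = _ ∧ D.G₄ * D.U₃' η P * _ = _ at k2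
  rw [← hU] at k2
  exact ⟨k1.1, k1.2, k2.1, k2.2⟩

theorem FourEquations.projR_mul {W : Matrix (Fin n₄) (Fin n₄) ℍ[ℝ]}
    (h : D.FourEquations η W) : (projR D.G₁ * D.L₁ η = 0 ∧ D.L₁ η * projL D.G₄ᵑ = 0) ∧
    (projR D.G₂ * D.L₂ η = 0 ∧ D.L₂ η * projL D.G₃ᵑ = 0) ∧
    (projR D.G₃ * D.L₃ η = 0 ∧ D.L₃ η * projL D.G₂ᵑ = 0) ∧
    (projR D.G₄ * D.L₄ η = 0 ∧ D.L₄ η * projL D.G₁ᵑ = 0) := by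
  have key : ∀ {a b c d : Type} [Fintype a] [Fintype b] [Fintype c] [Fintype d] [DecidableEq a]
      [DecidableEq d] (G : Matrix a b ℍ[ℝ]) (W : Matrix b c ℍ[ℝ]) (H : Matrix c d ℍ[ℝ])
      (L : Matrix a d ℍ[ℝ]), G * W * H = L →
      projR G * L = 0 ∧ L * projL H = 0 := by
    intro a b c d _ _ _ _ _ _ G W H L h
    classical
    rw [← h]
    constructor
    · rw [← Matrix.mul_assoc, ← Matrix.mul_assoc, EtaSylvester.projR_mul, Matrix.zero_mul,
        Matrix.zero_mul]
    · rw [Matrix.mul_assoc, mul_projL, Matrix.mul_zero]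
  exact ⟨key _ _ _ _ h.1, key _ _ _ _ h.2, key _ _ _ _ h.3, key _ _ _ _ h.4⟩

theorem FourEquations.exists_six_term (hη : IsPureUnit η) {W : Matrix (Fin n₄) (Fin n₄) ℍ[ℝ]}
    (h : D.FourEquations η W) : ∃ V₁ V₂ V₃ W₁ W₂ W₃ : Matrix (Fin n₄) (Fin n₄) ℍ[ℝ],
      W = D.F₁ η + projL D.G₂ * V₁ + V₂ * projR D.G₄ᵑ + projL D.G₁ * V₃ * projR D.G₃ᵑ ∧
      D.C₁₁ * Matrix.fromRows V₁ W₁ + Matrix.fromCols W₂ V₂ * D.C₁₁ᵑ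
        = D.F η - D.C₂₂ * V₃ * D.C₃₃ᵑ - D.C₃₃ * W₃ * D.C₂₂ᵑ := by
  obtain ⟨V₁, V₂, V₃, hV⟩ := pair_complete G₁_eq (star_G₃_eq hη) h.1 h.2
  obtain ⟨W₁, W₂, W₃, hW⟩ := pair_complete G₃_eq (star_G₁_eq hη) h.3 h.4
  -- The second form of the third unknown carries minus signs, so that all six unknowns enter the
  -- difference with the same sign.
  refine ⟨V₁, V₂, V₃, -W₁, -W₂, -W₃, hV, ?_⟩
  rw [C₁₁_mul_fromRows, fromCols_mul_star_C₁₁ hη, C₂₂, C₃₃, etaStar_projL hη, etaStar_projL hη, F]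
  rw [← F₁] at hV
  rw [← F₂] at hW
  have hFV : D.F₁ η = W - (projL D.G₂ * V₁ + V₂ * projR D.G₄ᵑ + projL D.G₁ * V₃ * projR D.G₃ᵑ) := by
    conv_rhs => rw [hV]
    abel
  have hFW : D.F₂ η = W - (projL D.G₄ * W₁ + W₂ * projR D.G₂ᵑ + projL D.G₃ * W₃ * projR D.G₁ᵑ) := by
    conv_rhs => rw [hW]
    abel
  rw [hFV, hFW]
  simp only [Matrix.mul_neg, Matrix.neg_mul]
  abel

/-- R_{C₁₁} on the left and its η-star on the right annihilate the Sylvester part. -/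
theorem two_term_of_six_term (hη : IsPureUnit η)
    {V₁ V₂ V₃ W₁ W₂ W₃ : Matrix (Fin n₄) (Fin n₄) ℍ[ℝ]}
    (h : D.C₁₁ * Matrix.fromRows V₁ W₁ + Matrix.fromCols W₂ V₂ * D.C₁₁ᵑ
        = D.F η - D.C₂₂ * V₃ * D.C₃₃ᵑ - D.C₃₃ * W₃ * D.C₂₂ᵑ) :
    D.E₁₁ * V₃ * D.E₂₂ᵑ + D.E₂₂ * W₃ * D.E₁₁ᵑ = D.E η := by
  have h1 := congrArg (fun X => projR D.C₁₁ * X * (projR D.C₁₁)ᵑ) h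
  have h2 : D.C₁₁ᵑ * (projR D.C₁₁)ᵑ = 0 := by rw [← etaStar_mul hη, EtaSylvester.projR_mul,
    etaStar_zero]
  simp only [Matrix.mul_add, Matrix.add_mul] at h1
  rw [← Matrix.mul_assoc, EtaSylvester.projR_mul, Matrix.zero_mul, Matrix.zero_mul,
    Matrix.mul_assoc _ _ (projR D.C₁₁)ᵑ, Matrix.mul_assoc _ _ (projR D.C₁₁)ᵑ, h2, Matrix.mul_zero,
    Matrix.mul_zero, add_zero] at h1
  rw [eq_comm, ← sub_eq_zero, E, h1]
  simp only [E₁₁, E₂₂, etaStar_mul hη, Matrix.mul_sub, Matrix.sub_mul, Matrix.mul_assoc]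
  abel

theorem FourEquations.exists_parameters (hη : IsPureUnit η) {W : Matrix (Fin n₄) (Fin n₄) ℍ[ℝ]}
    (h : D.FourEquations η W) : ∃ P : Parameters p n₁ n₂ n₃ n₄, W = D.U₃ η P := by
  obtain ⟨V₁, V₂, V₃, W₁, W₂, W₃, hW, h6⟩ := h.exists_six_term hη
  have h2 := two_term_of_six_term hη h6
  obtain ⟨hX, hY⟩ := twoTerm_complete h2 rfl (N_eq hη) rfl
  obtain ⟨hu, hv⟩ := sylvester_complete h6
  -- The nonzero fields are the parameters for which `sylvester_complete` and `twoTerm_complete`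
  -- return the given matrices; the signs of `U₁₂` and `U₄₂` undo those in `VW` and `W₃`.
  set P : Parameters p n₁ n₂ n₃ n₄ :=
    { W₁₁ := 0, W₁₂ := 0, W₁₃ := 0, U₄ := 0, U₅ := 0, U₆ := 0, U₇ := 0, U₈ := 0
      U₁₁ := Matrix.fromCols W₂ V₂
      U₁₂ := -Matrix.fromRows V₁ W₁
      U₂₁ := projR D.C₁₁ * Matrix.fromCols W₂ V₂
      U₃₁ := W₃
      U₃₂ := V₃
      U₃₃ := D.E₁₁† * D.E₁₁ * V₃
      U₄₁ := W₃ * D.N η * (D.N η)†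
      U₄₂ := -(D.M† * D.M * W₃) } with hP
  have eV₃ : D.V₃ η P = V₃ := by rw [V₃_eq P hη]; exact hX.symm
  have eW₃ : D.W₃ η P = W₃ := by
    rw [W₃_eq P hη, hP]; simp only [neg_neg]; exact hY.symm
  have eVW : D.VW η P = Matrix.fromRows V₁ W₁ := by
    rw [VW, K, eV₃, eW₃]
    conv_rhs => rw [hu]
    simp only [hP, Matrix.mul_neg]
    abel
  have eWV : D.WV η P = Matrix.fromCols W₂ V₂ := by
    rw [WV, K, eV₃, eW₃, etaStar_projL hη]
    conv_rhs => rw [hv]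
    simp only [hP]
    rw [add_assoc]
  refine ⟨P, ?_⟩
  rw [U₃, System.V₁, System.V₂, eVW, eWV, eV₃, Matrix.toRows₁_fromRows, Matrix.toCols₂_fromCols]
  exact hW

end System

/-! ### Solvability and general solution in terms of projectors -/

namespace System

variable {p m₁ m₂ m₃ m₄ n₁ n₂ n₃ n₄ : ℕ} {η : ℍ[ℝ]} {D : System p m₁ m₂ m₃ m₄ n₁ n₂ n₃ n₄}

local postfix:max "ᵑ" => etaStar η

variable (D) in
/-- Consistency of the constraints `A_i X_i = C_i`. -/
structure Consistent : Prop where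
  C₁ : projR D.A₁ * D.C₁ = 0
  C₂ : projR D.A₂ * D.C₂ = 0
  C₃ : projR D.A₃ * D.C₃ = 0
  C₄ : projR D.A₄ * D.C₄ = 0

/-! #### Necessity and completeness -/

section Unconstrained

variable {U : Matrix (Fin n₁) (Fin p) ℍ[ℝ]} {V : Matrix (Fin p) (Fin n₁) ℍ[ℝ]}
    {X : Matrix (Fin n₂) (Fin n₂) ℍ[ℝ]} {Y : Matrix (Fin n₃) (Fin n₃) ℍ[ℝ]}
    {Z : Matrix (Fin n₄) (Fin n₄) ℍ[ℝ]}

theorem IsUnconstrainedSolution.eq_pinv (h : D.IsUnconstrainedSolution η U V X Y Z) :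
    U = D.A₁† * D.C₁ + projL D.A₁ * U ∧ V = D.C₁ᵑ * D.A₁ᵑ† + V * projR D.A₁ᵑ := by
  constructor
  · rw [← h.eq_U]; simp only [projL, Matrix.sub_mul, Matrix.one_mul, Matrix.mul_assoc]; abel
  · rw [← h.eq_V]; simp only [projR, Matrix.mul_sub, Matrix.mul_one, Matrix.mul_assoc]; abel

theorem IsUnconstrainedSolution.main_eq (hη : IsPureUnit η)
    (h : D.IsUnconstrainedSolution η U V X Y Z) : D.A₁₁ * U + V * D.A₁₁ᵑ
      = D.T₁ η - D.A₂₂ * X * D.A₂₂ᵑ - D.A₃₃ * Y * D.A₃₃ᵑ - D.A₄₄ * Z * D.A₄₄ᵑ := by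
  rw [← main_eq_iff hη, ← h.eq_pinv.1, ← h.eq_pinv.2, ← hermitianPair_complete hη h.eq_X h.eq_X',
    ← hermitianPair_complete hη h.eq_Y h.eq_Y', ← hermitianPair_complete hη h.eq_Z h.eq_Z',
    h.eq_main]

theorem IsUnconstrainedSolution.isReduced (hη : IsPureUnit η)
    (h : D.IsUnconstrainedSolution η U V X Y Z) : D.IsReduced η X Y Z := by
  rw [isReduced_iff hη, ← h.main_eq hη, Matrix.mul_add, Matrix.add_mul, ← Matrix.mul_assoc,
    EtaSylvester.projR_mul, Matrix.mul_assoc _ (V * _), Matrix.mul_assoc V, mul_projL]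
  simp only [Matrix.zero_mul, Matrix.mul_zero, add_zero]

theorem IsUnconstrainedSolution.consistent (h : D.IsUnconstrainedSolution η U V X Y Z) :
    D.Consistent := by
  constructor
  · rw [← h.eq_U, ← Matrix.mul_assoc, EtaSylvester.projR_mul, Matrix.zero_mul]
  · rw [← h.eq_X, ← Matrix.mul_assoc, EtaSylvester.projR_mul, Matrix.zero_mul]
  · rw [← h.eq_Y, ← Matrix.mul_assoc, EtaSylvester.projR_mul, Matrix.zero_mul]
  · rw [← h.eq_Z, ← Matrix.mul_assoc, EtaSylvester.projR_mul, Matrix.zero_mul]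

theorem IsUnconstrainedSolution.exists_parameters (hη : IsPureUnit η)
    (h : D.IsUnconstrainedSolution η U V X Y Z) : ∃ P : Parameters p n₁ n₂ n₃ n₄,
      U = D.Utilde η P ∧ V = D.Vtilde η P ∧ X = D.Xtilde η P ∧ Y = D.Ytilde η P ∧
        Z = D.Ztilde η P := by
  have hred := h.isReduced hη
  obtain ⟨P₀, hP₀⟩ := (hred.fourEquations hη).exists_parameters hη
  have hN : D.M₁ᵑ = D.A₁₃ᵑ * projL D.A₁₂ᵑ := by rw [M₁, etaStar_mul hη, etaStar_projR hη]
  obtain ⟨hX, hY⟩ := twoTerm_complete (M := D.M₁) (S := D.S₁) hred (by rw [M₁]) hN (by rw [S₁])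
  obtain ⟨hu, hv⟩ := sylvester_complete (h.main_eq hη)
  -- The fields inherited from `P₀` reproduce Z; the others are read off from `twoTerm_complete` and
  -- `sylvester_complete`.
  let P : Parameters p n₁ n₂ n₃ n₄ :=
    { P₀ with
      W₁₁ := V
      W₁₂ := U
      W₁₃ := projR D.A₁₁ * V
      U₄ := Y
      U₅ := X
      U₆ := D.A₁₂† * D.A₁₂ * X
      U₇ := Y * D.M₁ᵑ * D.M₁ᵑ†
      U₈ := D.M₁† * D.M₁ * Y }
  -- None of the overwritten fields enters `U₃`, so the equation for `P₀` carries over by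
  -- definition.
  have e3 : D.U₃ η P = Z := hP₀.symm
  have e1 : D.U₁ η P = X := by
    rw [U₁, T, e3]
    simp only [etaStar_pinv hη]
    exact hX.symm
  have e2 : D.U₂ η P = Y := by
    rw [U₂, T, e3]
    simp only [etaStar_pinv hη]
    rw [add_right_comm]
    exact hY.symm
  have e0 : D.T₀ η P
      = D.T₁ η - D.A₂₂ * X * D.A₂₂ᵑ - D.A₃₃ * Y * D.A₃₃ᵑ - D.A₄₄ * Z * D.A₄₄ᵑ := by
    rw [T₀, e1, e2, e3]
  refine ⟨P, ?_, ?_, ?_, ?_, ?_⟩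
  · rw [Utilde, e0, ← hu, ← h.eq_pinv.1]
  · rw [Vtilde, e0, ← hv, ← h.eq_pinv.2]
  · rw [Xtilde, e1, ← hermitianPair_complete hη h.eq_X h.eq_X']
  · rw [Ytilde, e2, ← hermitianPair_complete hη h.eq_Y h.eq_Y']
  · rw [Ztilde, e3, ← hermitianPair_complete hη h.eq_Z h.eq_Z']

end Unconstrained

/-! #### Sufficiency and soundness -/

theorem FourEquations.U₃_eq_U₃' (hη : IsPureUnit η) {W : Matrix (Fin n₄) (Fin n₄) ℍ[ℝ]}
    (h : D.FourEquations η W) (P : Parameters p n₁ n₂ n₃ n₄) : D.U₃ η P = D.U₃' η P := by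
  obtain ⟨V₁, V₂, V₃, W₁, W₂, W₃, -, h6⟩ := h.exists_six_term hη
  exact System.U₃_eq_U₃' P hη (two_term_of_six_term hη h6)

/-- W serves only to guarantee consistency. Then `U₃` solves the four equations for every parameter,
which makes the equation for `U₁`, `U₂` solvable, and after it the one for u and v. -/
theorem FourEquations.isUnconstrainedSolution (hη : IsPureUnit η)
    {W : Matrix (Fin n₄) (Fin n₄) ℍ[ℝ]} (h : D.FourEquations η W) (hs : D.Symmetric η)
    (hc : D.Consistent) (P : Parameters p n₁ n₂ n₃ n₄) :
    D.IsUnconstrainedSolution η (D.Utilde η P) (D.Vtilde η P) (D.Xtilde η P) (D.Ytilde η P)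
      (D.Ztilde η P) := by
  obtain ⟨⟨h1, h1'⟩, ⟨h2, h2'⟩, ⟨h3, h3'⟩, h4, h4'⟩ := h.projR_mul
  have hU₃ := fourEquations_U₃ P hη (h.U₃_eq_U₃' hη P) h1 h1' h2 h2' h3 h3' h4 h4'
  obtain ⟨X₀, Y₀, h0⟩ := hU₃.exists_isReduced hη
  have hN : D.M₁ᵑ = D.A₁₃ᵑ * projL D.A₁₂ᵑ := by rw [M₁, etaStar_mul hη, etaStar_projR hη]
  have e1 : D.U₁ η P = twoTermX D.A₁₂ D.A₁₂ᵑ D.A₁₃ D.A₁₃ᵑ (D.T η P) D.M₁ D.M₁ᵑ D.S₁ P.U₄ P.U₅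
      P.U₆ := by
    rw [U₁, twoTermX]
    simp only [etaStar_pinv hη]
  have e2 : D.U₂ η P = twoTermY D.A₁₃ D.A₁₃ᵑ (D.T η P) D.M₁ D.M₁ᵑ D.S₁ P.U₄ P.U₇ P.U₈ := by
    rw [U₂, twoTermY, add_right_comm]
    simp only [etaStar_pinv hη]
  have hred : D.IsReduced η (D.U₁ η P) (D.U₂ η P) (D.U₃ η P) := by
    rw [IsReduced, e1, e2]
    exact twoTerm_sound (M := D.M₁) (S := D.S₁) h0 (by rw [M₁]) hN (by rw [S₁]) _ _ _ _ _
  have hsyl := sylvester_sound ((isReduced_iff hη).1 hred) P.W₁₁ P.W₁₂ P.W₁₃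
  rw [← main_eq_iff hη] at hsyl
  have c1 : D.A₁ * D.A₁† * D.C₁ = D.C₁ := (projR_mul_eq_zero_iff.1 hc.C₁).symm
  have c1' : D.C₁ᵑ * (D.A₁ᵑ† * D.A₁ᵑ) = D.C₁ᵑ := by
    have := congrArg (etaStar η) c1
    rwa [etaStar_mul hη, etaStar_mul hη, etaStar_pinv hη] at this
  have kX := hermitianPair_sound hη hc.C₂ hs.A₂C₂ (D.U₁ η P)
  have kY := hermitianPair_sound hη hc.C₃ hs.A₃C₃ (D.U₂ η P)
  have kZ := hermitianPair_sound hη hc.C₄ hs.A₄C₄ (D.U₃ η P)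
  refine ⟨?_, ?_, kX.1, kX.2, kY.1, kY.2, kZ.1, kZ.2, hsyl⟩
  · rw [Utilde, Matrix.mul_add, ← Matrix.mul_assoc, ← Matrix.mul_assoc, c1, mul_projL,
      Matrix.zero_mul, add_zero]
  · rw [Vtilde, Matrix.add_mul, Matrix.mul_assoc, Matrix.mul_assoc _ _ D.A₁ᵑ, c1',
      EtaSylvester.projR_mul, Matrix.mul_zero, add_zero]

/-! #### Symmetry -/

theorem IsSolution.unconstrained (hη : IsPureUnit η) {U : Matrix (Fin n₁) (Fin p) ℍ[ℝ]}
    {X : Matrix (Fin n₂) (Fin n₂) ℍ[ℝ]} {Y : Matrix (Fin n₃) (Fin n₃) ℍ[ℝ]}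
    {Z : Matrix (Fin n₄) (Fin n₄) ℍ[ℝ]} (h : D.IsSolution η U X Y Z) :
    D.IsUnconstrainedSolution η U Uᵑ X Y Z where
  eq_U := h.eq_U
  eq_V := by rw [← etaStar_mul hη, h.eq_U]
  eq_X := h.eq_X
  eq_X' := by
    conv_lhs => rw [h.hermitian_X]
    rw [← etaStar_mul hη, h.eq_X]
  eq_Y := h.eq_Y
  eq_Y' := by
    conv_lhs => rw [h.hermitian_Y]
    rw [← etaStar_mul hη, h.eq_Y]
  eq_Z := h.eq_Z
  eq_Z' := by
    conv_lhs => rw [h.hermitian_Z]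
    rw [← etaStar_mul hη, h.eq_Z]
  eq_main := by rw [← etaStar_mul hη, h.eq_main]

theorem IsSolution.symmetric (hη : IsPureUnit η) {U : Matrix (Fin n₁) (Fin p) ℍ[ℝ]}
    {X : Matrix (Fin n₂) (Fin n₂) ℍ[ℝ]} {Y : Matrix (Fin n₃) (Fin n₃) ℍ[ℝ]}
    {Z : Matrix (Fin n₄) (Fin n₄) ℍ[ℝ]} (h : D.IsSolution η U X Y Z) : D.Symmetric η where
  Cc := by
    rw [← h.eq_main]
    simp only [etaStar_add, etaStar_mul hη, etaStar_etaStar hη, ← h.hermitian_X, ← h.hermitian_Y,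
      ← h.hermitian_Z, Matrix.mul_assoc]
    abel
  A₂C₂ := by rw [← h.eq_X, etaStar_mul hη, ← h.hermitian_X, Matrix.mul_assoc]
  A₃C₃ := by rw [← h.eq_Y, etaStar_mul hη, ← h.hermitian_Y, Matrix.mul_assoc]
  A₄C₄ := by rw [← h.eq_Z, etaStar_mul hη, ← h.hermitian_Z, Matrix.mul_assoc]

theorem half_smul_add_self {m n : Type*} (A : Matrix m n ℍ[ℝ]) : (1 / 2 : ℝ) • (A + A) = A := by
  rw [← two_smul ℝ A, smul_smul]; norm_num

/-- The η-star maps the unconstrained system to itself, with U and V^{η*} exchanged, and the system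
is linear; so the mean of a solution and its mirror image is a symmetric solution. -/
theorem IsUnconstrainedSolution.symmetrize (hη : IsPureUnit η) {U : Matrix (Fin n₁) (Fin p) ℍ[ℝ]}
    {V : Matrix (Fin p) (Fin n₁) ℍ[ℝ]} {X : Matrix (Fin n₂) (Fin n₂) ℍ[ℝ]}
    {Y : Matrix (Fin n₃) (Fin n₃) ℍ[ℝ]} {Z : Matrix (Fin n₄) (Fin n₄) ℍ[ℝ]}
    (h : D.IsUnconstrainedSolution η U V X Y Z) (hs : D.Cc = D.Ccᵑ) :
    D.IsSolution η ((1 / 2 : ℝ) • (U + Vᵑ)) ((1 / 2 : ℝ) • (X + Xᵑ)) ((1 / 2 : ℝ) • (Y + Yᵑ))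
      ((1 / 2 : ℝ) • (Z + Zᵑ)) := by
  have key : ∀ {m n k : ℕ} {A : Matrix (Fin m) (Fin n) ℍ[ℝ]} {C : Matrix (Fin m) (Fin k) ℍ[ℝ]}
      {X : Matrix (Fin n) (Fin k) ℍ[ℝ]} {X' : Matrix (Fin k) (Fin n) ℍ[ℝ]},
      A * X = C → X' * Aᵑ = Cᵑ → A * ((1 / 2 : ℝ) • (X + X'ᵑ)) = C := by
    intro m n k A C X X' h h'
    have h'' := congrArg (etaStar η) h'
    rw [etaStar_mul hη, etaStar_etaStar hη, etaStar_etaStar hη] at h''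
    rw [Matrix.mul_smul, Matrix.mul_add, h, h'', half_smul_add_self]
  have herm : ∀ {n : ℕ} (X : Matrix (Fin n) (Fin n) ℍ[ℝ]),
      (1 / 2 : ℝ) • (X + Xᵑ) = ((1 / 2 : ℝ) • (X + Xᵑ))ᵑ := by
    intro n X
    rw [etaStar_smul, etaStar_add, etaStar_etaStar hη, add_comm]
  refine ⟨key h.eq_U h.eq_V, key h.eq_X h.eq_X', herm _, key h.eq_Y h.eq_Y', herm _,
    key h.eq_Z h.eq_Z', herm _, ?_⟩
  have h' := congrArg (etaStar η) h.eq_main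
  rw [← hs] at h'
  rw [← half_smul_add_self D.Cc]
  nth_rw 1 [← h.eq_main]
  rw [← h']
  simp only [etaStar_smul, etaStar_add, etaStar_mul hη, etaStar_etaStar hη, Matrix.mul_smul,
    Matrix.smul_mul, Matrix.mul_add, Matrix.add_mul, smul_add, Matrix.mul_assoc]
  abel

theorem T₁_etaStar (hη : IsPureUnit η) (hs : D.Symmetric η) : (D.T₁ η)ᵑ = D.T₁ η := by
  have k2 := hermitianPair_etaStar hη hs.A₂C₂
  have k3 := hermitianPair_etaStar hη hs.A₃C₃
  have k4 := hermitianPair_etaStar hη hs.A₄C₄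
  have key : ∀ {n : ℕ} (E : Matrix (Fin p) (Fin n) ℍ[ℝ]) {τ : Matrix (Fin n) (Fin n) ℍ[ℝ]},
      τᵑ = τ → (E * τ * Eᵑ)ᵑ = E * τ * Eᵑ := by
    intro n E τ h
    rw [etaStar_mul hη, etaStar_mul hη, etaStar_etaStar hη, h, Matrix.mul_assoc]
  have k1 : (D.E₁ * D.A₁† * D.C₁)ᵑ = D.C₁ᵑ * D.A₁ᵑ† * D.E₁ᵑ := by
    rw [etaStar_mul hη, etaStar_mul hη, etaStar_pinv hη, Matrix.mul_assoc]
  rw [T₁, ← k1, etaStar_sub, etaStar_sub, etaStar_sub, etaStar_add, etaStar_add, key _ k2,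
    key _ k3, key _ k4, etaStar_etaStar hη, ← hs.Cc]
  abel

theorem T₂_etaStar (hη : IsPureUnit η) (hs : D.Symmetric η) : (D.T₂ η)ᵑ = D.T₂ η := by
  simp only [T₂, etaStar_mul hη, etaStar_etaStar hη, T₁_etaStar hη hs, Matrix.mul_assoc]

theorem L₁_etaStar (hη : IsPureUnit η) (hs : D.Symmetric η) : (D.L₁ η)ᵑ = D.L₄ η := by
  rw [L₁, L₄, etaStar_mul hη, T₂_etaStar hη hs]

theorem L₄_etaStar (hη : IsPureUnit η) (hs : D.Symmetric η) : (D.L₄ η)ᵑ = D.L₁ η := by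
  rw [← L₁_etaStar hη hs, etaStar_etaStar hη]

theorem L₂_etaStar (hη : IsPureUnit η) (hs : D.Symmetric η) : (D.L₂ η)ᵑ = D.L₃ η := by
  simp only [L₂, L₃, etaStar_mul hη, T₂_etaStar hη hs, etaStar_etaStar hη, Matrix.mul_assoc]

theorem L₃_etaStar (hη : IsPureUnit η) (hs : D.Symmetric η) : (D.L₃ η)ᵑ = D.L₂ η := by
  rw [← L₂_etaStar hη hs, etaStar_etaStar hη]

/-- Since η-star exchanges `L₁` with `L₄` and `L₂` with `L₃`, the four left conditions R_{G_i}L_i =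
0 yield the four right conditions that `pair_sound` also needs. -/
theorem mul_projL_eq_zero_of_etaStar (hη : IsPureUnit η) {a b c : Type*} [Fintype a] [Fintype b]
    [DecidableEq b] {G : Matrix b a ℍ[ℝ]} {L : Matrix b c ℍ[ℝ]} {L' : Matrix c b ℍ[ℝ]}
    (hL : Lᵑ = L') (h : projR G * L = 0) : L' * projL Gᵑ = 0 := by
  have := congrArg (etaStar η) h
  rwa [etaStar_mul hη, etaStar_zero, etaStar_projR hη, hL] at this

/-! #### Solvability -/

/-- `F₁` and `F₂` each solve two of the four equations for the last unknown. -/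
theorem mul_F₁_mul_and_mul_F₂_mul (hη : IsPureUnit η) (hs : D.Symmetric η)
    (h1 : projR D.G₁ * D.L₁ η = 0) (h2 : projR D.G₂ * D.L₂ η = 0)
    (h3 : projR D.G₃ * D.L₃ η = 0) (h4 : projR D.G₄ * D.L₄ η = 0) :
    (D.G₁ * D.F₁ η * D.G₄ᵑ = D.L₁ η ∧ D.G₂ * D.F₁ η * D.G₃ᵑ = D.L₂ η) ∧
      D.G₃ * D.F₂ η * D.G₂ᵑ = D.L₃ η ∧ D.G₄ * D.F₂ η * D.G₁ᵑ = D.L₄ η := by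
  have h1' := mul_projL_eq_zero_of_etaStar hη (L₄_etaStar hη hs) h4
  have h2' := mul_projL_eq_zero_of_etaStar hη (L₃_etaStar hη hs) h3
  have h3' := mul_projL_eq_zero_of_etaStar hη (L₂_etaStar hη hs) h2
  have h4' := mul_projL_eq_zero_of_etaStar hη (L₁_etaStar hη hs) h1
  have k1 := pair_sound G₁_eq (star_G₃_eq hη) h1 h1' h2 h2' L₁_mul_eq 0 0 0
  have k2 := pair_sound G₃_eq (star_G₁_eq hη) h3 h3' h4 h4' (L₃_mul_eq hη) 0 0 0
  simp only [Matrix.mul_zero, Matrix.zero_mul, add_zero] at k1 k2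
  exact ⟨k1, k2⟩

/-- G₁ is a left multiple of G₃ as well as of G₂, and G₂ is one of G₄. The equations for F₁ and for
F₂ therefore both evaluate G₁·G₂^{η*}, to the same value L₁(R_{A₁₂})^{η*}; the mirrored product is
similar. -/
theorem ProjectorConditions.G₁_mul_F_mul (hη : IsPureUnit η) (hs : D.Symmetric η)
    (hp : D.ProjectorConditions η) :
    D.G₁ * D.F η * D.G₂ᵑ = 0 ∧ D.G₂ * D.F η * D.G₁ᵑ = 0 := by
  obtain ⟨k1, k2⟩ := mul_F₁_mul_and_mul_F₂_mul hη hs hp.L₁ hp.L₂ hp.L₃ hp.L₄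
  have e1 : D.G₁ = D.G * D.G₃ := by
    nth_rw 1 [G₁, ← G_mul_projR_A₁₃, Matrix.mul_assoc, ← G₃]
  have e2 : D.G₁ᵑ = D.G₃ᵑ * D.Gᵑ := by rw [e1, etaStar_mul hη]
  have e3 : D.G₂ = projR D.A₁₂ * D.G₄ := rfl
  have e4 : D.G₂ᵑ = D.G₄ᵑ * (projR D.A₁₂)ᵑ := by rw [e3, etaStar_mul hη]
  have e5 : (projR D.A₁₃)ᵑ * D.Gᵑ = D.Gᵑ := by rw [← etaStar_mul hη, G_mul_projR_A₁₃]
  constructor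
  · have l1 : D.G₁ * D.F₂ η * D.G₂ᵑ = D.L₁ η * (projR D.A₁₂)ᵑ := by
      rw [e1, Matrix.mul_assoc, Matrix.mul_assoc, ← Matrix.mul_assoc D.G₃, k2.1, System.L₃,
          System.L₁,
        ← Matrix.mul_assoc, ← Matrix.mul_assoc, G_mul_projR_A₁₃]
    have l2 : D.G₁ * D.F₁ η * D.G₂ᵑ = D.L₁ η * (projR D.A₁₂)ᵑ := by
      rw [e4, ← Matrix.mul_assoc, k1.1]
    rw [F, Matrix.mul_sub, Matrix.sub_mul, l1, l2, sub_self]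
  · have l1 : D.G₂ * D.F₂ η * D.G₁ᵑ = projR D.A₁₂ * D.L₄ η := by
      rw [e3, Matrix.mul_assoc, Matrix.mul_assoc, ← Matrix.mul_assoc D.G₄, k2.2]
    have l2 : D.G₂ * D.F₁ η * D.G₁ᵑ = projR D.A₁₂ * D.L₄ η := by
      rw [e2, ← Matrix.mul_assoc, k1.2, System.L₂, Matrix.mul_assoc, e5, System.L₄,
          Matrix.mul_assoc]
    rw [F, Matrix.mul_sub, Matrix.sub_mul, l1, l2, sub_self]

/-- A matrix annihilated by `G₁` after projection lies in the column space of `E₁₁`. -/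
theorem projR_E₁₁_mul_projR_C₁₁_mul {a : Type*} {F : Matrix (Fin n₄) a ℍ[ℝ]}
    (h : D.G₁ * F = 0) : projR D.E₁₁ * (projR D.C₁₁ * F) = 0 := by
  refine projR_mul_eq_zero_iff_exists.2 ⟨F, ?_⟩
  rw [E₁₁, C₂₂, Matrix.mul_assoc, projL_mul_of_mul_eq_zero h]

theorem ProjectorConditions.consistent (hp : D.ProjectorConditions η) : D.Consistent :=
  ⟨hp.C₁, hp.C₂, hp.C₃, hp.C₄⟩

theorem ProjectorConditions.exists_two_term (hη : IsPureUnit η) (hs : D.Symmetric η)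
    (hp : D.ProjectorConditions η) :
    ∃ X Y : Matrix (Fin n₄) (Fin n₄) ℍ[ℝ],
      D.E₁₁ * X * D.E₂₂ᵑ + D.E₂₂ * Y * D.E₁₁ᵑ = D.E η := by
  obtain ⟨hF, hF'⟩ := hp.G₁_mul_F_mul hη hs
  have hE : projR D.E₁₁ * D.E η = 0 := by
    rw [System.E, Matrix.mul_assoc (projR D.C₁₁)]
    apply projR_E₁₁_mul_projR_C₁₁_mul
    rw [star_projR_C₁₁ hη, ← Matrix.mul_assoc, ← Matrix.mul_assoc, hF, Matrix.zero_mul]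
  have hE' : D.E η * (projR D.E₁₁)ᵑ = 0 := by
    rw [← etaStar_eq_zero_iff hη, etaStar_mul hη, etaStar_etaStar hη, System.E, etaStar_mul hη,
      etaStar_mul hη, etaStar_etaStar hη]
    apply projR_E₁₁_mul_projR_C₁₁_mul
    rw [star_projR_C₁₁ hη, ← Matrix.mul_assoc, ← Matrix.mul_assoc, Matrix.mul_assoc D.G₁,
      ← etaStar_mul hη, ← etaStar_etaStar hη D.G₁, ← etaStar_mul hη, hF', etaStar_zero,
      Matrix.zero_mul]
  refine twoTerm_exists (M := D.M) (N := D.N η) (by rw [M]) (N_eq hη) ?_ ?_ ?_ ?_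
  · rw [hE, Matrix.mul_zero]
  · rw [hE, Matrix.zero_mul]
  · rw [← etaStar_projR hη, ← Matrix.mul_assoc, hp.E]
  -- This product annihilates E₁₁ from the left, so it factors through R_{E₁₁}, whose η-star already
  -- kills E from the right.
  · have hz : ∃ Q, projR (projR D.E₂₂ * D.E₁₁) * projR D.E₂₂ = Q * projR D.E₁₁ := by
      refine ⟨projR (projR D.E₂₂ * D.E₁₁) * projR D.E₂₂, (mul_projR_of_mul_eq_zero ?_).symm⟩
      rw [Matrix.mul_assoc, EtaSylvester.projR_mul]
    obtain ⟨Q, hQ⟩ := hz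
    rw [← etaStar_projR hη, N, ← etaStar_projR hη, Matrix.mul_assoc, ← etaStar_mul hη, hQ,
      etaStar_mul hη, ← Matrix.mul_assoc, hE', Matrix.zero_mul]

theorem ProjectorConditions.exists_isSolution (hη : IsPureUnit η) (hs : D.Symmetric η)
    (hp : D.ProjectorConditions η) : ∃ U X Y Z, D.IsSolution η U X Y Z := by
  have h1' := mul_projL_eq_zero_of_etaStar hη (L₄_etaStar hη hs) hp.L₄
  have h2' := mul_projL_eq_zero_of_etaStar hη (L₃_etaStar hη hs) hp.L₃
  have h3' := mul_projL_eq_zero_of_etaStar hη (L₂_etaStar hη hs) hp.L₂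
  have h4' := mul_projL_eq_zero_of_etaStar hη (L₁_etaStar hη hs) hp.L₁
  obtain ⟨X, Y, h⟩ := hp.exists_two_term hη hs
  let P : Parameters p n₁ n₂ n₃ n₄ := ⟨0, 0, 0, 0, 0, 0, 0, 0, 0, 0, 0, 0, 0, 0, 0, 0⟩
  have hW := fourEquations_U₃ P hη (System.U₃_eq_U₃' P hη h) hp.L₁ h1' hp.L₂ h2' hp.L₃ h3' hp.L₄ h4'
  exact ⟨_, _, _, _, (hW.isUnconstrainedSolution hη hs hp.consistent P).symmetrize hη hs.Cc⟩

theorem IsUnconstrainedSolution.projectorConditions (hη : IsPureUnit η)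
    {U : Matrix (Fin n₁) (Fin p) ℍ[ℝ]} {V : Matrix (Fin p) (Fin n₁) ℍ[ℝ]}
    {X : Matrix (Fin n₂) (Fin n₂) ℍ[ℝ]} {Y : Matrix (Fin n₃) (Fin n₃) ℍ[ℝ]}
    {Z : Matrix (Fin n₄) (Fin n₄) ℍ[ℝ]} (h : D.IsUnconstrainedSolution η U V X Y Z) :
    D.ProjectorConditions η := by
  have hW := (h.isReduced hη).fourEquations hη
  obtain ⟨⟨h1, -⟩, ⟨h2, -⟩, ⟨h3, -⟩, h4, -⟩ := hW.projR_mul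
  obtain ⟨c1, c2, c3, c4⟩ := h.consistent
  obtain ⟨V₁, V₂, V₃, W₁, W₂, W₃, -, h6⟩ := hW.exists_six_term hη
  refine ⟨?_, c1, c2, c3, c4, h1, h2, h3, h4⟩
  have e : D.E₂₂ᵑ * (projR D.E₂₂)ᵑ = 0 := by
    rw [← etaStar_mul hη, EtaSylvester.projR_mul, etaStar_zero]
  rw [← two_term_of_six_term hη h6, Matrix.mul_add, Matrix.add_mul, Matrix.mul_assoc D.E₂₂,
    ← Matrix.mul_assoc _ D.E₂₂, EtaSylvester.projR_mul, Matrix.zero_mul, Matrix.zero_mul, add_zero,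
    Matrix.mul_assoc, Matrix.mul_assoc _ D.E₂₂ᵑ, e, Matrix.mul_zero, Matrix.mul_zero]

theorem exists_isSolution_iff (hη : IsPureUnit η) : (∃ U X Y Z, D.IsSolution η U X Y Z) ↔
    D.Symmetric η ∧ D.ProjectorConditions η :=
  ⟨fun ⟨_, _, _, _, h⟩ => ⟨h.symmetric hη, (h.unconstrained hη).projectorConditions hη⟩,
    fun h => h.2.exists_isSolution hη h.1⟩

theorem general_solution (hη : IsPureUnit η) (h : ∃ U X Y Z, D.IsSolution η U X Y Z) :
    (∀ P : Parameters p n₁ n₂ n₃ n₄, D.IsUnconstrainedSolution η (D.Utilde η P) (D.Vtilde η P)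
        (D.Xtilde η P) (D.Ytilde η P) (D.Ztilde η P)) ∧
      (∀ U X Y Z, D.IsSolution η U X Y Z ↔ ∃ P : Parameters p n₁ n₂ n₃ n₄,
          U = (1 / 2 : ℝ) • (D.Utilde η P + (D.Vtilde η P)ᵑ) ∧
          X = (1 / 2 : ℝ) • (D.Xtilde η P + (D.Xtilde η P)ᵑ) ∧
          Y = (1 / 2 : ℝ) • (D.Ytilde η P + (D.Ytilde η P)ᵑ) ∧
          Z = (1 / 2 : ℝ) • (D.Ztilde η P + (D.Ztilde η P)ᵑ)) ∧
      ∀ P : Parameters p n₁ n₂ n₃ n₄, D.U₃ η P = D.U₃' η P := by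
  obtain ⟨U₀, X₀, Y₀, Z₀, h₀⟩ := h
  have hs := h₀.symmetric hη
  have hc := (h₀.unconstrained hη).consistent
  have hW := ((h₀.unconstrained hη).isReduced hη).fourEquations hη
  have hsound := hW.isUnconstrainedSolution hη hs hc
  refine ⟨hsound, fun U X Y Z => ⟨fun h => ?_, ?_⟩, hW.U₃_eq_U₃' hη⟩
  · obtain ⟨P, hU, hV, hX, hY, hZ⟩ := (h.unconstrained hη).exists_parameters hη
    refine ⟨P, ?_, ?_, ?_, ?_⟩
    · rw [← hU, ← hV, etaStar_etaStar hη, half_smul_add_self]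
    · rw [← hX, ← h.hermitian_X, half_smul_add_self]
    · rw [← hY, ← h.hermitian_Y, half_smul_add_self]
    · rw [← hZ, ← h.hermitian_Z, half_smul_add_self]
  · rintro ⟨P, rfl, rfl, rfl, rfl⟩
    exact (hsound P).symmetrize hη hs.Cc

end System

/-! ### Rank additivity for block matrices -/

section Rank

variable {a b c d m n k : Type*} [Fintype a] [Fintype b] [Fintype c] [Fintype d] [Fintype m]
  [Fintype n] [Fintype k]

theorem rank_eq_finrank_range (A : Matrix m n ℍ[ℝ]) :
    rank A = Module.finrank ℍ[ℝ] (LinearMap.range A.vecMulLinear) := by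
  rw [rank, range_vecMulLinear]

theorem vecMulLinear_mul (A : Matrix m n ℍ[ℝ]) (B : Matrix n k ℍ[ℝ]) :
    (A * B).vecMulLinear = B.vecMulLinear ∘ₗ A.vecMulLinear := by
  ext1 i
  ext1
  simp [Matrix.vecMul_vecMul]

theorem rank_mul_le_left (A : Matrix m n ℍ[ℝ]) (B : Matrix n k ℍ[ℝ]) : rank (A * B) ≤ rank A := by
  rw [rank_eq_finrank_range, rank_eq_finrank_range, vecMulLinear_mul, LinearMap.range_comp]
  exact Submodule.finrank_map_le _ _

theorem rank_mul_le_right (A : Matrix m n ℍ[ℝ]) (B : Matrix n k ℍ[ℝ]) : rank (A * B) ≤ rank B := by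
  rw [rank_eq_finrank_range, rank_eq_finrank_range, vecMulLinear_mul]
  exact Submodule.finrank_mono (LinearMap.range_comp_le_range _ _)

/-- Aᴴ = Aᴴ(AA†) factors through AA†, whose rank is at most that of A. This supplies row rank versus
column rank without commutativity. -/
theorem rank_conjTranspose_le (A : Matrix m n ℍ[ℝ]) : rank Aᴴ ≤ rank A := by
  calc rank Aᴴ = rank (Aᴴ * (A * A†)) := by
        conv_lhs => rw [← mul_pinv_mul A, Matrix.conjTranspose_mul, conjTranspose_mul_pinv]
    _ ≤ rank (A * A†) := rank_mul_le_right _ _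
    _ ≤ rank A := rank_mul_le_left _ _

/-- A^{η*} is Aᴴ multiplied on both sides by scalar diagonal matrices. -/
theorem rank_etaStar_le [DecidableEq m] [DecidableEq n] (η : ℍ[ℝ]) (A : Matrix m n ℍ[ℝ]) :
    rank (etaStar η A) ≤ rank A := by
  have h : etaStar η A
      = (Matrix.diagonal fun _ : n => -η) * (Aᴴ * Matrix.diagonal fun _ : m => η : Matrix n m ℍ[ℝ])
          := by
    ext1 i j
    rw [Matrix.diagonal_mul, Matrix.mul_diagonal, etaStar_apply, Matrix.conjTranspose_apply,
      neg_mul, mul_assoc]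
  rw [h]
  exact (rank_mul_le_right _ _).trans ((rank_mul_le_left _ _).trans (rank_conjTranspose_le A))

theorem rank_etaStar [DecidableEq m] [DecidableEq n] {η : ℍ[ℝ]} (hη : IsPureUnit η)
    (A : Matrix m n ℍ[ℝ]) : rank (etaStar η A) = rank A :=
  le_antisymm (rank_etaStar_le η A) (by
    conv_lhs => rw [← etaStar_etaStar hη A]
    exact rank_etaStar_le η _)

theorem rank_submatrix_le (A : Matrix m n ℍ[ℝ]) (e : a → m) (f : b → n) :
    rank (A.submatrix e f) ≤ rank A := by
  classical
  have h : A.submatrix e f = (1 : Matrix m m ℍ[ℝ]).submatrix e id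
      * (A * (1 : Matrix n n ℍ[ℝ]).submatrix id f) := by
    ext1 i j
    simp [Matrix.mul_apply, Matrix.one_apply]
  rw [h]
  exact (rank_mul_le_right _ _).trans (rank_mul_le_left _ _)

theorem rank_submatrix (A : Matrix m n ℍ[ℝ]) (e : a ≃ m) (f : b ≃ n) :
    rank (A.submatrix e f) = rank A := by
  refine le_antisymm (rank_submatrix_le A e f) ?_
  have := rank_submatrix_le (A.submatrix e f) e.symm f.symm
  rwa [Matrix.submatrix_submatrix, e.self_comp_symm, f.self_comp_symm, Matrix.submatrix_id_id]
    at this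

theorem rank_diagonal_mul_mul_diagonal [DecidableEq m] [DecidableEq n] (A : Matrix m n ℍ[ℝ])
    {s : m → ℍ[ℝ]} {t : n → ℍ[ℝ]} (hs : ∀ i, s i * s i = 1) (ht : ∀ j, t j * t j = 1) :
    rank (Matrix.diagonal s * A * Matrix.diagonal t) = rank A := by
  have key : ∀ A : Matrix m n ℍ[ℝ], rank (Matrix.diagonal s * A * Matrix.diagonal t) ≤ rank A :=
    fun A => (rank_mul_le_left _ _).trans (rank_mul_le_right _ _)
  refine le_antisymm (key A) ?_
  have h : A = Matrix.diagonal s * (Matrix.diagonal s * A * Matrix.diagonal t)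
      * Matrix.diagonal t := by
    ext1 i j
    rw [Matrix.mul_diagonal, Matrix.diagonal_mul, Matrix.mul_diagonal, Matrix.diagonal_mul,
      ← mul_assoc, ← mul_assoc, hs, one_mul, mul_assoc, ht, mul_one]
  conv_lhs => rw [h]
  exact key _

theorem rank_add_finrank_ker (A : Matrix m n ℍ[ℝ]) :
    rank A + Module.finrank ℍ[ℝ] (LinearMap.ker A.vecMulLinear) = Fintype.card m := by
  rw [rank_eq_finrank_range, LinearMap.finrank_range_add_finrank_ker,
      Module.finrank_fintype_fun_eq_card]

/-- Project the left kernel of the block matrix to its first component. The fibre over 0 is the left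
kernel of B and the image lies in the left kernel of A. Counting dimensions, rank additivity says
that the image is everything. -/
theorem rank_fromBlocks_eq_add_iff_exists (A : Matrix a d ℍ[ℝ]) (B : Matrix b c ℍ[ℝ])
    (C : Matrix a c ℍ[ℝ]) :
    rank (Matrix.fromBlocks C A B 0) = rank A + rank B ↔
      ∀ y : a → ℍ[ℝ], Matrix.vecMul y A = 0 → ∃ z, Matrix.vecMul y C + Matrix.vecMul z B = 0 := by
  set L := (Matrix.fromBlocks C A B 0).vecMulLinear with hL
  have hmem : ∀ w : a ⊕ b → ℍ[ℝ], w ∈ LinearMap.ker L ↔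
      Matrix.vecMul (w ∘ Sum.inl) C + Matrix.vecMul (w ∘ Sum.inr) B = 0 ∧
        Matrix.vecMul (w ∘ Sum.inl) A = 0 := by
    intro w
    rw [LinearMap.mem_ker, hL, Matrix.vecMulLinear_apply, Matrix.vecMul_fromBlocks,
      Matrix.vecMul_zero, add_zero, ← Sum.elim_zero_zero, Sum.elim_eq_iff]
  let π : LinearMap.ker L →ₗ[ℍ[ℝ]] (a → ℍ[ℝ]) :=
    (LinearMap.funLeft ℍ[ℝ] ℍ[ℝ] Sum.inl) ∘ₗ (LinearMap.ker L).subtype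
  have hπ : ∀ w, π w = w.1 ∘ Sum.inl := fun w => rfl
  have hrange : LinearMap.range π ≤ LinearMap.ker A.vecMulLinear := by
    rintro _ ⟨w, rfl⟩
    rw [LinearMap.mem_ker, Matrix.vecMulLinear_apply, hπ]
    exact ((hmem w.1).1 w.2).2
  have hker : Module.finrank ℍ[ℝ] (LinearMap.ker π)
      = Module.finrank ℍ[ℝ] (LinearMap.ker B.vecMulLinear) := by
    let g : LinearMap.ker π →ₗ[ℍ[ℝ]] (b → ℍ[ℝ]) :=
      (LinearMap.funLeft ℍ[ℝ] ℍ[ℝ] Sum.inr) ∘ₗ (LinearMap.ker L).subtype ∘ₗ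
        (LinearMap.ker π).subtype
    have hg : ∀ w, g w = w.1.1 ∘ Sum.inr := fun w => rfl
    have hz : ∀ w : LinearMap.ker π, w.1.1 ∘ Sum.inl = 0 := fun w => LinearMap.mem_ker.1 w.2
    have hinj : Function.Injective g := by
      intro w w' hw
      apply Subtype.ext
      apply Subtype.ext
      funext i
      rcases i with i | i
      · exact (congrFun (hz w) i).trans (congrFun (hz w') i).symm
      · exact congrFun hw i
    have hrg : LinearMap.range g = LinearMap.ker B.vecMulLinear := by
      apply le_antisymm
      · rintro _ ⟨w, rfl⟩
        have := ((hmem w.1.1).1 w.1.2).1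
        rw [hz, Matrix.zero_vecMul, zero_add] at this
        exact this
      · intro z hzB
        have h1 : Sum.elim (0 : a → ℍ[ℝ]) z ∈ LinearMap.ker L := by
          rw [hmem]
          refine ⟨?_, ?_⟩
          · rw [Sum.elim_comp_inl, Sum.elim_comp_inr, Matrix.zero_vecMul, zero_add]
            exact hzB
          · rw [Sum.elim_comp_inl, Matrix.zero_vecMul]
        refine ⟨⟨⟨Sum.elim (0 : a → ℍ[ℝ]) z, h1⟩, ?_⟩, ?_⟩
        · rw [LinearMap.mem_ker, hπ]; exact Sum.elim_comp_inl _ _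
        · rw [hg]; exact Sum.elim_comp_inr _ _
    rw [← hrg, LinearMap.finrank_range_of_inj hinj]
  have hdim := LinearMap.finrank_range_add_finrank_ker π
  have hA := rank_add_finrank_ker A
  have hB := rank_add_finrank_ker B
  have hBig := rank_add_finrank_ker (Matrix.fromBlocks C A B 0)
  rw [← hL, Fintype.card_sum] at hBig
  have h1 : rank (Matrix.fromBlocks C A B 0) = rank A + rank B ↔
      Module.finrank ℍ[ℝ] (LinearMap.range π)
        = Module.finrank ℍ[ℝ] (LinearMap.ker A.vecMulLinear) := by
    omega
  rw [h1]
  constructor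
  · intro h y hy
    have := Submodule.eq_of_le_of_finrank_eq hrange h
    have hy' : y ∈ LinearMap.range π := by rw [this]; exact hy
    obtain ⟨w, rfl⟩ := hy'
    exact ⟨w.1 ∘ Sum.inr, ((hmem w.1).1 w.2).1⟩
  · intro h
    refine congrArg (fun W : Submodule ℍ[ℝ] (a → ℍ[ℝ]) => Module.finrank ℍ[ℝ] W)
      (le_antisymm hrange fun y hy => ?_)
    obtain ⟨z, hz⟩ := h y hy
    refine ⟨⟨Sum.elim y z, (hmem _).2 ⟨?_, ?_⟩⟩, ?_⟩
    · rwa [Sum.elim_comp_inl, Sum.elim_comp_inr]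
    · rwa [Sum.elim_comp_inl]
    · rw [hπ]; exact Sum.elim_comp_inl _ _

theorem eq_zero_of_forall_mul_mul {X : Matrix m n ℍ[ℝ]}
    (h : ∀ (y : Matrix Unit m ℍ[ℝ]) (x : Matrix n Unit ℍ[ℝ]), y * X * x = 0) : X = 0 := by
  classical
  ext1 i j
  have h1 := congrFun (congrFun (h (Matrix.replicateRow Unit (Pi.single i 1))
    (Matrix.replicateCol Unit (Pi.single j 1))) ()) ()
  simpa [Matrix.mul_apply, Pi.single_apply] using h1

/-- yC lies in the row space of B exactly when it vanishes on the right kernel of B, which is the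
column space of L_B. -/
theorem rank_fromBlocks_eq_add_iff (A : Matrix a d ℍ[ℝ]) (B : Matrix b c ℍ[ℝ])
    (C : Matrix a c ℍ[ℝ]) :
    rank (Matrix.fromBlocks C A B 0) = rank A + rank B ↔
      ∀ (y : Matrix Unit a ℍ[ℝ]) (x : Matrix c Unit ℍ[ℝ]), y * A = 0 → B * x = 0 →
        y * C * x = 0 := by
  classical
  rw [rank_fromBlocks_eq_add_iff_exists]
  constructor
  · intro h y x hy hx
    obtain ⟨z, hz⟩ := h (y ()) (congrFun hy ())
    have h1 : y * C + Matrix.replicateRow Unit z * B = 0 := by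
      ext1 i j
      exact congrFun hz j
    rw [eq_neg_of_add_eq_zero_left h1, Matrix.neg_mul, Matrix.mul_assoc, hx, Matrix.mul_zero,
      neg_zero]
  · intro h y hy
    have h1 : Matrix.replicateRow Unit y * C * projL B = 0 := by
      apply eq_zero_of_forall_mul_mul
      intro s x
      have h2 : Matrix.replicateRow Unit y * A = 0 := by
        ext1 i j
        exact congrFun hy j
      rw [Matrix.mul_assoc, Matrix.mul_assoc, h _ (projL B * x) h2, Matrix.mul_zero]
      rw [← Matrix.mul_assoc, mul_projL, Matrix.zero_mul]
    obtain ⟨z, hz⟩ := mul_projL_eq_zero_iff_exists.1 h1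
    refine ⟨-z (), ?_⟩
    rw [Matrix.neg_vecMul, ← sub_eq_add_neg, sub_eq_zero]
    exact congrFun hz ()

theorem rank_fromCols_eq_iff [DecidableEq a] (C : Matrix a c ℍ[ℝ]) (A : Matrix a d ℍ[ℝ]) :
    rank (Matrix.fromCols C A) = rank A ↔ projR A * C = 0 := by
  -- With no rows in B, every x lies in its kernel.
  have h1 := rank_fromBlocks_eq_add_iff A (0 : Matrix Empty c ℍ[ℝ]) C
  have h2 : rank (0 : Matrix Empty c ℍ[ℝ]) = 0 := by
    have := rank_add_finrank_ker (0 : Matrix Empty c ℍ[ℝ])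
    rw [Fintype.card_empty] at this
    omega
  have h3 : (Matrix.fromCols C A).submatrix (Equiv.sumEmpty a Empty) (Equiv.refl _)
      = Matrix.fromBlocks C A (0 : Matrix Empty c ℍ[ℝ]) 0 := by
    ext1 i j
    rcases i with i | i
    · rcases j with j | j <;> rfl
    · exact i.elim
  rw [h2, add_zero, ← h3, rank_submatrix] at h1
  rw [h1]
  classical
  constructor
  · intro h
    apply eq_zero_of_forall_mul_mul
    intro y x
    rw [← Matrix.mul_assoc]
    refine h _ _ ?_ (by ext1 i; exact i.elim)
    rw [Matrix.mul_assoc, projR_mul, Matrix.mul_zero]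
  · intro h y x hy _
    rw [← mul_projR_of_mul_eq_zero hy, Matrix.mul_assoc y, h, Matrix.mul_zero, Matrix.zero_mul]

variable {q q' ky kx ny nx I J : Type*} [Fintype q] [Fintype q'] [Fintype ky] [Fintype kx]
  [Fintype ny] [Fintype nx] [Fintype I] [Fintype J] [DecidableEq q] [DecidableEq q']
  [DecidableEq ny] [DecidableEq nx] [DecidableEq kx] [DecidableEq ky]

/-- If yE_y + y₁A_y = 0, then y₁C_y = y₁A_yΦ = −yE_yΦ, so the constraint rows amount to subtracting
E_yΦ from K; the other border works in the same way. A suitable y₁ exists exactly when yE_y L_{A_y}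
= 0. -/
theorem rank_bordered_eq_add_iff {η : ℍ[ℝ]} (hη : IsPureUnit η) {X : Matrix I J ℍ[ℝ]}
    (e : (q ⊕ ky) ⊕ nx ≃ I) (f : (q' ⊕ kx) ⊕ ny ≃ J) {K : Matrix q q' ℍ[ℝ]}
    {Ey : Matrix q ny ℍ[ℝ]} {Ay : Matrix ky ny ℍ[ℝ]} {Cy : Matrix ky q' ℍ[ℝ]}
    {Ex : Matrix q' nx ℍ[ℝ]} {Ax : Matrix kx nx ℍ[ℝ]} {Cx : Matrix kx q ℍ[ℝ]}
    (Φ : Matrix ny q' ℍ[ℝ]) (Ψ : Matrix nx q ℍ[ℝ]) (hΦ : Ay * Φ = Cy) (hΨ : Ax * Ψ = Cx)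
    (hX : X.submatrix e f = Matrix.fromBlocks (Matrix.fromBlocks K (etaStar η Cx) Cy 0)
      (Matrix.fromRows Ey Ay) (Matrix.fromCols (etaStar η Ex) (etaStar η Ax)) 0) :
    rank X = rank (Matrix.fromRows Ey Ay) + rank (Matrix.fromRows Ex Ax) ↔
      ∀ (y : Matrix Unit q ℍ[ℝ]) (w : Matrix Unit q' ℍ[ℝ]), y * (Ey * projL Ay) = 0 →
        w * (Ex * projL Ax) = 0 →
        y * (K - Ey * Φ - etaStar η (Ex * Ψ)) * etaStar η w = 0 := by
  rw [← rank_submatrix X e f, hX, ← rank_etaStar hη (Matrix.fromRows Ex Ax), etaStar_fromRows,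
    rank_fromBlocks_eq_add_iff]
  have value : ∀ (y₀ : Matrix Unit q ℍ[ℝ]) (y₁ : Matrix Unit ky ℍ[ℝ]) (w₀ : Matrix Unit q' ℍ[ℝ])
      (w₁ : Matrix Unit kx ℍ[ℝ]), y₀ * Ey + y₁ * Ay = 0 → w₀ * Ex + w₁ * Ax = 0 →
      Matrix.fromCols y₀ y₁ * Matrix.fromBlocks K (etaStar η Cx) Cy 0
        * etaStar η (Matrix.fromCols w₀ w₁)
        = y₀ * (K - Ey * Φ - etaStar η (Ex * Ψ)) * etaStar η w₀ := by
    intro y₀ y₁ w₀ w₁ hy hw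
    have h1 : y₁ * Cy = -(y₀ * (Ey * Φ)) := by
      rw [← hΦ, ← Matrix.mul_assoc, eq_neg_of_add_eq_zero_right hy, Matrix.neg_mul,
        Matrix.mul_assoc]
    have h2 : w₁ * Cx = -(w₀ * (Ex * Ψ)) := by
      rw [← hΨ, ← Matrix.mul_assoc, eq_neg_of_add_eq_zero_right hw, Matrix.neg_mul,
        Matrix.mul_assoc]
    have h3 := congrArg (etaStar η) h2
    rw [etaStar_mul hη, etaStar_neg, etaStar_mul hη] at h3
    rw [← Matrix.fromRows_fromCols_eq_fromBlocks, Matrix.fromCols_mul_fromRows, etaStar_fromCols,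
      Matrix.mul_fromCols, Matrix.mul_fromCols, Matrix.add_mul, Matrix.fromCols_mul_fromRows,
      Matrix.fromCols_mul_fromRows, Matrix.mul_zero, Matrix.zero_mul, h1, Matrix.mul_assoc y₀
          (etaStar η Cx),
      h3]
    simp only [Matrix.mul_sub, Matrix.sub_mul, Matrix.neg_mul, Matrix.mul_neg, Matrix.mul_assoc]
    abel
  constructor
  · intro h y w hy hw
    rw [← Matrix.mul_assoc, mul_projL_eq_zero_iff_exists] at hy hw
    obtain ⟨y₁, hy⟩ := hy
    obtain ⟨w₁, hw⟩ := hw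
    have hy' : y * Ey + -y₁ * Ay = 0 := by rw [hy, Matrix.neg_mul, add_neg_cancel]
    have hw' : w * Ex + -w₁ * Ax = 0 := by rw [hw, Matrix.neg_mul, add_neg_cancel]
    rw [← value y (-y₁) w (-w₁) hy' hw']
    apply h
    · rw [Matrix.fromCols_mul_fromRows, hy']
    · rw [etaStar_fromCols, Matrix.fromCols_mul_fromRows, ← etaStar_mul hη, ← etaStar_mul hη,
        ← etaStar_add, hw', etaStar_zero]
  · intro h y x hy hx
    obtain ⟨w, rfl⟩ : ∃ w, x = etaStar η w := ⟨etaStar η x, (etaStar_etaStar hη x).symm⟩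
    rw [← Matrix.fromCols_toCols y, Matrix.fromCols_mul_fromRows] at hy
    rw [← Matrix.fromCols_toCols w, etaStar_fromCols, Matrix.fromCols_mul_fromRows,
      ← etaStar_mul hη, ← etaStar_mul hη, ← etaStar_add, etaStar_eq_zero_iff hη] at hx
    rw [← Matrix.fromCols_toCols y, ← Matrix.fromCols_toCols w, value _ _ _ _ hy hx]
    apply h
    · rw [← Matrix.mul_assoc, mul_projL_eq_zero_iff_exists]
      exact ⟨-y.toCols₂, by rw [Matrix.neg_mul]; exact eq_neg_of_add_eq_zero_left hy⟩
    · rw [← Matrix.mul_assoc, mul_projL_eq_zero_iff_exists]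
      exact ⟨-w.toCols₂, by rw [Matrix.neg_mul]; exact eq_neg_of_add_eq_zero_left hx⟩

theorem mul_fromCols_mul_projL_fromBlocks {A : Matrix a c ℍ[ℝ]} {B : Matrix b d ℍ[ℝ]}
    {E : Matrix m c ℍ[ℝ]} {E' : Matrix m d ℍ[ℝ]} {y : Matrix k m ℍ[ℝ]} [DecidableEq c]
    [DecidableEq d] :
    y * (Matrix.fromCols E E' * projL (Matrix.fromBlocks A 0 0 B)) = 0 ↔
      y * (E * projL A) = 0 ∧ y * (E' * projL B) = 0 := by
  classical
  rw [← Matrix.mul_assoc, ← Matrix.mul_assoc, ← Matrix.mul_assoc, mul_projL_eq_zero_iff_exists,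
    mul_projL_eq_zero_iff_exists, mul_projL_eq_zero_iff_exists, Matrix.mul_fromCols]
  have h : ∀ (z : Matrix k a ℍ[ℝ]) (z' : Matrix k b ℍ[ℝ]),
      Matrix.fromCols z z' * Matrix.fromBlocks A 0 0 B = Matrix.fromCols (z * A) (z' * B) := by
    intro z z'
    rw [Matrix.fromCols_mul_fromBlocks]
    simp only [Matrix.mul_zero, add_zero, zero_add]
  constructor
  · rintro ⟨z, hz⟩
    rw [← Matrix.fromCols_toCols z, h, Matrix.fromCols_inj.eq_iff] at hz
    exact ⟨⟨_, hz.1⟩, ⟨_, hz.2⟩⟩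
  · rintro ⟨⟨z, hz⟩, ⟨z', hz'⟩⟩
    exact ⟨Matrix.fromCols z z', by rw [h, hz, hz']⟩

end Rank

/-! ### Reorderings of block indices -/

section Shuffles

variable (α β γ δ ε ζ κ ρ : Type*)

/-- Move the second summand to the end. -/
def shuffle₁ : (α ⊕ ρ) ⊕ β ≃ α ⊕ β ⊕ ρ where
  toFun
    | .inl (.inl x) => .inl x
    | .inl (.inr x) => .inr (.inr x)
    | .inr x => .inr (.inl x)
  invFun
    | .inl x => .inl (.inl x)
    | .inr (.inl x) => .inr x
    | .inr (.inr x) => .inl (.inr x)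
  left_inv := by rintro ((_ | _) | _) <;> rfl
  right_inv := by rintro (_ | _ | _) <;> rfl

/-- Move the second and third summands to the end. -/
def shuffle₂ : (α ⊕ ρ) ⊕ β ⊕ γ ≃ α ⊕ β ⊕ γ ⊕ ρ where
  toFun
    | .inl (.inl x) => .inl x
    | .inl (.inr x) => .inr (.inr (.inr x))
    | .inr (.inl x) => .inr (.inl x)
    | .inr (.inr x) => .inr (.inr (.inl x))
  invFun
    | .inl x => .inl (.inl x)
    | .inr (.inl x) => .inr (.inl x)
    | .inr (.inr (.inl x)) => .inr (.inr x)
    | .inr (.inr (.inr x)) => .inl (.inr x)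
  left_inv := by rintro ((_ | _) | _ | _) <;> rfl
  right_inv := by rintro (_ | _ | _ | _) <;> rfl

/-- Move the three summands after the first to the end. -/
def shuffle₃ : (α ⊕ ρ) ⊕ β ⊕ γ ⊕ δ ≃ α ⊕ β ⊕ γ ⊕ δ ⊕ ρ where
  toFun
    | .inl (.inl x) => .inl x
    | .inl (.inr x) => .inr (.inr (.inr (.inr x)))
    | .inr (.inl x) => .inr (.inl x)
    | .inr (.inr (.inl x)) => .inr (.inr (.inl x))
    | .inr (.inr (.inr x)) => .inr (.inr (.inr (.inl x)))
  invFun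
    | .inl x => .inl (.inl x)
    | .inr (.inl x) => .inr (.inl x)
    | .inr (.inr (.inl x)) => .inr (.inr (.inl x))
    | .inr (.inr (.inr (.inl x))) => .inr (.inr (.inr x))
    | .inr (.inr (.inr (.inr x))) => .inl (.inr x)
  left_inv := by rintro ((_ | _) | _ | _ | _) <;> rfl
  right_inv := by rintro (_ | _ | _ | _ | _) <;> rfl

/-- Move the four summands after the first to the end. -/
def shuffle₄ : (α ⊕ ρ) ⊕ β ⊕ γ ⊕ δ ⊕ ε ≃ α ⊕ β ⊕ γ ⊕ δ ⊕ ε ⊕ ρ where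
  toFun
    | .inl (.inl x) => .inl x
    | .inl (.inr x) => .inr (.inr (.inr (.inr (.inr x))))
    | .inr (.inl x) => .inr (.inl x)
    | .inr (.inr (.inl x)) => .inr (.inr (.inl x))
    | .inr (.inr (.inr (.inl x))) => .inr (.inr (.inr (.inl x)))
    | .inr (.inr (.inr (.inr x))) => .inr (.inr (.inr (.inr (.inl x))))
  invFun
    | .inl x => .inl (.inl x)
    | .inr (.inl x) => .inr (.inl x)
    | .inr (.inr (.inl x)) => .inr (.inr (.inl x))
    | .inr (.inr (.inr (.inl x))) => .inr (.inr (.inr (.inl x)))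
    | .inr (.inr (.inr (.inr (.inl x)))) => .inr (.inr (.inr (.inr x)))
    | .inr (.inr (.inr (.inr (.inr x)))) => .inl (.inr x)
  left_inv := by rintro ((_ | _) | _ | _ | _ | _) <;> rfl
  right_inv := by rintro (_ | _ | _ | _ | _ | _) <;> rfl

/-- Collect the first and fourth summands in front, the other early ones at the end. -/
def shuffleDouble : ((α ⊕ β) ⊕ ρ) ⊕ γ ⊕ δ ⊕ ε ⊕ ζ ⊕ κ ≃ α ⊕ γ ⊕ δ ⊕ β ⊕ ε ⊕ ζ ⊕ κ ⊕ ρ where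
  toFun
    | .inl (.inl (.inl x)) => .inl x
    | .inl (.inl (.inr x)) => .inr (.inr (.inr (.inl x)))
    | .inl (.inr x) => .inr (.inr (.inr (.inr (.inr (.inr (.inr x))))))
    | .inr (.inl x) => .inr (.inl x)
    | .inr (.inr (.inl x)) => .inr (.inr (.inl x))
    | .inr (.inr (.inr (.inl x))) => .inr (.inr (.inr (.inr (.inl x))))
    | .inr (.inr (.inr (.inr (.inl x)))) => .inr (.inr (.inr (.inr (.inr (.inl x)))))
    | .inr (.inr (.inr (.inr (.inr x)))) => .inr (.inr (.inr (.inr (.inr (.inr (.inl x))))))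
  invFun
    | .inl x => .inl (.inl (.inl x))
    | .inr (.inr (.inr (.inl x))) => .inl (.inl (.inr x))
    | .inr (.inr (.inr (.inr (.inr (.inr (.inr x)))))) => .inl (.inr x)
    | .inr (.inl x) => .inr (.inl x)
    | .inr (.inr (.inl x)) => .inr (.inr (.inl x))
    | .inr (.inr (.inr (.inr (.inl x)))) => .inr (.inr (.inr (.inl x)))
    | .inr (.inr (.inr (.inr (.inr (.inl x))))) => .inr (.inr (.inr (.inr (.inl x))))
    | .inr (.inr (.inr (.inr (.inr (.inr (.inl x)))))) => .inr (.inr (.inr (.inr (.inr x))))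
  left_inv := by rintro (((_ | _) | _) | _ | _ | _ | _ | _) <;> rfl
  right_inv := by rintro (_ | _ | _ | _ | _ | _ | _ | _) <;> rfl

/-- Exchange the first two with the next two summands. -/
def swapPairs : α ⊕ β ⊕ γ ⊕ δ ⊕ ε ≃ γ ⊕ δ ⊕ α ⊕ β ⊕ ε where
  toFun
    | .inl x => .inr (.inr (.inl x))
    | .inr (.inl x) => .inr (.inr (.inr (.inl x)))
    | .inr (.inr (.inl x)) => .inl x
    | .inr (.inr (.inr (.inl x))) => .inr (.inl x)
    | .inr (.inr (.inr (.inr x))) => .inr (.inr (.inr (.inr x)))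
  invFun
    | .inl x => .inr (.inr (.inl x))
    | .inr (.inl x) => .inr (.inr (.inr (.inl x)))
    | .inr (.inr (.inl x)) => .inl x
    | .inr (.inr (.inr (.inl x))) => .inr (.inl x)
    | .inr (.inr (.inr (.inr x))) => .inr (.inr (.inr (.inr x)))
  left_inv := by rintro (_ | _ | _ | _ | _) <;> rfl
  right_inv := by rintro (_ | _ | _ | _ | _) <;> rfl

end Shuffles

/-! ### Splitting block-diagonal constraints -/

section BlockDiagonal

variable {a b c d e f g h i j k q : Type*} [Fintype a] [Fintype b] [Fintype c] [Fintype d]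
  [Fintype e] [Fintype f] [Fintype g] [Fintype h] [Fintype i] [Fintype j] [Fintype k] [Fintype q]
  [DecidableEq a] [DecidableEq b] [DecidableEq c] [DecidableEq d] [DecidableEq e] [DecidableEq f]
  [DecidableEq g] [DecidableEq h] [DecidableEq i] [DecidableEq j]
  {A : Matrix a b ℍ[ℝ]} {B : Matrix c d ℍ[ℝ]} {C : Matrix e f ℍ[ℝ]} {G : Matrix g h ℍ[ℝ]}
  {H : Matrix i j ℍ[ℝ]}
  {E₁ : Matrix q b ℍ[ℝ]} {E₂ : Matrix q d ℍ[ℝ]} {E₃ : Matrix q f ℍ[ℝ]} {E₄ : Matrix q h ℍ[ℝ]}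
  {E₅ : Matrix q j ℍ[ℝ]} {y : Matrix k q ℍ[ℝ]}

theorem mul_projL_blockDiagonal₂ : y * ((E₁ ┃ E₂) * projL (A ┃ 0 ⊟ 0 ┃ B)) = 0 ↔
    y * (E₁ * projL A) = 0 ∧ y * (E₂ * projL B) = 0 := by
  rw [Matrix.fromRows_fromCols_eq_fromBlocks, mul_fromCols_mul_projL_fromBlocks]

theorem mul_projL_blockDiagonal₃ :
    y * ((E₁ ┃ E₂ ┃ E₃) * projL (A ┃ 0 ┃ 0 ⊟ 0 ┃ B ┃ 0 ⊟ 0 ┃ 0 ┃ C)) = 0 ↔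
    y * (E₁ * projL A) = 0 ∧ y * (E₂ * projL B) = 0 ∧ y * (E₃ * projL C) = 0 := by
  have h : (A ┃ 0 ┃ 0 ⊟ 0 ┃ B ┃ 0 ⊟ 0 ┃ 0 ┃ C) = Matrix.fromBlocks A 0 0 (B ┃ 0 ⊟ 0 ┃ C) := by
    ext1 i j; rcases i with i | i | i <;> rcases j with j | j | j <;> rfl
  rw [h, mul_fromCols_mul_projL_fromBlocks, mul_projL_blockDiagonal₂]

theorem mul_projL_blockDiagonal₄ : y * ((E₁ ┃ E₂ ┃ E₃ ┃ E₄) *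
      projL (A ┃ 0 ┃ 0 ┃ 0 ⊟ 0 ┃ B ┃ 0 ┃ 0 ⊟ 0 ┃ 0 ┃ C ┃ 0 ⊟ 0 ┃ 0 ┃ 0 ┃ G)) = 0 ↔
    y * (E₁ * projL A) = 0 ∧ y * (E₂ * projL B) = 0 ∧ y * (E₃ * projL C) = 0 ∧
      y * (E₄ * projL G) = 0 := by
  have h : (A ┃ 0 ┃ 0 ┃ 0 ⊟ 0 ┃ B ┃ 0 ┃ 0 ⊟ 0 ┃ 0 ┃ C ┃ 0 ⊟ 0 ┃ 0 ┃ 0 ┃ G)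
      = Matrix.fromBlocks A 0 0 (B ┃ 0 ┃ 0 ⊟ 0 ┃ C ┃ 0 ⊟ 0 ┃ 0 ┃ G) := by
    ext1 i j; rcases i with i | i | i | i <;> rcases j with j | j | j | j <;> rfl
  rw [h, mul_fromCols_mul_projL_fromBlocks, mul_projL_blockDiagonal₃]

theorem mul_projL_blockDiagonal₅ : y * ((E₁ ┃ E₂ ┃ E₃ ┃ E₄ ┃ E₅) *
      projL (A ┃ 0 ┃ 0 ┃ 0 ┃ 0 ⊟ 0 ┃ B ┃ 0 ┃ 0 ┃ 0 ⊟ 0 ┃ 0 ┃ C ┃ 0 ┃ 0 ⊟ 0 ┃ 0 ┃ 0 ┃ G ┃ 0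
        ⊟ 0 ┃ 0 ┃ 0 ┃ 0 ┃ H)) = 0 ↔
    y * (E₁ * projL A) = 0 ∧ y * (E₂ * projL B) = 0 ∧ y * (E₃ * projL C) = 0 ∧
      y * (E₄ * projL G) = 0 ∧ y * (E₅ * projL H) = 0 := by
  have h : (A ┃ 0 ┃ 0 ┃ 0 ┃ 0 ⊟ 0 ┃ B ┃ 0 ┃ 0 ┃ 0 ⊟ 0 ┃ 0 ┃ C ┃ 0 ┃ 0 ⊟ 0 ┃ 0 ┃ 0 ┃ G ┃ 0
        ⊟ 0 ┃ 0 ┃ 0 ┃ 0 ┃ H)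
      = Matrix.fromBlocks A 0 0
        (B ┃ 0 ┃ 0 ┃ 0 ⊟ 0 ┃ C ┃ 0 ┃ 0 ⊟ 0 ┃ 0 ┃ G ┃ 0 ⊟ 0 ┃ 0 ┃ 0 ┃ H) := by
    ext1 i j; rcases i with i | i | i | i | i <;> rcases j with j | j | j | j | j <;> rfl
  rw [h, mul_fromCols_mul_projL_fromBlocks, mul_projL_blockDiagonal₄]

end BlockDiagonal

/-! ### The first four rank equalities in terms of T₁ -/

namespace System

variable {p m₁ m₂ m₃ m₄ n₁ n₂ n₃ n₄ : ℕ} {η : ℍ[ℝ]} {D : System p m₁ m₂ m₃ m₄ n₁ n₂ n₃ n₄}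

local postfix:max "ᵑ" => etaStar η

variable (η) in
/-- A self-adjoint solution of `A X = C`. -/
noncomputable def particular {m n : ℕ} (A C : Matrix (Fin m) (Fin n) ℍ[ℝ]) :
    Matrix (Fin n) (Fin n) ℍ[ℝ] :=
  A† * C + projL A * Cᵑ * Aᵑ†

theorem mul_particular {m n : ℕ} {A C : Matrix (Fin m) (Fin n) ℍ[ℝ]} (h : projR A * C = 0) :
    A * particular η A C = C := by
  rw [particular, Matrix.mul_add, ← Matrix.mul_assoc, ← projR_mul_eq_zero_iff.1 h,
    ← Matrix.mul_assoc, ← Matrix.mul_assoc, mul_projL, Matrix.zero_mul, Matrix.zero_mul, add_zero]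

theorem mul_pinv_mul_eq {m n k : ℕ} {A : Matrix (Fin m) (Fin n) ℍ[ℝ]}
    {C : Matrix (Fin m) (Fin k) ℍ[ℝ]} (h : projR A * C = 0) : A * (A† * C) = C := by
  rw [← Matrix.mul_assoc, ← projR_mul_eq_zero_iff.1 h]

variable (η D) in
/-- The contribution of the first unknown to `T₁`. -/
noncomputable def t₁ : Matrix (Fin p) (Fin p) ℍ[ℝ] := D.E₁ * (D.A₁† * D.C₁)

variable (η D) in
noncomputable def t₂ : Matrix (Fin p) (Fin p) ℍ[ℝ] := D.E₂ * (particular η D.A₂ D.C₂ * D.E₂ᵑ)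

variable (η D) in
noncomputable def t₃ : Matrix (Fin p) (Fin p) ℍ[ℝ] := D.E₃ * (particular η D.A₃ D.C₃ * D.E₃ᵑ)

variable (η D) in
noncomputable def t₄ : Matrix (Fin p) (Fin p) ℍ[ℝ] := D.E₄ * (particular η D.A₄ D.C₄ * D.E₄ᵑ)

theorem T₁_eq (hη : IsPureUnit η) :
    D.T₁ η = D.Cc - D.t₁ - D.t₁ᵑ - D.t₂ η - D.t₃ η - D.t₄ η := by
  simp only [T₁, t₁, t₂, t₃, t₄, particular, etaStar_mul hη, etaStar_pinv hη, Matrix.mul_assoc]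
  abel

theorem t₂_etaStar (hη : IsPureUnit η) (hs : D.Symmetric η) : (D.t₂ η)ᵑ = D.t₂ η := by
  rw [t₂, etaStar_mul hη, etaStar_mul hη, etaStar_etaStar hη, particular,
    hermitianPair_etaStar hη hs.A₂C₂, Matrix.mul_assoc]

theorem t₃_etaStar (hη : IsPureUnit η) (hs : D.Symmetric η) : (D.t₃ η)ᵑ = D.t₃ η := by
  rw [t₃, etaStar_mul hη, etaStar_mul hη, etaStar_etaStar hη, particular,
    hermitianPair_etaStar hη hs.A₃C₃, Matrix.mul_assoc]

theorem t₄_etaStar (hη : IsPureUnit η) (hs : D.Symmetric η) : (D.t₄ η)ᵑ = D.t₄ η := by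
  rw [t₄, etaStar_mul hη, etaStar_mul hη, etaStar_etaStar hη, particular,
    hermitianPair_etaStar hη hs.A₄C₄, Matrix.mul_assoc]

theorem mul_particular_mul {m n k : ℕ} {A C : Matrix (Fin m) (Fin n) ℍ[ℝ]}
    (h : projR A * C = 0) (E : Matrix (Fin k) (Fin n) ℍ[ℝ]) :
    A * (particular η A C * Eᵑ) = C * Eᵑ := by
  rw [← Matrix.mul_assoc, mul_particular h]

/-- The first rank equality in terms of `T₁`. -/
theorem rank₁_iff (hη : IsPureUnit η) (hc : D.Consistent) :
    rank ( D.Cc  ┃ D.E₁ ┃ D.E₂ ┃ D.E₃ ┃ D.E₄ ┃ D.C₁ᵑ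
         ⊟ D.E₁ᵑ ┃ 0    ┃ 0    ┃ 0    ┃ 0    ┃ D.A₁ᵑ
         ⊟ D.C₁  ┃ D.A₁ ┃ 0    ┃ 0    ┃ 0    ┃ 0
         ⊟ D.P₂ η ┃ 0   ┃ D.A₂ ┃ 0    ┃ 0    ┃ 0
         ⊟ D.P₃ η ┃ 0   ┃ 0    ┃ D.A₃ ┃ 0    ┃ 0
         ⊟ D.P₄ η ┃ 0   ┃ 0    ┃ 0    ┃ D.A₄ ┃ 0)
    = rank ( D.E₁ ┃ D.E₂ ┃ D.E₃ ┃ D.E₄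
           ⊟ D.A₁ ┃ 0    ┃ 0    ┃ 0
           ⊟ 0    ┃ D.A₂ ┃ 0    ┃ 0
           ⊟ 0    ┃ 0    ┃ D.A₃ ┃ 0
           ⊟ 0    ┃ 0    ┃ 0    ┃ D.A₄)
      + rank (D.E₁ ⊟ D.A₁) ↔
    ∀ y w : Matrix Unit (Fin p) ℍ[ℝ],
      (y * D.A₁₁ = 0 ∧ y * D.A₂₂ = 0 ∧ y * D.A₃₃ = 0 ∧ y * D.A₄₄ = 0) → w * D.A₁₁ = 0 →
        y * D.T₁ η * wᵑ = 0 := by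
  have hT : D.T₁ η = D.Cc - (D.E₁ ┃ D.E₂ ┃ D.E₃ ┃ D.E₄)
      * (D.A₁† * D.C₁ ⊟ particular η D.A₂ D.C₂ * D.E₂ᵑ ⊟ particular η D.A₃ D.C₃ * D.E₃ᵑ
        ⊟ particular η D.A₄ D.C₄ * D.E₄ᵑ) - (D.E₁ * (D.A₁† * D.C₁))ᵑ := by
    simp only [Matrix.fromCols_mul_fromRows, T₁_eq hη, t₁, t₂, t₃, t₄]
    abel
  rw [hT]
  simp only [A₁₁, A₂₂, A₃₃, A₄₄, ← mul_projL_blockDiagonal₄]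
  refine rank_bordered_eq_add_iff hη (shuffle₁ _ _ _) (shuffle₄ _ _ _ _ _ _) (K := D.Cc)
    (Cy := D.C₁ ⊟ D.P₂ η ⊟ D.P₃ η ⊟ D.P₄ η) (Cx := D.C₁)
    (D.A₁† * D.C₁ ⊟ particular η D.A₂ D.C₂ * D.E₂ᵑ ⊟ particular η D.A₃ D.C₃ * D.E₃ᵑ
      ⊟ particular η D.A₄ D.C₄ * D.E₄ᵑ) (D.A₁† * D.C₁) ?_ (mul_pinv_mul_eq hc.C₁) ?_
  · simp only [Matrix.fromRows_mul, Matrix.fromCols_mul_fromRows, Matrix.zero_mul, add_zero,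
      zero_add, mul_pinv_mul_eq hc.C₁, mul_particular_mul hc.C₂, mul_particular_mul hc.C₃,
      mul_particular_mul hc.C₄, P₂, P₃, P₄]
  · ext1 i j
    rcases i with (i | i | i | i | i) | i <;> rcases j with (j | j) | j | j | j | j <;> rfl

theorem rank₂_iff (hη : IsPureUnit η) (hs : D.Symmetric η) (hc : D.Consistent) :
    rank ( D.Cc   ┃ D.E₄ ┃ D.E₂ ┃ D.E₁ ┃ (D.P₃ η)ᵑ ┃ D.C₁ᵑ
         ⊟ D.E₃ᵑ  ┃ 0    ┃ 0    ┃ 0    ┃ D.A₃ᵑ     ┃ 0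
         ⊟ D.E₁ᵑ  ┃ 0    ┃ 0    ┃ 0    ┃ 0         ┃ D.A₁ᵑ
         ⊟ D.P₄ η ┃ D.A₄ ┃ 0    ┃ 0    ┃ 0         ┃ 0
         ⊟ D.P₂ η ┃ 0    ┃ D.A₂ ┃ 0    ┃ 0         ┃ 0
         ⊟ D.C₁   ┃ 0    ┃ 0    ┃ D.A₁ ┃ 0         ┃ 0)
    = rank ( D.E₄ ┃ D.E₂ ┃ D.E₁
           ⊟ D.A₄ ┃ 0    ┃ 0
           ⊟ 0    ┃ D.A₂ ┃ 0
           ⊟ 0    ┃ 0    ┃ D.A₁)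
      + rank ( D.E₃ ┃ D.E₁
             ⊟ D.A₃ ┃ 0
             ⊟ 0    ┃ D.A₁) ↔
    ∀ y w : Matrix Unit (Fin p) ℍ[ℝ],
      (y * D.A₄₄ = 0 ∧ y * D.A₂₂ = 0 ∧ y * D.A₁₁ = 0) →
      (w * D.A₃₃ = 0 ∧ w * D.A₁₁ = 0) → y * D.T₁ η * wᵑ = 0 := by
  -- The correction by E₃ is taken from the other border and so appears as an η-star; this is where
  -- its self-adjointness is needed.
  have hT : D.T₁ η = D.Cc - (D.E₄ ┃ D.E₂ ┃ D.E₁)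
      * (particular η D.A₄ D.C₄ * D.E₄ᵑ ⊟ particular η D.A₂ D.C₂ * D.E₂ᵑ ⊟ D.A₁† * D.C₁)
      - ((D.E₃ ┃ D.E₁)
        * (particular η D.A₃ D.C₃ * D.E₃ᵑ ⊟ D.A₁† * D.C₁))ᵑ := by
    simp only [Matrix.fromCols_mul_fromRows, etaStar_add, ← t₁.eq_def, ← t₂.eq_def, ← t₃.eq_def, ←
        t₄.eq_def,
      t₃_etaStar hη hs]
    rw [T₁_eq hη]
    abel
  rw [hT]
  simp only [A₁₁, A₂₂, A₃₃, A₄₄, ← mul_projL_blockDiagonal₃]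
  simp only [← mul_projL_blockDiagonal₂]
  refine rank_bordered_eq_add_iff hη (shuffle₂ _ _ _ _ ) (shuffle₃ _ _ _ _ _ ) (K := D.Cc)
    (Cy := D.P₄ η ⊟ D.P₂ η ⊟ D.C₁) (Cx := D.P₃ η ⊟ D.C₁)
    (particular η D.A₄ D.C₄ * D.E₄ᵑ ⊟ particular η D.A₂ D.C₂ * D.E₂ᵑ ⊟ D.A₁† * D.C₁)
    (particular η D.A₃ D.C₃ * D.E₃ᵑ ⊟ D.A₁† * D.C₁) ?_ ?_ ?_
  · simp only [Matrix.fromRows_mul, Matrix.fromCols_mul_fromRows, Matrix.zero_mul, add_zero,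
      zero_add, mul_pinv_mul_eq hc.C₁, mul_particular_mul hc.C₄, mul_particular_mul hc.C₂,
      P₄, P₂]
  · simp only [Matrix.fromRows_mul, Matrix.fromCols_mul_fromRows, Matrix.zero_mul, add_zero,
      zero_add, mul_pinv_mul_eq hc.C₁, mul_particular_mul hc.C₃,
      P₃]
  · simp only [etaStar_fromRows, etaStar_fromCols, etaStar_zero]
    ext1 i j
    rcases i with (i | i | i | i) | i | i <;> rcases j with (j | j | j) | j | j | j <;> rfl

theorem rank₃_iff (hη : IsPureUnit η) (hs : D.Symmetric η) (hc : D.Consistent) :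
    rank ( D.Cc   ┃ D.E₄ ┃ D.E₃ ┃ D.E₁ ┃ (D.P₂ η)ᵑ ┃ D.C₁ᵑ
         ⊟ D.E₂ᵑ  ┃ 0    ┃ 0    ┃ 0    ┃ D.A₂ᵑ     ┃ 0
         ⊟ D.E₁ᵑ  ┃ 0    ┃ 0    ┃ 0    ┃ 0         ┃ D.A₁ᵑ
         ⊟ D.P₄ η ┃ D.A₄ ┃ 0    ┃ 0    ┃ 0         ┃ 0
         ⊟ D.P₃ η ┃ 0    ┃ D.A₃ ┃ 0    ┃ 0         ┃ 0
         ⊟ D.C₁   ┃ 0    ┃ 0    ┃ D.A₁ ┃ 0         ┃ 0)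
    = rank ( D.E₄ ┃ D.E₃ ┃ D.E₁
           ⊟ D.A₄ ┃ 0    ┃ 0
           ⊟ 0    ┃ D.A₃ ┃ 0
           ⊟ 0    ┃ 0    ┃ D.A₁)
      + rank ( D.E₂ ┃ D.E₁
             ⊟ D.A₂ ┃ 0
             ⊟ 0    ┃ D.A₁) ↔
    ∀ y w : Matrix Unit (Fin p) ℍ[ℝ],
      (y * D.A₄₄ = 0 ∧ y * D.A₃₃ = 0 ∧ y * D.A₁₁ = 0) →
      (w * D.A₂₂ = 0 ∧ w * D.A₁₁ = 0) → y * D.T₁ η * wᵑ = 0 := by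
  have hT : D.T₁ η = D.Cc - (D.E₄ ┃ D.E₃ ┃ D.E₁)
      * (particular η D.A₄ D.C₄ * D.E₄ᵑ ⊟ particular η D.A₃ D.C₃ * D.E₃ᵑ ⊟ D.A₁† * D.C₁)
      - ((D.E₂ ┃ D.E₁)
        * (particular η D.A₂ D.C₂ * D.E₂ᵑ ⊟ D.A₁† * D.C₁))ᵑ := by
    simp only [Matrix.fromCols_mul_fromRows, etaStar_add, ← t₁.eq_def, ← t₂.eq_def, ← t₃.eq_def, ←
        t₄.eq_def,
      t₂_etaStar hη hs]
    rw [T₁_eq hη]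
    abel
  rw [hT]
  simp only [A₁₁, A₂₂, A₃₃, A₄₄, ← mul_projL_blockDiagonal₃]
  simp only [← mul_projL_blockDiagonal₂]
  refine rank_bordered_eq_add_iff hη (shuffle₂ _ _ _ _ ) (shuffle₃ _ _ _ _ _ ) (K := D.Cc)
    (Cy := D.P₄ η ⊟ D.P₃ η ⊟ D.C₁) (Cx := D.P₂ η ⊟ D.C₁)
    (particular η D.A₄ D.C₄ * D.E₄ᵑ ⊟ particular η D.A₃ D.C₃ * D.E₃ᵑ ⊟ D.A₁† * D.C₁)
    (particular η D.A₂ D.C₂ * D.E₂ᵑ ⊟ D.A₁† * D.C₁) ?_ ?_ ?_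
  · simp only [Matrix.fromRows_mul, Matrix.fromCols_mul_fromRows, Matrix.zero_mul, add_zero,
      zero_add, mul_pinv_mul_eq hc.C₁, mul_particular_mul hc.C₄, mul_particular_mul hc.C₃,
      P₄, P₃]
  · simp only [Matrix.fromRows_mul, Matrix.fromCols_mul_fromRows, Matrix.zero_mul, add_zero,
      zero_add, mul_pinv_mul_eq hc.C₁, mul_particular_mul hc.C₂,
      P₂]
  · simp only [etaStar_fromRows, etaStar_fromCols, etaStar_zero]
    ext1 i j
    rcases i with (i | i | i | i) | i | i <;> rcases j with (j | j | j) | j | j | j <;> rfl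

theorem rank₄_iff (hη : IsPureUnit η) (hs : D.Symmetric η) (hc : D.Consistent) :
    rank ( D.Cc   ┃ D.E₄ ┃ D.E₁ ┃ (D.P₃ η)ᵑ ┃ (D.P₂ η)ᵑ ┃ D.C₁ᵑ
         ⊟ D.E₃ᵑ  ┃ 0    ┃ 0    ┃ D.A₃ᵑ     ┃ 0         ┃ 0
         ⊟ D.E₂ᵑ  ┃ 0    ┃ 0    ┃ 0         ┃ D.A₂ᵑ     ┃ 0
         ⊟ D.E₁ᵑ  ┃ 0    ┃ 0    ┃ 0         ┃ 0         ┃ D.A₁ᵑ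
         ⊟ D.P₄ η ┃ D.A₄ ┃ 0    ┃ 0         ┃ 0         ┃ 0
         ⊟ D.C₁   ┃ 0    ┃ D.A₁ ┃ 0         ┃ 0         ┃ 0)
    = rank ( D.E₃ ┃ D.E₂ ┃ D.E₁
           ⊟ D.A₃ ┃ 0    ┃ 0
           ⊟ 0    ┃ D.A₂ ┃ 0
           ⊟ 0    ┃ 0    ┃ D.A₁)
      + rank ( D.E₄ ┃ D.E₁
             ⊟ D.A₄ ┃ 0
             ⊟ 0    ┃ D.A₁) ↔
    ∀ y w : Matrix Unit (Fin p) ℍ[ℝ],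
      (y * D.A₄₄ = 0 ∧ y * D.A₁₁ = 0) →
      (w * D.A₃₃ = 0 ∧ w * D.A₂₂ = 0 ∧ w * D.A₁₁ = 0) → y * D.T₁ η * wᵑ = 0 := by
  have hT : D.T₁ η = D.Cc - (D.E₄ ┃ D.E₁)
      * (particular η D.A₄ D.C₄ * D.E₄ᵑ ⊟ D.A₁† * D.C₁)
      - ((D.E₃ ┃ D.E₂ ┃ D.E₁)
        * (particular η D.A₃ D.C₃ * D.E₃ᵑ ⊟ particular η D.A₂ D.C₂ * D.E₂ᵑ ⊟ D.A₁† * D.C₁))ᵑ := by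
    simp only [Matrix.fromCols_mul_fromRows, etaStar_add, ← t₁.eq_def, ← t₂.eq_def, ← t₃.eq_def, ←
        t₄.eq_def,
      t₃_etaStar hη hs, t₂_etaStar hη hs]
    rw [T₁_eq hη]
    abel
  rw [hT, add_comm (rank (D.E₃ ┃ _ ⊟ _))]
  simp only [A₁₁, A₂₂, A₃₃, A₄₄, ← mul_projL_blockDiagonal₃]
  simp only [← mul_projL_blockDiagonal₂]
  refine rank_bordered_eq_add_iff hη (shuffle₃ _ _ _ _ _ ) (shuffle₂ _ _ _ _ ) (K := D.Cc)
    (Cy := D.P₄ η ⊟ D.C₁) (Cx := D.P₃ η ⊟ D.P₂ η ⊟ D.C₁)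
    (particular η D.A₄ D.C₄ * D.E₄ᵑ ⊟ D.A₁† * D.C₁)
    (particular η D.A₃ D.C₃ * D.E₃ᵑ ⊟ particular η D.A₂ D.C₂ * D.E₂ᵑ ⊟ D.A₁† * D.C₁) ?_ ?_ ?_
  · simp only [Matrix.fromRows_mul, Matrix.fromCols_mul_fromRows, Matrix.zero_mul, add_zero,
      zero_add, mul_pinv_mul_eq hc.C₁, mul_particular_mul hc.C₄,
      P₄]
  · simp only [Matrix.fromRows_mul, Matrix.fromCols_mul_fromRows, Matrix.zero_mul, add_zero,
      zero_add, mul_pinv_mul_eq hc.C₁, mul_particular_mul hc.C₃, mul_particular_mul hc.C₂,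
      P₃, P₂]
  · simp only [etaStar_fromRows, etaStar_fromCols, etaStar_zero]
    ext1 i j
    rcases i with (i | i | i) | i | i | i <;> rcases j with (j | j | j | j) | j | j <;> rfl

end System

theorem forall_fromCols_iff {m n k : Type*} {Q : Matrix k (m ⊕ n) ℍ[ℝ] → Prop} :
    (∀ y, Q y) ↔ ∀ y₀ y₁, Q (y₀ ┃ y₁) :=
  ⟨fun h _ _ => h _, fun h y => by rw [← Matrix.fromCols_toCols y]; exact h _ _⟩

/-! ### The fifth rank equality and the doubled system -/

namespace System

variable {p m₁ m₂ m₃ m₄ n₁ n₂ n₃ n₄ : ℕ} {η : ℍ[ℝ]} {D : System p m₁ m₂ m₃ m₄ n₁ n₂ n₃ n₄}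

local postfix:max "ᵑ" => etaStar η

variable (D) in
/-- The matrix on the right of the fifth rank equality. -/
noncomputable def double := ( D.E₂ ┃ D.E₁ ┃ 0 ┃ 0 ┃ D.E₄
  ⊟ 0 ┃ 0 ┃ D.E₃ ┃ D.E₁ ┃ D.E₄
  ⊟ D.A₂ ┃ 0 ┃ 0 ┃ 0 ┃ 0
  ⊟ 0 ┃ D.A₁ ┃ 0 ┃ 0 ┃ 0
  ⊟ 0 ┃ 0 ┃ D.A₃ ┃ 0 ┃ 0
  ⊟ 0 ┃ 0 ┃ 0 ┃ D.A₁ ┃ 0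
  ⊟ 0 ┃ 0 ┃ 0 ┃ 0 ┃ D.A₄)

variable (D) in
theorem rank_double_left :
    rank (((D.E₂ ⊟ 0) ┃ (D.E₁ ⊟ 0) ┃ (0 ⊟ D.E₃) ┃ (0 ⊟ D.E₁) ┃ (D.E₄ ⊟ D.E₄))
      ⊟ D.A₂ ┃ 0 ┃ 0 ┃ 0 ┃ 0
      ⊟ 0 ┃ D.A₁ ┃ 0 ┃ 0 ┃ 0
      ⊟ 0 ┃ 0 ┃ D.A₃ ┃ 0 ┃ 0
      ⊟ 0 ┃ 0 ┃ 0 ┃ D.A₁ ┃ 0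
      ⊟ 0 ┃ 0 ┃ 0 ┃ 0 ┃ D.A₄) = rank D.double := by
  rw [← rank_submatrix D.double (Equiv.sumAssoc _ _ _) (Equiv.refl _)]
  congr 1
  ext1 i j
  rcases i with (i | i) | i <;> rcases j with j | j | j | j | j <;> rfl

variable (D) in
-- Exchange the two copies and reverse the signs of one of them. This leaves the diagonal blocks
-- alone and changes only one of the two E₄ blocks.
theorem rank_double_right :
    rank (((D.E₃ ⊟ 0) ┃ (D.E₁ ⊟ 0) ┃ (0 ⊟ D.E₂) ┃ (0 ⊟ D.E₁) ┃ (D.E₄ ⊟ -D.E₄))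
      ⊟ D.A₃ ┃ 0 ┃ 0 ┃ 0 ┃ 0
      ⊟ 0 ┃ D.A₁ ┃ 0 ┃ 0 ┃ 0
      ⊟ 0 ┃ 0 ┃ D.A₂ ┃ 0 ┃ 0
      ⊟ 0 ┃ 0 ┃ 0 ┃ D.A₁ ┃ 0
      ⊟ 0 ┃ 0 ┃ 0 ┃ 0 ┃ D.A₄) = rank D.double := by
  let s : (Fin p ⊕ Fin p) ⊕ (Fin m₃ ⊕ Fin m₁ ⊕ Fin m₂ ⊕ Fin m₁ ⊕ Fin m₄) → ℍ[ℝ] :=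
    Sum.elim (Sum.elim 1 (-1)) (Sum.elim 1 (Sum.elim 1 (Sum.elim (-1) (Sum.elim (-1) 1))))
  let t : Fin n₃ ⊕ Fin n₁ ⊕ Fin n₂ ⊕ Fin n₁ ⊕ Fin n₄ → ℍ[ℝ] :=
    Sum.elim 1 (Sum.elim 1 (Sum.elim (-1) (Sum.elim (-1) 1)))
  have hs : ∀ i, s i * s i = 1 := by rintro ((_ | _) | _ | _ | _ | _ | _) <;> simp [s]
  have ht : ∀ j, t j * t j = 1 := by rintro (_ | _ | _ | _ | _) <;> simp [t]
  rw [← rank_submatrix D.double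
    (((Equiv.sumComm _ _).sumCongr (swapPairs _ _ _ _ _)).trans (Equiv.sumAssoc _ _ _))
    (swapPairs _ _ _ _ _), ← rank_diagonal_mul_mul_diagonal (D.double.submatrix _ _) hs ht]
  congr 1
  ext1 i j
  rw [Matrix.mul_diagonal, Matrix.diagonal_mul]
  rcases i with (i | i) | i | i | i | i | i <;> rcases j with j | j | j | j | j <;>
    simp [s, t, double, swapPairs]

theorem rank₅_iff (hη : IsPureUnit η) (hs : D.Symmetric η) (hc : D.Consistent) :
    rank
      ( D.Cc   ┃ D.E₂ ┃ D.E₁ ┃ 0      ┃ 0    ┃ 0    ┃ D.E₄ ┃ (D.P₃ η)ᵑ ┃ D.C₁ᵑ ┃ 0 ┃ 0 ┃ (D.P₄ η)ᵑ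
      ⊟ D.E₃ᵑ  ┃ 0    ┃ 0    ┃ 0      ┃ 0    ┃ 0    ┃ 0    ┃ D.A₃ᵑ     ┃ 0     ┃ 0 ┃ 0 ┃ 0
      ⊟ D.E₁ᵑ  ┃ 0    ┃ 0    ┃ 0      ┃ 0    ┃ 0    ┃ 0    ┃ 0         ┃ D.A₁ᵑ ┃ 0 ┃ 0 ┃ 0
      ⊟ 0      ┃ 0    ┃ 0    ┃ D.Cc   ┃ D.E₃ ┃ D.E₁ ┃ D.E₄ ┃ 0 ┃ 0 ┃ (D.P₂ η)ᵑ ┃ D.C₁ᵑ ┃ 0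
      ⊟ 0      ┃ 0    ┃ 0    ┃ D.E₂ᵑ  ┃ 0    ┃ 0    ┃ 0    ┃ 0 ┃ 0 ┃ D.A₂ᵑ     ┃ 0     ┃ 0
      ⊟ 0      ┃ 0    ┃ 0    ┃ D.E₁ᵑ  ┃ 0    ┃ 0    ┃ 0    ┃ 0 ┃ 0 ┃ 0         ┃ D.A₁ᵑ ┃ 0
      ⊟ D.E₄ᵑ  ┃ 0    ┃ 0    ┃ -D.E₄ᵑ ┃ 0    ┃ 0    ┃ 0    ┃ 0 ┃ 0 ┃ 0         ┃ 0     ┃ D.A₄ᵑ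
      ⊟ D.P₂ η ┃ D.A₂ ┃ 0    ┃ 0      ┃ 0    ┃ 0    ┃ 0    ┃ 0 ┃ 0 ┃ 0         ┃ 0     ┃ 0
      ⊟ D.C₁   ┃ 0    ┃ D.A₁ ┃ 0      ┃ 0    ┃ 0    ┃ 0    ┃ 0 ┃ 0 ┃ 0         ┃ 0     ┃ 0
      ⊟ 0      ┃ 0    ┃ 0    ┃ D.P₃ η ┃ D.A₃ ┃ 0    ┃ 0    ┃ 0 ┃ 0 ┃ 0         ┃ 0     ┃ 0
      ⊟ 0      ┃ 0    ┃ 0    ┃ D.C₁   ┃ 0    ┃ D.A₁ ┃ 0    ┃ 0 ┃ 0 ┃ 0         ┃ 0     ┃ 0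
      ⊟ 0      ┃ 0    ┃ 0    ┃ D.P₄ η ┃ 0    ┃ 0    ┃ D.A₄ ┃ 0 ┃ 0 ┃ 0         ┃ 0     ┃ 0)
    = 2 * rank ( D.E₂ ┃ D.E₁ ┃ 0    ┃ 0    ┃ D.E₄
               ⊟ 0    ┃ 0    ┃ D.E₃ ┃ D.E₁ ┃ D.E₄
               ⊟ D.A₂ ┃ 0    ┃ 0    ┃ 0    ┃ 0
               ⊟ 0    ┃ D.A₁ ┃ 0    ┃ 0    ┃ 0
               ⊟ 0    ┃ 0    ┃ D.A₃ ┃ 0    ┃ 0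
               ⊟ 0    ┃ 0    ┃ 0    ┃ D.A₁ ┃ 0
               ⊟ 0    ┃ 0    ┃ 0    ┃ 0    ┃ D.A₄) ↔
    ∀ y₀ y₁ w₀ w₁ : Matrix Unit (Fin p) ℍ[ℝ], y₀ * D.A₂₂ = 0 → y₀ * D.A₁₁ = 0 →
      y₁ * D.A₃₃ = 0 → y₁ * D.A₁₁ = 0 → y₀ * D.A₄₄ + y₁ * D.A₄₄ = 0 → w₀ * D.A₃₃ = 0 →
      w₀ * D.A₁₁ = 0 → w₁ * D.A₂₂ = 0 → w₁ * D.A₁₁ = 0 → w₀ * D.A₄₄ - w₁ * D.A₄₄ = 0 →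
      y₀ * D.T₁ η * w₀ᵑ + y₁ * D.T₁ η * w₁ᵑ = 0 := by
  -- The coupling column corrects the second copy from the left border and the first copy from the
  -- right. Each leaves a stray `t₄` block off the diagonal, and the minus sign at E₄ makes the two
  -- cancel.
  have hT : Matrix.fromBlocks (D.T₁ η) 0 0 (D.T₁ η) = Matrix.fromBlocks D.Cc 0 0 D.Cc
      - ((D.E₂ ⊟ 0) ┃ (D.E₁ ⊟ 0) ┃ (0 ⊟ D.E₃) ┃ (0 ⊟ D.E₁) ┃ (D.E₄ ⊟ D.E₄)) * (particular η D.A₂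
          D.C₂ * D.E₂ᵑ ┃ 0 ⊟ D.A₁† * D.C₁ ┃ 0 ⊟ 0 ┃ particular η D.A₃ D.C₃ * D.E₃ᵑ
      ⊟ 0 ┃ D.A₁† * D.C₁ ⊟ 0 ┃ particular η D.A₄ D.C₄ * D.E₄ᵑ)
      - (((D.E₃ ⊟ 0) ┃ (D.E₁ ⊟ 0) ┃ (0 ⊟ D.E₂) ┃ (0 ⊟ D.E₁) ┃ (D.E₄ ⊟ -D.E₄)) * (particular η D.A₃
          D.C₃ * D.E₃ᵑ ┃ 0 ⊟ D.A₁† * D.C₁ ┃ 0 ⊟ 0 ┃ particular η D.A₂ D.C₂ * D.E₂ᵑ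
      ⊟ 0 ┃ D.A₁† * D.C₁ ⊟ particular η D.A₄ D.C₄ * D.E₄ᵑ ┃ 0))ᵑ := by
    have h1 : ((D.E₂ ⊟ 0) ┃ (D.E₁ ⊟ 0) ┃ (0 ⊟ D.E₃) ┃ (0 ⊟ D.E₁) ┃ (D.E₄ ⊟ D.E₄)) * (particular η
        D.A₂ D.C₂ * D.E₂ᵑ ┃ 0 ⊟ D.A₁† * D.C₁ ┃ 0 ⊟ 0 ┃ particular η D.A₃ D.C₃ * D.E₃ᵑ
      ⊟ 0 ┃ D.A₁† * D.C₁ ⊟ 0 ┃ particular η D.A₄ D.C₄ * D.E₄ᵑ)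
        = Matrix.fromBlocks (D.t₂ η + D.t₁) (D.t₄ η) 0 (D.t₃ η + D.t₁ + D.t₄ η) := by
      simp only [Matrix.fromCols_mul_fromRows, Matrix.fromRows_mul_fromCols, Matrix.fromBlocks_add,
        Matrix.mul_zero, Matrix.zero_mul, t₁, t₂, t₃, t₄, add_zero, zero_add, add_assoc]
    have h2 : ((D.E₃ ⊟ 0) ┃ (D.E₁ ⊟ 0) ┃ (0 ⊟ D.E₂) ┃ (0 ⊟ D.E₁) ┃ (D.E₄ ⊟ -D.E₄)) * (particular η
        D.A₃ D.C₃ * D.E₃ᵑ ┃ 0 ⊟ D.A₁† * D.C₁ ┃ 0 ⊟ 0 ┃ particular η D.A₂ D.C₂ * D.E₂ᵑ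
      ⊟ 0 ┃ D.A₁† * D.C₁ ⊟ particular η D.A₄ D.C₄ * D.E₄ᵑ ┃ 0)
        = Matrix.fromBlocks (D.t₃ η + D.t₁ + D.t₄ η) 0 (-D.t₄ η) (D.t₂ η + D.t₁) := by
      simp only [Matrix.fromCols_mul_fromRows, Matrix.fromRows_mul_fromCols, Matrix.fromBlocks_add,
        Matrix.mul_zero, Matrix.zero_mul, Matrix.neg_mul, t₁, t₂, t₃, t₄, add_zero, zero_add,
        add_assoc]
    have h3 : (Matrix.fromBlocks (D.t₃ η + D.t₁ + D.t₄ η) 0 (-D.t₄ η) (D.t₂ η + D.t₁))ᵑ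
        = Matrix.fromBlocks (D.t₃ η + D.t₁ᵑ + D.t₄ η) (-D.t₄ η) 0 (D.t₂ η + D.t₁ᵑ) := by
      rw [← Matrix.fromRows_fromCols_eq_fromBlocks, etaStar_fromRows, etaStar_fromCols,
        etaStar_fromCols, Matrix.fromCols_fromRows_eq_fromBlocks]
      simp only [etaStar_add, etaStar_neg, etaStar_zero, t₂_etaStar hη hs, t₃_etaStar hη hs,
        t₄_etaStar hη hs]
    rw [h1, h2, h3, T₁_eq hη]
    simp only [sub_eq_add_neg, Matrix.fromBlocks_neg, Matrix.fromBlocks_add]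
    congr 1 <;> abel
  rw [← double, two_mul]
  nth_rewrite 1 [← rank_double_left]
  rw [← rank_double_right]
  refine (rank_bordered_eq_add_iff hη (shuffleDouble _ _ _ _ _ _ _ _)
    (shuffleDouble _ _ _ _ _ _ _ _) (K := Matrix.fromBlocks D.Cc 0 0 D.Cc)
    (Cy := D.P₂ η ┃ 0 ⊟ D.C₁ ┃ 0 ⊟ 0 ┃ D.P₃ η ⊟ 0 ┃ D.C₁ ⊟ 0 ┃ D.P₄ η)
    (Cx := D.P₃ η ┃ 0 ⊟ D.C₁ ┃ 0 ⊟ 0 ┃ D.P₂ η ⊟ 0 ┃ D.C₁ ⊟ D.P₄ η ┃ 0)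
    (particular η D.A₂ D.C₂ * D.E₂ᵑ ┃ 0 ⊟ D.A₁† * D.C₁ ┃ 0 ⊟ 0 ┃ particular η D.A₃ D.C₃ * D.E₃ᵑ
      ⊟ 0 ┃ D.A₁† * D.C₁ ⊟ 0 ┃ particular η D.A₄ D.C₄ * D.E₄ᵑ)
    (particular η D.A₃ D.C₃ * D.E₃ᵑ ┃ 0 ⊟ D.A₁† * D.C₁ ┃ 0 ⊟ 0 ┃ particular η D.A₂ D.C₂ * D.E₂ᵑ
      ⊟ 0 ┃ D.A₁† * D.C₁ ⊟ particular η D.A₄ D.C₄ * D.E₄ᵑ ┃ 0) ?_ ?_ ?_).trans ?_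
  · simp only [Matrix.fromRows_mul, Matrix.fromCols_mul_fromRows, Matrix.mul_fromCols,
      Matrix.zero_mul, Matrix.mul_zero, add_zero, zero_add, mul_pinv_mul_eq hc.C₁,
      mul_particular_mul hc.C₂, mul_particular_mul hc.C₃, mul_particular_mul hc.C₄, P₂, P₃, P₄]
  · simp only [Matrix.fromRows_mul, Matrix.fromCols_mul_fromRows, Matrix.mul_fromCols,
      Matrix.zero_mul, Matrix.mul_zero, add_zero, zero_add, mul_pinv_mul_eq hc.C₁,
      mul_particular_mul hc.C₂, mul_particular_mul hc.C₃, mul_particular_mul hc.C₄, P₂, P₃, P₄]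
  · simp only [etaStar_fromRows, etaStar_fromCols, etaStar_zero, etaStar_neg]
    ext1 i j
    rcases i with (((i | i) | (i | i | i | i | i)) | i | i | i | i | i) <;>
      rcases j with (((j | j) | (j | j | j | j | j)) | j | j | j | j | j) <;> rfl
  · rw [← hT]
    simp only [mul_projL_blockDiagonal₅]
    simp only [forall_fromCols_iff, Matrix.fromRows_mul, Matrix.fromCols_mul_fromRows,
      Matrix.fromCols_mul_fromBlocks, etaStar_fromCols, Matrix.zero_mul, Matrix.mul_zero,
      Matrix.neg_mul, Matrix.mul_neg, add_zero, zero_add, ← A₁₁.eq_def, ← A₂₂.eq_def,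
      ← A₃₃.eq_def, ← A₄₄.eq_def, ← sub_eq_add_neg]
    constructor
    · intro h y₀ y₁ w₀ w₁ h1 h2 h3 h4 h5 h6 h7 h8 h9 h10
      exact h _ _ _ _ ⟨h1, h2, h3, h4, h5⟩ ⟨h6, h7, h8, h9, h10⟩
    · rintro h y₀ y₁ w₀ w₁ ⟨h1, h2, h3, h4, h5⟩ ⟨h6, h7, h8, h9, h10⟩
      exact h _ _ _ _ h1 h2 h3 h4 h5 h6 h7 h8 h9 h10

end System

/-! ### From annihilators to projector conditions -/

theorem forall_mul_mul_etaStar_eq_zero_iff {m n a b : Type*} [Fintype m] [Fintype n] [Fintype a]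
    [Fintype b] {η : ℍ[ℝ]} (hη : IsPureUnit η) {T : Matrix m n ℍ[ℝ]} {Q : Matrix a m ℍ[ℝ]}
    {Q' : Matrix b n ℍ[ℝ]} {κ : Matrix Unit m ℍ[ℝ] → Prop} {κ' : Matrix Unit n ℍ[ℝ] → Prop}
    (h : ∀ y, κ y ↔ ∃ z : Matrix Unit a ℍ[ℝ], z * Q = y) (h' : ∀ w, κ' w ↔ ∃ z : Matrix Unit b
        ℍ[ℝ], z * Q' = w) :
    (∀ y w, κ y → κ' w → y * T * etaStar η w = 0) ↔ Q * T * etaStar η Q' = 0 := by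
  constructor
  · intro H
    apply eq_zero_of_forall_mul_mul
    intro y x
    rw [← H _ _ ((h _).2 ⟨y, rfl⟩) ((h' _).2 ⟨etaStar η x, rfl⟩), etaStar_mul hη,
      etaStar_etaStar hη]
    simp only [Matrix.mul_assoc]
  · intro H y w hy hw
    obtain ⟨z, rfl⟩ := (h _).1 hy
    obtain ⟨z', rfl⟩ := (h' _).1 hw
    have : z * Q * T * etaStar η (z' * Q') = z * (Q * T * etaStar η Q') * etaStar η z' := by
      rw [etaStar_mul hη]
      simp only [Matrix.mul_assoc]
    rw [this, H, Matrix.mul_zero, Matrix.zero_mul]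

namespace System

variable {p m₁ m₂ m₃ m₄ n₁ n₂ n₃ n₄ : ℕ} {η : ℍ[ℝ]} {D : System p m₁ m₂ m₃ m₄ n₁ n₂ n₃ n₄}

local postfix:max "ᵑ" => etaStar η

section Annihilators

variable {k : Type*} {y : Matrix k (Fin p) ℍ[ℝ]}

theorem exists_mul_projR_A₁₁_iff : y * D.A₁₁ = 0 ↔ ∃ z : Matrix k (Fin p) ℍ[ℝ], z * projR D.A₁₁ = y
    := by
  constructor
  · exact fun h => ⟨y, mul_projR_of_mul_eq_zero h⟩
  · rintro ⟨z, rfl⟩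
    rw [Matrix.mul_assoc, EtaSylvester.projR_mul, Matrix.mul_zero]

theorem mul_A₁₂_eq (h : y * D.A₁₁ = 0) : y * D.A₁₂ = y * D.A₂₂ := by
  rw [A₁₂, ← Matrix.mul_assoc, mul_projR_of_mul_eq_zero h]

theorem mul_A₁₃_eq (h : y * D.A₁₁ = 0) : y * D.A₁₃ = y * D.A₃₃ := by
  rw [A₁₃, ← Matrix.mul_assoc, mul_projR_of_mul_eq_zero h]

theorem mul_A₁₄_eq (h : y * D.A₁₁ = 0) : y * D.A₁₄ = y * D.A₄₄ := by
  rw [A₁₄, ← Matrix.mul_assoc, mul_projR_of_mul_eq_zero h]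

theorem exists_mul_projR_A₁₂_iff : (y * D.A₂₂ = 0 ∧ y * D.A₁₁ = 0) ↔
    ∃ z : Matrix k (Fin p) ℍ[ℝ], z * (projR D.A₁₂ * projR D.A₁₁) = y := by
  constructor
  · rintro ⟨h2, h1⟩
    refine ⟨y, ?_⟩
    rw [← Matrix.mul_assoc, mul_projR_of_mul_eq_zero ((mul_A₁₂_eq h1).trans h2),
      mul_projR_of_mul_eq_zero h1]
  · rintro ⟨z, rfl⟩
    simp only [Matrix.mul_assoc, ← A₁₂.eq_def, EtaSylvester.projR_mul, Matrix.mul_zero, and_self]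

theorem exists_mul_projR_A₁₃_iff : (y * D.A₃₃ = 0 ∧ y * D.A₁₁ = 0) ↔
    ∃ z : Matrix k (Fin p) ℍ[ℝ], z * (projR D.A₁₃ * projR D.A₁₁) = y := by
  constructor
  · rintro ⟨h2, h1⟩
    refine ⟨y, ?_⟩
    rw [← Matrix.mul_assoc, mul_projR_of_mul_eq_zero ((mul_A₁₃_eq h1).trans h2),
      mul_projR_of_mul_eq_zero h1]
  · rintro ⟨z, rfl⟩
    simp only [Matrix.mul_assoc, ← A₁₃.eq_def, EtaSylvester.projR_mul, Matrix.mul_zero, and_self]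

/-- The conditions are imposed one at a time. A row killing A₁₁ is fixed by R_{A₁₁}; if it also
kills A₂₂ it is fixed by R_{A₁₂}; its product with M₁ is then its product with A₃₃. -/
theorem exists_mul_G_iff : (y * D.A₃₃ = 0 ∧ y * D.A₂₂ = 0 ∧ y * D.A₁₁ = 0) ↔
    ∃ z : Matrix k (Fin p) ℍ[ℝ], z * (D.G * projR D.A₁₁) = y := by
  constructor
  · rintro ⟨h3, h2, h1⟩
    have e : y * projR D.A₁₂ = y := mul_projR_of_mul_eq_zero ((mul_A₁₂_eq h1).trans h2)
    refine ⟨y, ?_⟩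
    have e' : y * projR D.M₁ = y :=
      mul_projR_of_mul_eq_zero (by rw [M₁, ← Matrix.mul_assoc, e, mul_A₁₃_eq h1, h3])
    rw [G, ← Matrix.mul_assoc, ← Matrix.mul_assoc, e', e, mul_projR_of_mul_eq_zero h1]
  · rintro ⟨z, rfl⟩
    simp only [Matrix.mul_assoc, ← A₁₂.eq_def, ← A₁₃.eq_def, G_mul_A₁₂, G_mul_A₁₃,
        EtaSylvester.projR_mul,
      Matrix.mul_zero, and_self]

theorem exists_mul_projR_G₄_iff : (y * D.A₄₄ = 0 ∧ y * D.A₁₁ = 0) ↔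
    ∃ z : Matrix k (Fin p) ℍ[ℝ], z * (projR D.G₄ * projR D.A₁₁) = y := by
  constructor
  · rintro ⟨h4, h1⟩
    refine ⟨y, ?_⟩
    rw [← Matrix.mul_assoc, mul_projR_of_mul_eq_zero (A := D.G₄), mul_projR_of_mul_eq_zero h1]
    rw [G₄, mul_A₁₄_eq h1, h4]
  · rintro ⟨z, rfl⟩
    simp only [Matrix.mul_assoc, ← A₁₄.eq_def, ← G₄.eq_def, EtaSylvester.projR_mul,
        Matrix.mul_zero, and_self]

theorem exists_mul_projR_G₂_iff : (y * D.A₄₄ = 0 ∧ y * D.A₂₂ = 0 ∧ y * D.A₁₁ = 0) ↔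
    ∃ z : Matrix k (Fin p) ℍ[ℝ], z * (projR D.G₂ * projR D.A₁₂ * projR D.A₁₁) = y := by
  constructor
  · rintro ⟨h4, h2, h1⟩
    have e : y * projR D.A₁₂ = y := mul_projR_of_mul_eq_zero ((mul_A₁₂_eq h1).trans h2)
    refine ⟨y, ?_⟩
    rw [Matrix.mul_assoc, ← Matrix.mul_assoc, mul_projR_of_mul_eq_zero (A := D.G₂),
      ← Matrix.mul_assoc, e, mul_projR_of_mul_eq_zero h1]
    rw [G₂, ← Matrix.mul_assoc, e, mul_A₁₄_eq h1, h4]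
  · rintro ⟨z, rfl⟩
    simp only [Matrix.mul_assoc, ← A₁₂.eq_def, ← A₁₄.eq_def, ← G₂.eq_def, EtaSylvester.projR_mul,
        Matrix.mul_zero,
      and_self]

theorem exists_mul_projR_G₃_iff : (y * D.A₄₄ = 0 ∧ y * D.A₃₃ = 0 ∧ y * D.A₁₁ = 0) ↔
    ∃ z : Matrix k (Fin p) ℍ[ℝ], z * (projR D.G₃ * projR D.A₁₃ * projR D.A₁₁) = y := by
  constructor
  · rintro ⟨h4, h2, h1⟩
    have e : y * projR D.A₁₃ = y := mul_projR_of_mul_eq_zero ((mul_A₁₃_eq h1).trans h2)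
    refine ⟨y, ?_⟩
    rw [Matrix.mul_assoc, ← Matrix.mul_assoc, mul_projR_of_mul_eq_zero (A := D.G₃),
      ← Matrix.mul_assoc, e, mul_projR_of_mul_eq_zero h1]
    rw [G₃, ← Matrix.mul_assoc, e, mul_A₁₄_eq h1, h4]
  · rintro ⟨z, rfl⟩
    simp only [Matrix.mul_assoc, ← A₁₃.eq_def, ← A₁₄.eq_def, ← G₃.eq_def, EtaSylvester.projR_mul,
        Matrix.mul_zero,
      and_self]

theorem exists_mul_projR_G₁_iff :
    (y * D.A₁₁ = 0 ∧ y * D.A₂₂ = 0 ∧ y * D.A₃₃ = 0 ∧ y * D.A₄₄ = 0) ↔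
      ∃ z : Matrix k (Fin p) ℍ[ℝ], z * (projR D.G₁ * D.G * projR D.A₁₁) = y := by
  constructor
  · rintro ⟨h1, h2, h3, h4⟩
    obtain ⟨z, hz⟩ := exists_mul_G_iff.1 ⟨h3, h2, h1⟩
    refine ⟨z, ?_⟩
    rw [Matrix.mul_assoc, ← Matrix.mul_assoc, mul_projR_of_mul_eq_zero (A := D.G₁), hz]
    rw [G₁, A₁₄, ← Matrix.mul_assoc D.G, ← Matrix.mul_assoc, hz, h4]
  · rintro ⟨z, rfl⟩
    simp only [Matrix.mul_assoc, ← A₁₂.eq_def, ← A₁₃.eq_def, ← A₁₄.eq_def, ← G₁.eq_def, G_mul_A₁₂,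
        G_mul_A₁₃,
      EtaSylvester.projR_mul, Matrix.mul_zero, and_self]

end Annihilators

/-- The two ways of comparing the remainders at `F₁` and `F₂` on the annihilators. -/
theorem pairing_eq (hη : IsPureUnit η) (k1 : D.G₂ * D.F₁ η * D.G₃ᵑ = D.L₂ η)
    (k2 : D.G₃ * D.F₂ η * D.G₂ᵑ = D.L₃ η) {y₀ y₁ w₀ w₁ : Matrix Unit (Fin p) ℍ[ℝ]}
    (hy₀ : y₀ * D.A₂₂ = 0 ∧ y₀ * D.A₁₁ = 0) (hy₁ : y₁ * D.A₃₃ = 0 ∧ y₁ * D.A₁₁ = 0)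
    (hw₀ : w₀ * D.A₃₃ = 0 ∧ w₀ * D.A₁₁ = 0) (hw₁ : w₁ * D.A₂₂ = 0 ∧ w₁ * D.A₁₁ = 0) :
    y₀ * D.T₁ η * w₀ᵑ = y₀ * D.A₄₄ * D.F₁ η * (w₀ * D.A₄₄)ᵑ ∧
      y₁ * D.T₁ η * w₁ᵑ = y₁ * D.A₄₄ * D.F₂ η * (w₁ * D.A₄₄)ᵑ := by
  have key₂ : ∀ y : Matrix Unit (Fin p) ℍ[ℝ], y * D.A₂₂ = 0 ∧ y * D.A₁₁ = 0 →
      y * projR D.A₁₂ = y ∧ y * projR D.A₁₁ = y ∧ y * D.G₂ = y * D.A₄₄ := by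
    rintro y ⟨h2, h1⟩
    have e : y * projR D.A₁₂ = y := mul_projR_of_mul_eq_zero ((mul_A₁₂_eq h1).trans h2)
    exact ⟨e, mul_projR_of_mul_eq_zero h1, by rw [G₂, ← Matrix.mul_assoc, e, mul_A₁₄_eq h1]⟩
  have key₃ : ∀ y : Matrix Unit (Fin p) ℍ[ℝ], y * D.A₃₃ = 0 ∧ y * D.A₁₁ = 0 →
      y * projR D.A₁₃ = y ∧ y * projR D.A₁₁ = y ∧ y * D.G₃ = y * D.A₄₄ := by
    rintro y ⟨h2, h1⟩
    have e : y * projR D.A₁₃ = y := mul_projR_of_mul_eq_zero ((mul_A₁₃_eq h1).trans h2)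
    exact ⟨e, mul_projR_of_mul_eq_zero h1, by rw [G₃, ← Matrix.mul_assoc, e, mul_A₁₄_eq h1]⟩
  have val : ∀ {a b : Matrix Unit (Fin p) ℍ[ℝ]} {Q Q' : Matrix (Fin p) (Fin p) ℍ[ℝ]},
      a * Q = a → a * projR D.A₁₁ = a → b * Q' = b → b * projR D.A₁₁ = b →
      a * (Q * D.T₂ η * Q'ᵑ) * bᵑ = a * D.T₁ η * bᵑ := by
    intro a b Q Q' h1 h2 h3 h4
    have h5 : Q'ᵑ * bᵑ = bᵑ := by rw [← etaStar_mul hη, h3]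
    have h6 : (projR D.A₁₁)ᵑ * bᵑ = bᵑ := by rw [← etaStar_mul hη, h4]
    simp only [T₂, Matrix.mul_assoc, h5, h6]
    rw [← Matrix.mul_assoc a Q, h1, ← Matrix.mul_assoc a, h2]
  constructor
  · obtain ⟨a1, a2, a3⟩ := key₂ y₀ hy₀
    obtain ⟨b1, b2, b3⟩ := key₃ w₀ hw₀
    rw [← val a1 a2 b1 b2, ← L₂, ← k1, ← a3, ← b3, etaStar_mul hη]
    simp only [Matrix.mul_assoc]
  · obtain ⟨a1, a2, a3⟩ := key₃ y₁ hy₁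
    obtain ⟨b1, b2, b3⟩ := key₂ w₁ hw₁
    rw [← val a1 a2 b1 b2, ← L₃, ← k2, ← a3, ← b3, etaStar_mul hη]
    simp only [Matrix.mul_assoc]

theorem forall_annihilator_iff₁ (hη : IsPureUnit η) :
    (∀ y w : Matrix Unit (Fin p) ℍ[ℝ],
      (y * D.A₁₁ = 0 ∧ y * D.A₂₂ = 0 ∧ y * D.A₃₃ = 0 ∧ y * D.A₄₄ = 0) → w * D.A₁₁ = 0 →
        y * D.T₁ η * wᵑ = 0) ↔ projR D.G₁ * D.L₁ η = 0 := by
  refine (forall_mul_mul_etaStar_eq_zero_iff hη (Q := projR D.G₁ * D.G * projR D.A₁₁)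
    (Q' := projR D.A₁₁) (fun y => exists_mul_projR_G₁_iff)
    (fun w => exists_mul_projR_A₁₁_iff)).trans ?_
  simp only [System.L₁, T₂, Matrix.mul_assoc]

theorem forall_annihilator_iff₂ (hη : IsPureUnit η) :
    (∀ y w : Matrix Unit (Fin p) ℍ[ℝ],
      (y * D.A₄₄ = 0 ∧ y * D.A₂₂ = 0 ∧ y * D.A₁₁ = 0) → (w * D.A₃₃ = 0 ∧ w * D.A₁₁ = 0) →
        y * D.T₁ η * wᵑ = 0) ↔ projR D.G₂ * D.L₂ η = 0 := by
  refine (forall_mul_mul_etaStar_eq_zero_iff hη (Q := projR D.G₂ * projR D.A₁₂ * projR D.A₁₁)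
    (Q' := projR D.A₁₃ * projR D.A₁₁) (fun y => exists_mul_projR_G₂_iff)
    (fun w => exists_mul_projR_A₁₃_iff)).trans ?_
  simp only [System.L₂, T₂, Matrix.mul_assoc, etaStar_mul hη]

theorem forall_annihilator_iff₃ (hη : IsPureUnit η) :
    (∀ y w : Matrix Unit (Fin p) ℍ[ℝ],
      (y * D.A₄₄ = 0 ∧ y * D.A₃₃ = 0 ∧ y * D.A₁₁ = 0) → (w * D.A₂₂ = 0 ∧ w * D.A₁₁ = 0) →
        y * D.T₁ η * wᵑ = 0) ↔ projR D.G₃ * D.L₃ η = 0 := by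
  refine (forall_mul_mul_etaStar_eq_zero_iff hη (Q := projR D.G₃ * projR D.A₁₃ * projR D.A₁₁)
    (Q' := projR D.A₁₂ * projR D.A₁₁) (fun y => exists_mul_projR_G₃_iff)
    (fun w => exists_mul_projR_A₁₂_iff)).trans ?_
  simp only [System.L₃, T₂, Matrix.mul_assoc, etaStar_mul hη]

theorem forall_annihilator_iff₄ (hη : IsPureUnit η) :
    (∀ y w : Matrix Unit (Fin p) ℍ[ℝ],
      (y * D.A₄₄ = 0 ∧ y * D.A₁₁ = 0) → (w * D.A₃₃ = 0 ∧ w * D.A₂₂ = 0 ∧ w * D.A₁₁ = 0) →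
        y * D.T₁ η * wᵑ = 0) ↔ projR D.G₄ * D.L₄ η = 0 := by
  refine (forall_mul_mul_etaStar_eq_zero_iff hη (Q := projR D.G₄ * projR D.A₁₁)
    (Q' := D.G * projR D.A₁₁) (fun y => exists_mul_projR_G₄_iff)
    (fun w => exists_mul_G_iff)).trans ?_
  simp only [System.L₄, T₂, Matrix.mul_assoc, etaStar_mul hη]

/-- zR_{E₂₂}R_{C₁₁} lies in the row space of G₂, since R_{C₁₁} = G₂†G₂, and in that of G₃, since it
annihilates L_{G₃}. Each membership provides one of the two rows. -/
theorem exists_eq_mul_projR_E₂₂ (z : Matrix Unit (Fin n₄) ℍ[ℝ]) :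
    ∃ y₀ y₁ : Matrix Unit (Fin p) ℍ[ℝ], (y₀ * D.A₂₂ = 0 ∧ y₀ * D.A₁₁ = 0) ∧
      (y₁ * D.A₃₃ = 0 ∧ y₁ * D.A₁₁ = 0) ∧ y₀ * D.A₄₄ = z * (projR D.E₂₂ * projR D.C₁₁) ∧
      y₁ * D.A₄₄ = z * (projR D.E₂₂ * projR D.C₁₁) := by
  have h3 : z * (projR D.E₂₂ * projR D.C₁₁) * projL D.G₃ = 0 := by
    rw [Matrix.mul_assoc, Matrix.mul_assoc, ← C₃₃, ← E₂₂, EtaSylvester.projR_mul, Matrix.mul_zero]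
  obtain ⟨b, hb⟩ := mul_projL_eq_zero_iff_exists.1 h3
  refine ⟨z * projR D.E₂₂ * D.G₂† * (projR D.A₁₂ * projR D.A₁₁), b * (projR D.A₁₃ * projR D.A₁₁),
    exists_mul_projR_A₁₂_iff.2 ⟨_, rfl⟩, exists_mul_projR_A₁₃_iff.2 ⟨_, rfl⟩, ?_, ?_⟩
  · rw [projR_C₁₁]
    simp only [Matrix.mul_assoc, G₂, A₁₄]
  · rw [hb]
    simp only [Matrix.mul_assoc, G₃, A₁₄]

/-- Converse of `exists_eq_mul_projR_E₂₂`: a common value of the two products lies in the row spaces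
of G₂ and G₃, hence is fixed by both projectors. -/
theorem mul_projR_E₂₂_mul_projR_C₁₁ {y w : Matrix Unit (Fin p) ℍ[ℝ]}
    (hy : y * D.A₂₂ = 0 ∧ y * D.A₁₁ = 0) (hw : w * D.A₃₃ = 0 ∧ w * D.A₁₁ = 0)
    {v : Matrix Unit (Fin n₄) ℍ[ℝ]} (hv : y * D.A₄₄ = v) (hv' : w * D.A₄₄ = v) :
    v * (projR D.E₂₂ * projR D.C₁₁) = v := by
  have h2 : v = y * projR D.A₁₂ * D.A₁₄ := by
    rw [mul_projR_of_mul_eq_zero ((mul_A₁₂_eq hy.2).trans hy.1), mul_A₁₄_eq hy.2, hv]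
  have h3 : v = w * projR D.A₁₃ * D.A₁₄ := by
    rw [mul_projR_of_mul_eq_zero ((mul_A₁₃_eq hw.2).trans hw.1), mul_A₁₄_eq hw.2, hv']
  rw [Matrix.mul_assoc, ← G₂] at h2
  rw [Matrix.mul_assoc, ← G₃] at h3
  have h4 : v * projR D.C₁₁ = v := by
    rw [projR_C₁₁, h2, Matrix.mul_assoc, ← Matrix.mul_assoc D.G₂, mul_pinv_mul]
  rw [← Matrix.mul_assoc, mul_projR_of_mul_eq_zero (A := D.E₂₂), h4]
  rw [E₂₂, ← Matrix.mul_assoc, h4, C₃₃, h3, Matrix.mul_assoc, mul_projL, Matrix.mul_zero]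

/-- The constraints force v = y₀A₄₄ = −y₁A₄₄ and w = w₀A₄₄ = w₁A₄₄. By `pairing_eq` the sum is then
vF₁w^{η*} − vF₂w^{η*} = −vFw^{η*}, and v, w range over the row space of R_{E₂₂}R_{C₁₁}. -/
theorem forall_annihilator_iff₅ (hη : IsPureUnit η)
    (k1 : D.G₂ * D.F₁ η * D.G₃ᵑ = D.L₂ η) (k2 : D.G₃ * D.F₂ η * D.G₂ᵑ = D.L₃ η) :
    (∀ y₀ y₁ w₀ w₁ : Matrix Unit (Fin p) ℍ[ℝ], y₀ * D.A₂₂ = 0 → y₀ * D.A₁₁ = 0 →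
      y₁ * D.A₃₃ = 0 → y₁ * D.A₁₁ = 0 → y₀ * D.A₄₄ + y₁ * D.A₄₄ = 0 → w₀ * D.A₃₃ = 0 →
      w₀ * D.A₁₁ = 0 → w₁ * D.A₂₂ = 0 → w₁ * D.A₁₁ = 0 → w₀ * D.A₄₄ - w₁ * D.A₄₄ = 0 →
      y₀ * D.T₁ η * w₀ᵑ + y₁ * D.T₁ η * w₁ᵑ = 0) ↔
      projR D.E₂₂ * D.E η * (projR D.E₂₂)ᵑ = 0 := by
  have hE : projR D.E₂₂ * D.E η * (projR D.E₂₂)ᵑ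
      = projR D.E₂₂ * projR D.C₁₁ * D.F η * (projR D.E₂₂ * projR D.C₁₁)ᵑ := by
    rw [System.E, etaStar_mul hη]
    simp only [Matrix.mul_assoc]
  rw [hE]
  constructor
  · intro H
    apply eq_zero_of_forall_mul_mul
    intro z x
    obtain ⟨y₀, y₁, hy₀, hy₁, e₀, e₁⟩ := exists_eq_mul_projR_E₂₂ (D := D) z
    obtain ⟨w₁, w₀, hw₁, hw₀, e₁', e₀'⟩ := exists_eq_mul_projR_E₂₂ (D := D) xᵑ
    have hy₁' : -y₁ * D.A₃₃ = 0 ∧ -y₁ * D.A₁₁ = 0 := by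
      rw [Matrix.neg_mul, Matrix.neg_mul, hy₁.1, hy₁.2, neg_zero, neg_zero]
      exact ⟨rfl, rfl⟩
    have h := H y₀ (-y₁) w₀ w₁ hy₀.1 hy₀.2 hy₁'.1 hy₁'.2
      (by rw [Matrix.neg_mul, e₀, e₁, add_neg_cancel]) hw₀.1 hw₀.2 hw₁.1 hw₁.2
      (by rw [e₀', e₁', sub_self])
    obtain ⟨p1, p2⟩ := pairing_eq hη k1 k2 hy₀ hy₁' hw₀ hw₁
    rw [p1, p2, Matrix.neg_mul, e₀, e₁, e₀', e₁', etaStar_mul hη, etaStar_etaStar hη] at h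
    rw [← neg_eq_zero, ← h, F]
    simp only [Matrix.mul_sub, Matrix.sub_mul, Matrix.neg_mul, Matrix.mul_assoc]
    abel
  · intro H y₀ y₁ w₀ w₁ a1 a2 a3 a4 a5 a6 a7 a8 a9 a10
    obtain ⟨p1, p2⟩ := pairing_eq hη k1 k2 ⟨a1, a2⟩ ⟨a3, a4⟩ ⟨a6, a7⟩ ⟨a8, a9⟩
    have hy := mul_projR_E₂₂_mul_projR_C₁₁ (w := -y₁) ⟨a1, a2⟩
      (by rw [Matrix.neg_mul, Matrix.neg_mul, a3, a4, neg_zero, neg_zero]; exact ⟨rfl, rfl⟩) rfl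
      (by rw [Matrix.neg_mul]; exact (eq_neg_of_add_eq_zero_left a5).symm)
    have hw := mul_projR_E₂₂_mul_projR_C₁₁ ⟨a8, a9⟩ ⟨a6, a7⟩ rfl (sub_eq_zero.1 a10)
    have h : y₀ * D.A₄₄ * D.F η * (w₁ * D.A₄₄)ᵑ = 0 := by
      rw [← hy, ← hw, etaStar_mul hη (w₁ * D.A₄₄)]
      have := congrArg (fun X => y₀ * D.A₄₄ * X * (w₁ * D.A₄₄)ᵑ) H
      simpa only [Matrix.mul_assoc, Matrix.mul_zero, Matrix.zero_mul] using this
    rw [p1, p2, eq_neg_of_add_eq_zero_right a5, sub_eq_zero.1 a10, ← neg_eq_zero, ← h, F]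
    simp only [Matrix.mul_sub, Matrix.sub_mul, Matrix.neg_mul]
    abel

theorem projectorConditions_iff_rankConditions (hη : IsPureUnit η) (hs : D.Symmetric η) :
    D.ProjectorConditions η ↔ D.RankConditions η := by
  constructor
  · intro h
    have hc := h.consistent
    obtain ⟨⟨-, k1⟩, k2, -⟩ := mul_F₁_mul_and_mul_F₂_mul hη hs h.L₁ h.L₂ h.L₃ h.L₄
    exact ⟨(rank_fromCols_eq_iff _ _).2 h.C₁, (rank_fromCols_eq_iff _ _).2 h.C₂,
      (rank_fromCols_eq_iff _ _).2 h.C₃, (rank_fromCols_eq_iff _ _).2 h.C₄,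
      (rank₁_iff hη hc).2 ((forall_annihilator_iff₁ hη).2 h.L₁),
      (rank₂_iff hη hs hc).2 ((forall_annihilator_iff₂ hη).2 h.L₂),
      (rank₃_iff hη hs hc).2 ((forall_annihilator_iff₃ hη).2 h.L₃),
      (rank₄_iff hη hs hc).2 ((forall_annihilator_iff₄ hη).2 h.L₄),
      (rank₅_iff hη hs hc).2 ((forall_annihilator_iff₅ hη k1 k2).2 h.E)⟩
  · intro h
    have c1 := (rank_fromCols_eq_iff _ _).1 h.C₁
    have c2 := (rank_fromCols_eq_iff _ _).1 h.C₂
    have c3 := (rank_fromCols_eq_iff _ _).1 h.C₃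
    have c4 := (rank_fromCols_eq_iff _ _).1 h.C₄
    have hc : D.Consistent := ⟨c1, c2, c3, c4⟩
    have h1 := (forall_annihilator_iff₁ hη).1 ((rank₁_iff hη hc).1 h.rank₁)
    have h2 := (forall_annihilator_iff₂ hη).1 ((rank₂_iff hη hs hc).1 h.rank₂)
    have h3 := (forall_annihilator_iff₃ hη).1 ((rank₃_iff hη hs hc).1 h.rank₃)
    have h4 := (forall_annihilator_iff₄ hη).1 ((rank₄_iff hη hs hc).1 h.rank₄)
    -- The first four conditions come first: the fifth equivalence needs F₁ and F₂ to solve the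
    -- equations for L₂ and L₃.
    obtain ⟨⟨-, k1⟩, k2, -⟩ := mul_F₁_mul_and_mul_F₂_mul hη hs h1 h2 h3 h4
    exact ⟨(forall_annihilator_iff₅ hη k1 k2).1 ((rank₅_iff hη hs hc).1 h.rank₅),
      c1, c2, c3, c4, h1, h2, h3, h4⟩

end System

/-- A purely imaginary η of norm one has conjugate −η, so −η² is its squared norm 1. -/
theorem isPureUnit_of_eq {η : ℍ[ℝ]}
    (hη : η = ⟨0, 1, 0, 0⟩ ∨ η = ⟨0, 0, 1, 0⟩ ∨ η = ⟨0, 0, 0, 1⟩) : IsPureUnit η := by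
  have h : η.re = 0 ∧ η.imI ^ 2 + η.imJ ^ 2 + η.imK ^ 2 = 1 := by
    rcases hη with rfl | rfl | rfl <;> norm_num
  have hs : star η = -η := Quaternion.star_eq_neg.2 h.1
  refine ⟨hs, ?_⟩
  have hn : Quaternion.normSq η = 1 := by
    rw [Quaternion.normSq_def', h.1]
    linarith [h.2]
  have := Quaternion.star_mul_self η
  rw [hs, hn, neg_mul, Quaternion.coe_one] at this
  rw [← this, neg_neg]

end EtaSylvester

theorem theorem4p1 {p m₁ m₂ m₃ m₄ n₁ n₂ n₃ n₄ : ℕ} (η : ℍ[ℝ])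
    (hη : η = ⟨0, 1, 0, 0⟩ ∨ η = ⟨0, 0, 1, 0⟩ ∨ η = ⟨0, 0, 0, 1⟩)
    (D : EtaSylvester.System p m₁ m₂ m₃ m₄ n₁ n₂ n₃ n₄) :
    List.TFAE
      [ ∃ U X Y Z, D.IsSolution η U X Y Z,
        D.Symmetric η ∧ D.ProjectorConditions η,
        D.Symmetric η ∧ D.RankConditions η ] ∧
    ((∃ U X Y Z, D.IsSolution η U X Y Z) →
      (∀ P : EtaSylvester.System.Parameters p n₁ n₂ n₃ n₄,
        D.IsUnconstrainedSolution η (D.Utilde η P) (D.Vtilde η P)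
          (D.Xtilde η P) (D.Ytilde η P) (D.Ztilde η P)) ∧
      (∀ U X Y Z, D.IsSolution η U X Y Z ↔
        ∃ P : EtaSylvester.System.Parameters p n₁ n₂ n₃ n₄,
          U = (1 / 2 : ℝ) • (D.Utilde η P + EtaSylvester.etaStar η (D.Vtilde η P)) ∧
          X = (1 / 2 : ℝ) • (D.Xtilde η P + EtaSylvester.etaStar η (D.Xtilde η P)) ∧
          Y = (1 / 2 : ℝ) • (D.Ytilde η P + EtaSylvester.etaStar η (D.Ytilde η P)) ∧
          Z = (1 / 2 : ℝ) • (D.Ztilde η P + EtaSylvester.etaStar η (D.Ztilde η P))) ∧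
      ∀ P : EtaSylvester.System.Parameters p n₁ n₂ n₃ n₄, D.U₃ η P = D.U₃' η P) := by
  have h := EtaSylvester.isPureUnit_of_eq hη
  refine ⟨?_, EtaSylvester.System.general_solution h⟩
  tfae_have 1 ↔ 2 := EtaSylvester.System.exists_isSolution_iff h
  tfae_have 2 ↔ 3 :=
    and_congr_right fun hs => EtaSylvester.System.projectorConditions_iff_rankConditions h hs
  tfae_finish
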